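/- Let $\mathcal H$ and $\mathcal H_o$ be complex Hilbert spaces and $n_o\ge 1$ an integer. Let $G\in\mathcal S_{n_o}(\mathcal H)$ and $\Lambda\in\mathcal S_{n_o}(\mathcal H_o)$, where the Schatten class $\mathcal S_p$ consists of the compact operators $K$ whose singular numbers (the eigenvalues of $|K|=\sqrt{K^*K}$, counted with multiplicities) form a sequence in $\ell^p$; its $\ell^p$ norm is $\|K\|_{\mathcal S_p}$. For $A\in\mathcal S_n$ let $\det_n(1-A)$ denote the $n$-regularized determinant, that is, the value at $A$ of the $\|\cdot\|_{\mathcal S_n}$-continuous extension of $$\det\nolimits_n(1-F)=\det(1-F)\,\exp\Big(\sum_{k=1}^{n-1}\tfrac1k\,\mathrm{trace}\,F^k\Big)$$ from the operators $F$ of finite rank; $\det=\det_1$ is the Fredholm determinant for trace class operators. Let $\mathcal H\hat\otimes\bigwedge^\nu\mathcal H_o$ be the Hilbert space tensor product of $\mathcal H$ with the $\nu$-th Hilbert space exterior power of $\mathcal H_o$, and $G\otimes\wedge^\nu\Lambda$ the operator induced on it by $G$ and $\Lambda$. Let $(Z_n)_{n\ge1}$ be a sequence in $\mathbb C$ such that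 $Z_n=\det(1-\Lambda^n)\,\mathrm{trace}\,G^n$ for all $n\ge n_o$, and put $\zeta_R(z)=\exp\big(\sum_{n=1}^\infty\frac{z^n}{n}Z_n\big)$. Then the power series $\sum_{n\ge1}\frac{z^n}{n}Z_n$ has a positive radius of convergence, and $\zeta_R$ extends from a neighbourhood of $0$ to a meromorphic function on $\mathbb C$, given by $$\zeta_R(z)=\exp\Big(\sum_{n=1}^{n_o-1}\frac{z^n}{n}Z_n\Big)\prod_{\nu=0}^{\dim\mathcal H_o}\Big(\det\nolimits_{n_o}\big(1-z\,G\otimes\wedge^\nu\Lambda\big)\Big)^{(-1)^{\nu+1}},$$ where $\nu$ runs through all integers $\nu\ge0$ if $\dim\mathcal H_o=\infty$. More precisely: each $G\otimes\wedge^\nu\Lambda$ lies in $\mathcal S_{n_o}$ and each $D_\nu(z)=\det_{n_o}(1-z\,G\otimes\wedge^\nu\Lambda)$ is an entire function of $z$; the series $\sum_\nu|D_\nu(z)-1|$ converges locally uniformly on $\mathbb C$; the set of zeros of the $D_\nu$ with $\nu$ even is closed and discrete in $\mathbb C$; and at every $z$ outside this set the product converges and the formula holds for the meromorphic continuation. 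-/

import Mathlib

open Filter Topology
open scoped ENNReal InnerProductSpace TensorProduct ComplexConjugate

namespace DynZeta

universe u v

/-! ### The Hilbert space structure of exterior powers -/

section Exterior

variable {H : Type u} [NormedAddCommGroup H] [InnerProductSpace ℂ H]
variable {K : Type v} [NormedAddCommGroup K] [InnerProductSpace ℂ K] {n : ℕ}

/-- The alternating form `y ↦ det (⟪x i, y j⟫)`. -/
noncomputable def gramAlt (x : Fin n → H) : H [⋀^Fin n]→ₗ[ℂ] ℂ :=
  Matrix.detRowAlternating.compLinearMap (LinearMap.pi fun i => innerₛₗ ℂ (x i))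

theorem gramAlt_apply (x y : Fin n → H) :
    gramAlt x y = (Matrix.of fun j i => ⟪x i, y j⟫_ℂ).det := rfl

theorem gramAlt_update (x y : Fin n → H) (i : Fin n) (a : H) :
    gramAlt (Function.update x i a) y
      = ((Matrix.of fun j i => ⟪x i, y j⟫_ℂ).updateCol i fun j => ⟪a, y j⟫_ℂ).det := by
  rw [gramAlt_apply]
  congr 1
  ext j k
  by_cases h : k = i
  · subst h; simp
  · simp [h]

theorem gramAlt_update_add (x : Fin n → H) (i : Fin n) (a b : H) :
    gramAlt (Function.update x i (a + b))
      = gramAlt (Function.update x i a) + gramAlt (Function.update x i b) := by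
  ext y
  rw [AlternatingMap.add_apply, gramAlt_update, gramAlt_update, gramAlt_update,
    ← Matrix.det_updateCol_add]
  congr 2
  ext j
  simp

theorem gramAlt_update_smul (x : Fin n → H) (i : Fin n) (c : ℂ) (a : H) :
    gramAlt (Function.update x i (c • a)) = conj c • gramAlt (Function.update x i a) := by
  ext y
  rw [AlternatingMap.smul_apply, gramAlt_update, gramAlt_update, smul_eq_mul,
    ← Matrix.det_updateCol_smul]
  congr 2
  ext j
  simp [mul_comm]

theorem gramAlt_eq_zero (x : Fin n → H) (i j : Fin n) (h : x i = x j) (hij : i ≠ j) :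
    gramAlt x = 0 := by
  ext y
  rw [gramAlt_apply]
  exact Matrix.det_zero_of_column_eq hij fun k => by simp [h]

/-- The alternating form `x ↦ conj ⟪x 0 ∧ ⋯ ∧ x (n - 1), v⟫`. -/
noncomputable def leftAlt (v : ⋀[ℂ]^n H) : H [⋀^Fin n]→ₗ[ℂ] ℂ where
  toFun x := conj (exteriorPower.alternatingMapLinearEquiv (gramAlt x) v)
  map_update_add' := by
    intro inst x i a b
    rw [Subsingleton.elim inst (instDecidableEqFin n), gramAlt_update_add]
    simp
  map_update_smul' := by
    intro inst x i c a
    rw [Subsingleton.elim inst (instDecidableEqFin n), gramAlt_update_smul]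
    simp
  map_eq_zero_of_eq' := by
    intro x i j h hij
    rw [gramAlt_eq_zero x i j h hij]
    simp

/-- The inner product of the exterior power: the sesquilinear form with
`⟪x 0 ∧ ⋯ ∧ x (n - 1), y 0 ∧ ⋯ ∧ y (n - 1)⟫ = det (⟪x i, y j⟫)`. -/
noncomputable instance extInner : Inner ℂ (⋀[ℂ]^n H) where
  inner u w := conj (exteriorPower.alternatingMapLinearEquiv (leftAlt w) u)

theorem extInner_def (u w : ⋀[ℂ]^n H) :
    ⟪u, w⟫_ℂ = conj (exteriorPower.alternatingMapLinearEquiv (leftAlt w) u) := rfl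

theorem extInner_ιMulti_left (x : Fin n → H) (w : ⋀[ℂ]^n H) :
    ⟪exteriorPower.ιMulti ℂ n x, w⟫_ℂ = exteriorPower.alternatingMapLinearEquiv (gramAlt x) w := by
  rw [extInner_def, exteriorPower.alternatingMapLinearEquiv_apply_ιMulti]
  simp [leftAlt]

theorem extInner_ιMulti (x y : Fin n → H) :
    ⟪exteriorPower.ιMulti ℂ n x, exteriorPower.ιMulti ℂ n y⟫_ℂ
      = (Matrix.of fun i j => ⟪x i, y j⟫_ℂ).det := by
  rw [extInner_ιMulti_left, exteriorPower.alternatingMapLinearEquiv_apply_ιMulti, gramAlt_apply,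
    ← Matrix.det_transpose]
  rfl

theorem extInner_add_left (u u' w : ⋀[ℂ]^n H) : ⟪u + u', w⟫_ℂ = ⟪u, w⟫_ℂ + ⟪u', w⟫_ℂ := by
  simp [extInner_def]

theorem extInner_smul_left (c : ℂ) (u w : ⋀[ℂ]^n H) : ⟪c • u, w⟫_ℂ = conj c * ⟪u, w⟫_ℂ := by
  simp [extInner_def]

theorem extInner_zero_left (w : ⋀[ℂ]^n H) : ⟪(0 : ⋀[ℂ]^n H), w⟫_ℂ = 0 := by
  simp [extInner_def]

theorem leftAlt_add (w w' : ⋀[ℂ]^n H) : leftAlt (w + w') = leftAlt w + leftAlt w' := by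
  ext x; simp [leftAlt]

theorem leftAlt_smul (c : ℂ) (w : ⋀[ℂ]^n H) : leftAlt (c • w) = conj c • leftAlt w := by
  ext x; simp [leftAlt]

theorem extInner_add_right (w u u' : ⋀[ℂ]^n H) : ⟪w, u + u'⟫_ℂ = ⟪w, u⟫_ℂ + ⟪w, u'⟫_ℂ := by
  simp [extInner_def, leftAlt_add]

theorem extInner_smul_right (c : ℂ) (w u : ⋀[ℂ]^n H) : ⟪w, c • u⟫_ℂ = c * ⟪w, u⟫_ℂ := by
  simp [extInner_def, leftAlt_smul]

theorem extInner_zero_right (w : ⋀[ℂ]^n H) : ⟪w, (0 : ⋀[ℂ]^n H)⟫_ℂ = 0 := by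
  simpa using extInner_smul_right (0 : ℂ) w 0

theorem ext_induction {p : ⋀[ℂ]^n H → Prop} (u : ⋀[ℂ]^n H)
    (hι : ∀ x, p (exteriorPower.ιMulti ℂ n x)) (h0 : p 0)
    (hadd : ∀ a b, p a → p b → p (a + b)) (hsmul : ∀ (c : ℂ) a, p a → p (c • a)) : p u := by
  have hu : u ∈ Submodule.span ℂ (Set.range (exteriorPower.ιMulti ℂ n (M := H))) := by
    rw [exteriorPower.ιMulti_span]; trivial
  induction hu using Submodule.span_induction with
  | mem y hy => obtain ⟨x, rfl⟩ := hy; exact hι x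
  | zero => exact h0
  | add a b _ _ ha hb => exact hadd a b ha hb
  | smul c a _ ha => exact hsmul c a ha

theorem extInner_conj_symm (u w : ⋀[ℂ]^n H) : conj ⟪w, u⟫_ℂ = ⟪u, w⟫_ℂ := by
  induction u using ext_induction with
  | hι x =>
    induction w using ext_induction with
    | hι y =>
      rw [extInner_ιMulti, extInner_ιMulti, RingHom.map_det, ← Matrix.det_transpose]
      congr 1
      ext i j
      simp
    | h0 => simp [extInner_zero_left, extInner_zero_right]
    | hadd a b ha hb => rw [extInner_add_left, extInner_add_right, map_add, ha, hb]
    | hsmul c a ha => rw [extInner_smul_left, extInner_smul_right, map_mul, ha]; simp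
  | h0 => simp [extInner_zero_left, extInner_zero_right]
  | hadd a b ha hb => rw [extInner_add_left, extInner_add_right, map_add, ha, hb]
  | hsmul c a ha => rw [extInner_smul_left, extInner_smul_right, map_mul, ha]

/-- Every element of the exterior power comes from a finite-dimensional subspace. -/
theorem ext_exists_finite (u : ⋀[ℂ]^n H) :
    ∃ V : Submodule ℂ H, FiniteDimensional ℂ V ∧
      ∃ w : ⋀[ℂ]^n V, exteriorPower.map n V.subtype w = u := by
  induction u using ext_induction with
  | hι x =>
    refine ⟨Submodule.span ℂ (Set.range x), FiniteDimensional.span_of_finite ℂ (Set.finite_range x),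
      exteriorPower.ιMulti ℂ n fun i => ⟨x i, Submodule.subset_span ⟨i, rfl⟩⟩, ?_⟩
    rw [exteriorPower.map_apply_ιMulti]
    rfl
  | h0 => exact ⟨⊥, inferInstance, 0, map_zero _⟩
  | hadd a b ha hb =>
    obtain ⟨V, hV, w, rfl⟩ := ha
    obtain ⟨V', hV', w', rfl⟩ := hb
    refine ⟨V ⊔ V', inferInstance, exteriorPower.map n (Submodule.inclusion le_sup_left) w
      + exteriorPower.map n (Submodule.inclusion le_sup_right) w', ?_⟩
    rw [map_add, ← LinearMap.comp_apply, ← LinearMap.comp_apply, ← exteriorPower.map_comp,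
      ← exteriorPower.map_comp]
    rfl
  | hsmul c a ha =>
    obtain ⟨V, hV, w, rfl⟩ := ha
    exact ⟨V, hV, c • w, map_smul _ _ _⟩

/-- If the vectors `f (b k)` are orthogonal with squared norms `μ k`, then so are their
exterior products, with squared norms the products of the `μ k`. -/
theorem extInner_family {ι : Type*} [LinearOrder ι] (f : ι → K) (μ : ι → ℝ)
    (hf : ∀ k l, ⟪f k, f l⟫_ℂ = if k = l then (μ k : ℂ) else 0) (s t : Set.powersetCard ι n) :
    ⟪exteriorPower.ιMulti_family ℂ n f s, exteriorPower.ιMulti_family ℂ n f t⟫_ℂ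
      = if s = t then ((∏ i, μ (Set.powersetCard.ofFinEmbEquiv.symm s i) : ℝ) : ℂ) else 0 := by
  rw [exteriorPower.ιMulti_family, exteriorPower.ιMulti_family, extInner_ιMulti]
  split_ifs with hst
  · subst hst
    rw [Complex.ofReal_prod, ← Matrix.det_diagonal]
    congr 1
    ext i j
    simp [hf, Matrix.diagonal_apply]
  · obtain ⟨i, his, hit⟩ := (Set.powersetCard.exists_mem_notMem_iff_ne s t).mp hst
    obtain ⟨k, rfl⟩ := (Set.powersetCard.mem_range_ofFinEmbEquiv_symm_iff_mem s i).mpr his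
    refine Matrix.det_eq_zero_of_row_eq_zero k fun j => ?_
    simp only [Matrix.of_apply, Function.comp_apply, hf]
    rw [if_neg]
    intro h
    exact hit ((Set.powersetCard.mem_range_ofFinEmbEquiv_symm_iff_mem t _).mp ⟨j, h.symm⟩)

theorem extInner_sum_left {ι : Type*} (s : Finset ι) (f : ι → ⋀[ℂ]^n H) (w : ⋀[ℂ]^n H) :
    ⟪∑ i ∈ s, f i, w⟫_ℂ = ∑ i ∈ s, ⟪f i, w⟫_ℂ := by
  simp [extInner_def]

theorem extInner_sum_right {ι : Type*} (s : Finset ι) (f : ι → ⋀[ℂ]^n H) (w : ⋀[ℂ]^n H) :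
    ⟪w, ∑ i ∈ s, f i⟫_ℂ = ∑ i ∈ s, ⟪w, f i⟫_ℂ := by
  classical
  induction s using Finset.induction_on with
  | empty => simp [extInner_zero_right]
  | insert a s ha ih => rw [Finset.sum_insert ha, Finset.sum_insert ha, extInner_add_right, ih]

theorem extInner_combination {ι : Type*} [LinearOrder ι] [Fintype ι] (f : ι → K) (μ : ι → ℝ)
    (hf : ∀ k l, ⟪f k, f l⟫_ℂ = if k = l then (μ k : ℂ) else 0)
    (c : Set.powersetCard ι n → ℂ) :
    ⟪∑ s, c s • exteriorPower.ιMulti_family ℂ n f s,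
      ∑ s, c s • exteriorPower.ιMulti_family ℂ n f s⟫_ℂ
      = ((∑ s, ‖c s‖ ^ 2 * ∏ i, μ (Set.powersetCard.ofFinEmbEquiv.symm s i) : ℝ) : ℂ) := by
  rw [extInner_sum_left, Complex.ofReal_sum]
  refine Finset.sum_congr rfl fun s _ => ?_
  rw [extInner_sum_right, Finset.sum_eq_single s]
  · rw [extInner_smul_left, extInner_smul_right, extInner_family f μ hf, if_pos rfl, ← mul_assoc,
      Complex.conj_mul']
    push_cast
    rfl
  · intro t _ hts
    rw [extInner_smul_left, extInner_smul_right, extInner_family f μ hf, if_neg hts.symm]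
    simp
  · simp

/-- A bounded operator, restricted to a finite-dimensional subspace, maps some orthonormal basis
to an orthogonal family. -/
theorem exists_orthogonal_image [CompleteSpace K] (V : Submodule ℂ H) [FiniteDimensional ℂ V]
    (f : H →L[ℂ] K) :
    ∃ (b : OrthonormalBasis (Fin (Module.finrank ℂ V)) ℂ V)
      (μ : Fin (Module.finrank ℂ V) → ℝ), (∀ k, 0 ≤ μ k ∧ μ k ≤ ‖f‖ ^ 2) ∧
        ∀ k l, ⟪f (b k), f (b l)⟫_ℂ = if k = l then (μ k : ℂ) else 0 := by
  have : CompleteSpace V := FiniteDimensional.complete ℂ V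
  let g : V →L[ℂ] K := f.comp V.subtypeL
  have hT : ((ContinuousLinearMap.adjoint g ∘L g : V →L[ℂ] V) : V →ₗ[ℂ] V).IsSymmetric := by
    intro x y
    simp [ContinuousLinearMap.adjoint_inner_left, ContinuousLinearMap.adjoint_inner_right]
  let b := hT.eigenvectorBasis rfl
  have key : ∀ k l, ⟪f (b k), f (b l)⟫_ℂ
      = if k = l then ((hT.eigenvalues rfl k : ℝ) : ℂ) else 0 := by
    intro k l
    have h1 : ⟪f (b k), f (b l)⟫_ℂ
        = ⟪((ContinuousLinearMap.adjoint g ∘L g : V →L[ℂ] V) : V →ₗ[ℂ] V) (b k), b l⟫_ℂ := by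
      simp [ContinuousLinearMap.adjoint_inner_left, g]
    rw [h1, hT.apply_eigenvectorBasis rfl k, inner_smul_left]
    have := orthonormal_iff_ite.mp b.orthonormal k l
    rw [show hT.eigenvectorBasis rfl k = b k from rfl, this]
    split_ifs <;> simp
  refine ⟨b, fun k => hT.eigenvalues rfl k, fun k => ?_, key⟩
  have hk : hT.eigenvalues rfl k = ‖f (b k)‖ ^ 2 := by
    have := key k k
    rw [if_pos rfl, inner_self_eq_norm_sq_to_K] at this
    have h2 : ((hT.eigenvalues rfl k : ℝ) : ℂ) = ((‖f (b k)‖ ^ 2 : ℝ) : ℂ) := by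
      rw [← this]; simp
    exact_mod_cast h2
  change 0 ≤ hT.eigenvalues rfl k ∧ hT.eigenvalues rfl k ≤ ‖f‖ ^ 2
  rw [hk]
  refine ⟨by positivity, ?_⟩
  have hb : ‖(b k : H)‖ = 1 := by
    have := b.orthonormal.1 k
    rwa [Submodule.coe_norm] at this
  have := f.le_opNorm (b k : H)
  rw [hb, mul_one] at this
  gcongr

theorem ext_exists_expansion [CompleteSpace K] (f : H →L[ℂ] K) (u : ⋀[ℂ]^n H) :
    ∃ (d : ℕ) (e : Fin d → H) (μ : Fin d → ℝ) (c : Set.powersetCard (Fin d) n → ℂ),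
      (∀ k l, ⟪e k, e l⟫_ℂ = if k = l then ((1 : ℝ) : ℂ) else 0) ∧
      (∀ k, 0 ≤ μ k ∧ μ k ≤ ‖f‖ ^ 2) ∧
      (∀ k l, ⟪(f ∘ e) k, (f ∘ e) l⟫_ℂ = if k = l then (μ k : ℂ) else 0) ∧
      u = ∑ s, c s • exteriorPower.ιMulti_family ℂ n e s ∧
      exteriorPower.map n (f : H →ₗ[ℂ] K) u
        = ∑ s, c s • exteriorPower.ιMulti_family ℂ n (f ∘ e) s := by
  obtain ⟨V, hV, w, rfl⟩ := ext_exists_finite u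
  obtain ⟨b, μ, hμ, hb⟩ := exists_orthogonal_image V f
  have hw := (b.toBasis.exteriorPower n).sum_repr w
  have h1 : exteriorPower.map n V.subtype w
      = ∑ s, (b.toBasis.exteriorPower n).repr w s •
        exteriorPower.ιMulti_family ℂ n (fun k => (b k : H)) s := by
    conv_lhs => rw [← hw]
    rw [map_sum]
    refine Finset.sum_congr rfl fun s _ => ?_
    rw [map_smul, exteriorPower.basis_apply, exteriorPower.map_apply_ιMulti_family]
    congr 2
  refine ⟨_, fun k => (b k : H), μ, (b.toBasis.exteriorPower n).repr w, ?_, hμ, hb, h1, ?_⟩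
  · intro k l
    have := orthonormal_iff_ite.mp b.orthonormal k l
    rw [← Submodule.coe_inner, this]
    split_ifs <;> simp
  · rw [h1, map_sum]
    refine Finset.sum_congr rfl fun s _ => ?_
    rw [map_smul, exteriorPower.map_apply_ιMulti_family]
    rfl

theorem extInner_nonneg (u : ⋀[ℂ]^n H) : 0 ≤ (⟪u, u⟫_ℂ).re := by
  obtain ⟨d, e, μ, c, he, -, -, rfl, -⟩ := ext_exists_expansion (0 : H →L[ℂ] ℂ) u
  rw [extInner_combination e (fun _ => 1) he, Complex.ofReal_re]
  exact Finset.sum_nonneg fun s _ => by simp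

theorem extInner_definite (u : ⋀[ℂ]^n H) (hu : ⟪u, u⟫_ℂ = 0) : u = 0 := by
  obtain ⟨d, e, μ, c, he, -, -, rfl, -⟩ := ext_exists_expansion (0 : H →L[ℂ] ℂ) u
  rw [extInner_combination e (fun _ => 1) he, Complex.ofReal_eq_zero,
    Finset.sum_eq_zero_iff_of_nonneg fun s _ => by simp] at hu
  refine Finset.sum_eq_zero fun s hs => ?_
  have := hu s hs
  simp only [Finset.prod_const_one, mul_one, ne_eq, OfNat.ofNat_ne_zero, not_false_eq_true,
    pow_eq_zero_iff, norm_eq_zero] at this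
  rw [this, zero_smul]

theorem extInner_map_le [CompleteSpace K] (f : H →L[ℂ] K) (u : ⋀[ℂ]^n H) :
    (⟪exteriorPower.map n (f : H →ₗ[ℂ] K) u, exteriorPower.map n (f : H →ₗ[ℂ] K) u⟫_ℂ).re
      ≤ (‖f‖ ^ n) ^ 2 * (⟪u, u⟫_ℂ).re := by
  obtain ⟨d, e, μ, c, he, hμ, hf, hu, hfu⟩ := ext_exists_expansion f u
  rw [hfu, extInner_combination (f ∘ e) μ hf, Complex.ofReal_re, hu,
    extInner_combination e (fun _ => 1) he, Complex.ofReal_re, Finset.mul_sum]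
  refine Finset.sum_le_sum fun s _ => ?_
  have h : ∏ i, μ (Set.powersetCard.ofFinEmbEquiv.symm s i) ≤ (‖f‖ ^ n) ^ 2 := by
    calc ∏ i, μ (Set.powersetCard.ofFinEmbEquiv.symm s i) ≤ ∏ _i : Fin n, ‖f‖ ^ 2 :=
          Finset.prod_le_prod (fun i _ => (hμ _).1) fun i _ => (hμ _).2
      _ = (‖f‖ ^ n) ^ 2 := by simp [← pow_mul, mul_comm]
  rw [Finset.prod_const_one, mul_one, mul_comm]
  gcongr

noncomputable instance extNormedAddCommGroup : NormedAddCommGroup (⋀[ℂ]^n H) :=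
  letI : InnerProductSpace.Core ℂ (⋀[ℂ]^n H) :=
  { conj_inner_symm := extInner_conj_symm
    add_left := extInner_add_left
    smul_left u w c := extInner_smul_left c u w
    definite := extInner_definite
    re_inner_nonneg := extInner_nonneg }
  this.toNormedAddCommGroup

noncomputable instance extInnerProductSpace : InnerProductSpace ℂ (⋀[ℂ]^n H) := .ofCore _

/-- The inner product of the Hilbert space structure is the Gram determinant. -/
theorem inner_ιMulti (x y : Fin n → H) :
    ⟪exteriorPower.ιMulti ℂ n x, exteriorPower.ιMulti ℂ n y⟫_ℂ
      = (Matrix.of fun i j => ⟪x i, y j⟫_ℂ).det :=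
  extInner_ιMulti x y

theorem norm_ext_map_le [CompleteSpace K] (f : H →L[ℂ] K) (u : ⋀[ℂ]^n H) :
    ‖exteriorPower.map n (f : H →ₗ[ℂ] K) u‖ ≤ ‖f‖ ^ n * ‖u‖ := by
  refine le_of_sq_le_sq ?_ (by positivity)
  rw [mul_pow, ← inner_self_eq_norm_sq (𝕜 := ℂ), ← inner_self_eq_norm_sq (𝕜 := ℂ)]
  exact extInner_map_le f u

/-- The bounded operator `f ∧ ⋯ ∧ f` on the algebraic exterior power. -/
noncomputable def extMapL [CompleteSpace K] (n : ℕ) (f : H →L[ℂ] K) : ⋀[ℂ]^n H →L[ℂ] ⋀[ℂ]^n K :=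
  (exteriorPower.map n (f : H →ₗ[ℂ] K)).mkContinuous (‖f‖ ^ n) (norm_ext_map_le f)

end Exterior

/-! ### Hilbert tensor products and exterior powers of operators -/

section Operators

variable (H : Type u) [NormedAddCommGroup H] [InnerProductSpace ℂ H]
variable (K : Type v) [NormedAddCommGroup K] [InnerProductSpace ℂ K]

/-- The Hilbert space tensor product: the completion of the algebraic tensor product for
`⟪x ⊗ y, x' ⊗ y'⟫ = ⟪x, x'⟫ ⟪y, y'⟫`. -/
abbrev HilbertTensor : Type (max u v) := UniformSpace.Completion (H ⊗[ℂ] K)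

/-- The Hilbert space exterior power: the completion of the algebraic exterior power for
`⟪x 0 ∧ ⋯ ∧ x (n - 1), y 0 ∧ ⋯ ∧ y (n - 1)⟫ = det (⟪x i, y j⟫)`. -/
abbrev HilbertExterior (n : ℕ) : Type u := UniformSpace.Completion (⋀[ℂ]^n H)

variable {H K}

/-- The operator `A ⊗ B` on the Hilbert space tensor product. -/
noncomputable def opTensor (A : H →L[ℂ] H) (B : K →L[ℂ] K) :
    HilbertTensor H K →L[ℂ] HilbertTensor H K :=
  (TensorProduct.mapL A B).completion

/-- The operator `A ∧ ⋯ ∧ A` (`n` factors) on the Hilbert space exterior power. -/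
noncomputable def opExterior [CompleteSpace H] (n : ℕ) (A : H →L[ℂ] H) :
    HilbertExterior H n →L[ℂ] HilbertExterior H n :=
  (extMapL n A).completion

end Operators

/-! ### Schatten classes, traces and regularized determinants -/

section Schatten

variable {H : Type u} [NormedAddCommGroup H] [InnerProductSpace ℂ H] [CompleteSpace H]

/-- The multiplicity of `s` as a singular number of `A`, that is, as an eigenvalue of
`|A| = √(A⋆ A)`. -/
noncomputable def singularMultiplicity (A : H →L[ℂ] H) (s : ℝ) : ℕ :=
  Module.finrank ℂ (Module.End.eigenspace ((CFC.abs A : H →L[ℂ] H) : H →ₗ[ℂ] H) (s : ℂ))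

open Classical in
/-- The Schatten norm of a bounded operator, with value `∞` if the operator is not compact: the
`ℓ^p` norm of the sequence of the singular numbers, counted with multiplicities (vanishing
singular numbers contribute nothing). -/
noncomputable def schattenNorm (p : ℝ) (A : H →L[ℂ] H) : ℝ≥0∞ :=
  if IsCompactOperator A then
    (∑' s : Set.Ioi (0 : ℝ), (singularMultiplicity A s : ℝ≥0∞) * ENNReal.ofReal s ^ p) ^ (1 / p)
  else ∞

/-- The Schatten class of exponent `p`. -/
def IsSchatten (p : ℝ) (A : H →L[ℂ] H) : Prop := schattenNorm p A < ∞

/-- The trace of a trace class operator, computed in an orthonormal basis of the Hilbert space. -/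
noncomputable def trace (A : H →L[ℂ] H) : ℂ :=
  ∑' i : (exists_hilbertBasis ℂ H).choose, ⟪(i : H), A i⟫_ℂ

/-- `A` has finite rank. -/
def IsFiniteRank (A : H →L[ℂ] H) : Prop := FiniteDimensional ℂ (LinearMap.range (A : H →ₗ[ℂ] H))

/-- `det (1 - A)` for an operator of finite rank: the determinant of the restriction of `1 - A`
to the range of `A`. -/
noncomputable def finiteRankDet (A : H →L[ℂ] H) : ℂ :=
  LinearMap.det (LinearMap.id -
    (A : H →ₗ[ℂ] H).rangeRestrict ∘ₗ (LinearMap.range (A : H →ₗ[ℂ] H)).subtype)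

/-- `det (1 - A) exp (∑_{k=1}^{n-1} tr (A ^ k) / k)` for an operator of finite rank. -/
noncomputable def finiteRankRegDet (n : ℕ) (A : H →L[ℂ] H) : ℂ :=
  finiteRankDet A * Complex.exp (∑ k ∈ Finset.Ico 1 n, 1 / (k : ℂ) * trace (A ^ k))

/-- The `n`-regularized determinant `det_n (1 - A)` for `A` in the Schatten class of exponent `n`:
the continuous extension of `finiteRankRegDet n` from the operators of finite rank, that is, its
limit along operators `F` of finite rank with `‖F - A‖_{S_n} → 0`. -/
noncomputable def regDet (n : ℕ) (A : H →L[ℂ] H) : ℂ :=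
  limUnder (comap (fun F : H →L[ℂ] H => schattenNorm n (F - A)) (𝓝 0) ⊓ 𝓟 {F | IsFiniteRank F})
    (finiteRankRegDet n)

/-- The Fredholm determinant `det (1 - A)` of a trace class operator. -/
noncomputable def fredholmDet (A : H →L[ℂ] H) : ℂ := regDet 1 A

end Schatten

/-! ### Dynamical zeta functions -/

/-- The dynamical zeta function `exp (∑_{n ≥ 1} z ^ n / n * Z n)` of a sequence. -/
noncomputable def zetaR (Z : ℕ → ℂ) (z : ℂ) : ℂ :=
  Complex.exp (∑' n : ℕ+, z ^ (n : ℕ) / (n : ℂ) * Z n)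

/-- The function `z ↦ det_{n₀} (1 - z G ⊗ ∧^ν Λ)`. -/
noncomputable def factorDet {H : Type u} [NormedAddCommGroup H] [InnerProductSpace ℂ H]
    {H₀ : Type v} [NormedAddCommGroup H₀] [InnerProductSpace ℂ H₀] [CompleteSpace H₀]
    (n₀ : ℕ) (G : H →L[ℂ] H) (Λ : H₀ →L[ℂ] H₀) (ν : ℕ) (z : ℂ) : ℂ :=
  regDet n₀ (z • opTensor G (opExterior ν Λ))

/-- The index set `{0, …, dim H₀}`, equal to `ℕ` if `H₀` is infinite-dimensional. -/
abbrev DimIndex (H₀ : Type v) [AddCommGroup H₀] [Module ℂ H₀] : Type :=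
  {ν : ℕ // (ν : Cardinal.{v}) ≤ Module.rank ℂ H₀}

end DynZeta

open Filter Topology
open scoped ENNReal InnerProductSpace TensorProduct ComplexConjugate

/-! Write `A_ν = G ⊗ ∧^ν Λ`. For a trace class operator `X` the Fredholm determinant is `det (1 - X)
= ∑ (-1)^ν tr ∧^ν X`. Taking `X = Λ^m` and using `tr (B ⊗ C) = tr B * tr C`, the hypothesis becomes
`Z m = ∑ (-1)^ν tr (A_ν ^ m)` for `m ≥ n₀` (`hasSum_trace_opTensor_opExterior`). For small `z`,
`det_{n₀} (1 - z A_ν) = exp (-∑_{k ≥ n₀} z^k tr (A_ν ^ k) / k)` (`regDet_eq_exp`). Interchanging the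
sums over `k` and `ν` gives the product formula near the origin.

The rest is convergence. If `s_k` are the singular numbers of `Λ`, those of `∧^ν Λ` are the products
of `s_k` over `ν`-element index sets, so the `p`-th powers of the Schatten norms sum over `ν` to at
most `∏ (1 + s_k^p) < ∞` (`exists_opExterior_bounds`). Since `det_n (1 - z A) - 1 = O (‖z A‖^n)` for
small `z A`, the factors converge normally on discs, and the odd product divided by the even one is
meromorphic on the whole plane.

Schatten norms are handled through `SBound`: a bound for the `ℓ^p` norm of the coefficients `⟪f j, A
(e j)⟫` over all finite orthonormal families. For a compact operator and `p ≥ 1` this agrees with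
the definition by singular numbers (`schattenNorm_le_ofReal_iff`), and it makes Minkowski's
inequality, limits and eigenvalue bounds immediate. Hölder's inequality (`sBound_list_prod`) makes
powers trace class. Lidskii's theorem is needed only in finite rank, where Schur triangularization
suffices. There the regularized determinant is a product of Weierstrass factors, hence at most `exp
(C M^n)`, and the Schwarz lemma turns this growth bound into a Lipschitz bound, which yields the
continuous extension. -/

namespace DynZeta

universe u v

/-! ### Schatten norms as bounds on matrix coefficients -/

section SchattenBounds

variable {H : Type u} [NormedAddCommGroup H] [InnerProductSpace ℂ H]

/-- Jensen's inequality for a doubly substochastic matrix. -/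
theorem sum_rpow_weighted_le {ι κ : Type*} (s : Finset ι) (t : Finset κ) (w : κ → ι → ℝ)
    (x : ι → ℝ) (hw : ∀ j k, 0 ≤ w j k) (h1 : ∀ j ∈ t, ∑ k ∈ s, w j k ≤ 1)
    (h2 : ∀ k ∈ s, ∑ j ∈ t, w j k ≤ 1) (hx : ∀ k, 0 ≤ x k) {r : ℝ} (hr : 1 ≤ r) :
    ∑ j ∈ t, (∑ k ∈ s, w j k * x k) ^ r ≤ ∑ k ∈ s, x k ^ r := by
  have key : ∀ j ∈ t, (∑ k ∈ s, w j k * x k) ^ r ≤ ∑ k ∈ s, w j k * x k ^ r := by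
    intro j hj
    have hW0 : 0 ≤ ∑ k ∈ s, w j k := Finset.sum_nonneg fun k _ => hw j k
    set W := ∑ k ∈ s, w j k with hW
    -- The weights of a row sum to `W ≤ 1`, not to `1`, so Jensen is applied to `w / W`; the
    -- remaining factor is absorbed by `W ^ r ≤ W`.
    rcases hW0.eq_or_lt with h0 | h0
    · have hz : ∀ k ∈ s, w j k = 0 :=
        (Finset.sum_eq_zero_iff_of_nonneg fun k _ => hw j k).mp (hW ▸ h0.symm)
      rw [Finset.sum_eq_zero fun k hk => by rw [hz k hk, zero_mul],
        Real.zero_rpow (by linarith)]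
      exact Finset.sum_nonneg fun k _ => mul_nonneg (hw j k) (Real.rpow_nonneg (hx k) _)
    · have hJ := Real.rpow_arith_mean_le_arith_mean_rpow s (fun k => w j k / W) x
        (fun k _ => div_nonneg (hw j k) h0.le)
        (by rw [← Finset.sum_div, ← hW, div_self h0.ne']) (fun k _ => hx k) hr
      have e1 : ∑ k ∈ s, w j k * x k = W * ∑ k ∈ s, w j k / W * x k := by
        rw [Finset.mul_sum]
        refine Finset.sum_congr rfl fun k _ => ?_
        field_simp
      have e2 : ∑ k ∈ s, w j k * x k ^ r = W * ∑ k ∈ s, w j k / W * x k ^ r := by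
        rw [Finset.mul_sum]
        refine Finset.sum_congr rfl fun k _ => ?_
        field_simp
      have h3 : 0 ≤ ∑ k ∈ s, w j k / W * x k :=
        Finset.sum_nonneg fun k _ => mul_nonneg (div_nonneg (hw j k) h0.le) (hx k)
      rw [e1, e2, Real.mul_rpow h0.le h3]
      have h4 : W ^ r ≤ W := by
        simpa using Real.rpow_le_rpow_of_exponent_ge h0 (h1 j hj) hr
      exact mul_le_mul h4 hJ (Real.rpow_nonneg h3 _) h0.le
  calc _ ≤ ∑ j ∈ t, ∑ k ∈ s, w j k * x k ^ r := Finset.sum_le_sum key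
    _ = ∑ k ∈ s, (∑ j ∈ t, w j k) * x k ^ r := by
        rw [Finset.sum_comm]; simp_rw [Finset.sum_mul]
    _ ≤ ∑ k ∈ s, x k ^ r := by
        refine Finset.sum_le_sum fun k hk => ?_
        exact mul_le_of_le_one_left (Real.rpow_nonneg (hx k) _) (h2 k hk)

/-- Bessel's inequality for pairwise orthogonal vectors that are normalized or zero. -/
theorem bessel_of_orthogonal {ι : Type*} (f : ι → H) (hf : ∀ k l, k ≠ l → ⟪f k, f l⟫_ℂ = 0)
    (hn : ∀ k, ‖f k‖ = 1 ∨ f k = 0) (s : Finset ι) (y : H) :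
    ∑ k ∈ s, ‖⟪f k, y⟫_ℂ‖ ^ 2 ≤ ‖y‖ ^ 2 := by
  classical
  have hort : Orthonormal ℂ fun k : {k // f k ≠ 0} => f k :=
    ⟨fun k => (hn k).resolve_right k.2, fun k l hkl => hf k l fun h => hkl (Subtype.ext h)⟩
  have h := hort.sum_inner_products_le y (s := s.subtype fun k => f k ≠ 0)
  rw [Finset.sum_subtype_eq_sum_filter (fun k => ‖⟪f k, y⟫_ℂ‖ ^ 2), Finset.sum_filter] at h
  refine le_trans (Finset.sum_le_sum fun k _ => ?_) h
  split_ifs with h0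
  · exact le_rfl
  · rw [not_not] at h0
    simp [h0]

/-- `M` bounds the Schatten norm of `A` of exponent `p`, in terms of matrix coefficients. -/
def SBound (p : ℝ) (A : H →L[ℂ] H) (M : ℝ) : Prop :=
  0 ≤ M ∧ ∀ (n : ℕ) (e f : Fin n → H), Orthonormal ℂ e → Orthonormal ℂ f →
    ∑ j, ‖⟪f j, A (e j)⟫_ℂ‖ ^ p ≤ M ^ p

theorem SBound.sum_le {p : ℝ} {A : H →L[ℂ] H} {M : ℝ} (h : SBound p A M) {κ : Type*} [Fintype κ]
    {e f : κ → H} (he : Orthonormal ℂ e) (hf : Orthonormal ℂ f) :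
    ∑ j, ‖⟪f j, A (e j)⟫_ℂ‖ ^ p ≤ M ^ p := by
  let σ := (Fintype.equivFin κ).symm
  rw [← σ.sum_comp]
  exact h.2 _ (e ∘ σ) (f ∘ σ) (he.comp _ σ.injective) (hf.comp _ σ.injective)

theorem SBound.sum_finset_le {p : ℝ} {A : H →L[ℂ] H} {M : ℝ} (h : SBound p A M) {κ : Type*}
    (s : Finset κ) {e f : κ → H} (he : Orthonormal ℂ e) (hf : Orthonormal ℂ f) :
    ∑ j ∈ s, ‖⟪f j, A (e j)⟫_ℂ‖ ^ p ≤ M ^ p := by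
  rw [← Finset.sum_coe_sort]
  exact h.sum_le (he.comp _ Subtype.coe_injective) (hf.comp _ Subtype.coe_injective)

/-- The direction of `A (b k)`. -/
noncomputable def imageDir (A : H →L[ℂ] H) {κ : Type*} (b : κ → H) (k : κ) : H :=
  ((‖A (b k)‖ : ℂ)⁻¹) • A (b k)

theorem norm_smul_imageDir (A : H →L[ℂ] H) {κ : Type*} (b : κ → H) (k : κ) :
    (‖A (b k)‖ : ℂ) • imageDir A b k = A (b k) := by
  by_cases h : A (b k) = 0
  · simp [h]
  · have : (‖A (b k)‖ : ℂ) ≠ 0 := by simpa using h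
    rw [imageDir, smul_smul, mul_inv_cancel₀ this, one_smul]

theorem norm_imageDir (A : H →L[ℂ] H) {κ : Type*} (b : κ → H) (k : κ) :
    ‖imageDir A b k‖ = 1 ∨ imageDir A b k = 0 := by
  by_cases h : A (b k) = 0
  · right; simp [imageDir, h]
  · left
    rw [imageDir, norm_smul, norm_inv, Complex.norm_real, norm_norm,
      inv_mul_cancel₀ (norm_ne_zero_iff.mpr h)]

theorem inner_imageDir {A : H →L[ℂ] H} {κ : Type*} {b : κ → H}
    (h : ∀ k l, k ≠ l → ⟪A (b k), A (b l)⟫_ℂ = 0) (k l : κ) (hkl : k ≠ l) :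
    ⟪imageDir A b k, imageDir A b l⟫_ℂ = 0 := by
  rw [imageDir, imageDir, inner_smul_left, inner_smul_right, h k l hkl, mul_zero, mul_zero]

/-- The directions of the nonzero vectors `A (b k)` are themselves orthonormal. Testing `SBound` on
`b` against these directions gives coefficients of modulus exactly `‖A (b k)‖`. -/
theorem SBound.sum_norm_le {p : ℝ} (hp : 1 ≤ p) {A : H →L[ℂ] H} {M : ℝ} (h : SBound p A M)
    {κ : Type*} {b : κ → H} (hb : Orthonormal ℂ b)
    (ho : ∀ k l, k ≠ l → ⟪A (b k), A (b l)⟫_ℂ = 0) (s : Finset κ) :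
    ∑ k ∈ s, ‖A (b k)‖ ^ p ≤ M ^ p := by
  classical
  let q : κ → Prop := fun k => A (b k) ≠ 0
  have hort : Orthonormal ℂ fun k : {k // q k} => imageDir A b k := by
    refine ⟨fun k => (norm_imageDir A b k).resolve_right fun h0 => k.2 ?_, fun k l hkl =>
      inner_imageDir ho k l fun h => hkl (Subtype.ext h)⟩
    rw [← norm_smul_imageDir A b k, h0, smul_zero]
  have h1 := h.sum_finset_le (s.subtype q) (hb.comp _ Subtype.coe_injective) hort
  have h2 : ∀ k, ‖⟪imageDir A b k, A (b k)⟫_ℂ‖ = ‖A (b k)‖ := by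
    intro k
    by_cases h : A (b k) = 0
    · simp [h]
    · rw [imageDir, inner_smul_left, inner_self_eq_norm_sq_to_K, norm_mul]
      have : ‖A (b k)‖ ≠ 0 := norm_ne_zero_iff.mpr h
      simp
      field_simp
  simp only [Function.comp_apply, h2] at h1
  rw [Finset.sum_subtype_eq_sum_filter (fun k => ‖A (b k)‖ ^ p), Finset.sum_filter] at h1
  refine le_trans (Finset.sum_le_sum fun k _ => ?_) h1
  split_ifs with h0
  · exact le_rfl
  · rw [not_not] at h0
    rw [h0, norm_zero, Real.zero_rpow (by linarith)]

/-- Singular numbers dominate matrix coefficients: each term carries `‖A (b k)‖` times a product of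
two inner products, which is at most the mean of their squares. By Bessel in both indices these
means form a doubly substochastic matrix, and Jensen applies. -/
theorem sum_norm_inner_sum_le {A : H →L[ℂ] H} {κ : Type*} {b : κ → H} (hb : Orthonormal ℂ b)
    (ho : ∀ k l, k ≠ l → ⟪A (b k), A (b l)⟫_ℂ = 0) {p : ℝ} (hp : 1 ≤ p) (s : Finset κ)
    {μ : Type*} [Fintype μ] {e f : μ → H} (he : Orthonormal ℂ e) (hf : Orthonormal ℂ f) :
    ∑ j, ‖∑ k ∈ s, ⟪b k, e j⟫_ℂ * ⟪f j, A (b k)⟫_ℂ‖ ^ p ≤ ∑ k ∈ s, ‖A (b k)‖ ^ p := by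
  let w : μ → κ → ℝ := fun j k =>
    (‖⟪b k, e j⟫_ℂ‖ ^ 2 + ‖⟪imageDir A b k, f j⟫_ℂ‖ ^ 2) / 2
  have hbes := fun y => bessel_of_orthogonal (imageDir A b) (inner_imageDir ho)
    (norm_imageDir A b) s y
  have hone : ∀ k, ‖imageDir A b k‖ ^ 2 ≤ 1 := by
    intro k
    rcases norm_imageDir A b k with h | h <;> simp [h]
  refine le_trans (Finset.sum_le_sum fun j _ => ?_)
    (sum_rpow_weighted_le s Finset.univ w (fun k => ‖A (b k)‖) (fun j k => by positivity)
      (fun j _ => ?_) (fun k _ => ?_) (fun k => norm_nonneg _) hp)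
  · refine Real.rpow_le_rpow (norm_nonneg _) ?_ (by linarith)
    refine (norm_sum_le _ _).trans (Finset.sum_le_sum fun k _ => ?_)
    conv_lhs => rw [← norm_smul_imageDir A b k]
    rw [inner_smul_right, norm_mul, norm_mul, Complex.norm_real, norm_norm,
      norm_inner_symm (f j)]
    have := two_mul_le_add_sq ‖⟪b k, e j⟫_ℂ‖ ‖⟪imageDir A b k, f j⟫_ℂ‖
    calc _ = (‖⟪b k, e j⟫_ℂ‖ * ‖⟪imageDir A b k, f j⟫_ℂ‖) * ‖A (b k)‖ := by ring
      _ ≤ w j k * ‖A (b k)‖ := by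
        gcongr
        simp only [w]
        linarith
  · have h1 := hb.sum_inner_products_le (e j) (s := s)
    have h2 := hbes (f j)
    rw [he.1 j] at h1
    rw [hf.1 j] at h2
    simp only [w]
    rw [← Finset.sum_div, Finset.sum_add_distrib]
    linarith
  · have h1 := he.sum_inner_products_le (b k) (s := Finset.univ)
    have h2 := hf.sum_inner_products_le (imageDir A b k) (s := Finset.univ)
    rw [hb.1 k] at h1
    simp only [w]
    rw [← Finset.sum_div, Finset.sum_add_distrib]
    simp_rw [norm_inner_symm (b k), norm_inner_symm (imageDir A b k)]
    linarith [hone k]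

/-- An orthonormal basis that an operator maps to an orthogonal family. -/
def IsSingularBasis (A : H →L[ℂ] H) {ι : Type*} (e : HilbertBasis ι ℂ H) : Prop :=
  ∀ k l, k ≠ l → ⟪A (e k), A (e l)⟫_ℂ = 0

theorem hasSum_inner_smul_apply (A : H →L[ℂ] H) {ι : Type*} (e : HilbertBasis ι ℂ H) (x : H) :
    HasSum (fun k => ⟪e k, x⟫_ℂ • A (e k)) (A x) := by
  have := (e.hasSum_repr x).mapL A
  simpa [HilbertBasis.repr_apply_apply] using this

/-- Expanding the arguments in `e`, the partial sums satisfy the finite inequality above, which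
survives the limit. On a singular basis the bound therefore only has to be checked on the numbers
`‖A (e k)‖`. -/
theorem IsSingularBasis.sBound {A : H →L[ℂ] H} {ι : Type*} {e : HilbertBasis ι ℂ H}
    (hA : IsSingularBasis A e) {p : ℝ} (hp : 1 ≤ p) {M : ℝ} (hM : 0 ≤ M)
    (h : ∀ s : Finset ι, ∑ k ∈ s, ‖A (e k)‖ ^ p ≤ M ^ p) : SBound p A M := by
  refine ⟨hM, fun n x y hx hy => ?_⟩
  have h1 : ∀ j, Tendsto (fun s : Finset ι => ∑ k ∈ s, ⟪e k, x j⟫_ℂ * ⟪y j, A (e k)⟫_ℂ) atTop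
      (𝓝 ⟪y j, A (x j)⟫_ℂ) := by
    intro j
    have := (hasSum_inner_smul_apply A e (x j)).mapL (innerSL ℂ (y j))
    simpa [HasSum, inner_smul_right] using this
  refine le_of_tendsto (tendsto_finsetSum _ fun j _ => ((h1 j).norm.rpow_const
    (Or.inr (by linarith : (0 : ℝ) ≤ p)))) (Eventually.of_forall fun s => ?_)
  exact (sum_norm_inner_sum_le e.orthonormal hA hp s hx hy).trans (h s)

theorem IsSingularBasis.sBound_iff {A : H →L[ℂ] H} {ι : Type*} {e : HilbertBasis ι ℂ H}
    (hA : IsSingularBasis A e) {p : ℝ} (hp : 1 ≤ p) {M : ℝ} (hM : 0 ≤ M) :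
    SBound p A M ↔ ∀ s : Finset ι, ∑ k ∈ s, ‖A (e k)‖ ^ p ≤ M ^ p :=
  ⟨fun h => h.sum_norm_le hp e.orthonormal hA, hA.sBound hp hM⟩

section Complete

variable [CompleteSpace H]

open ContinuousLinearMap in
-- Diagonalize the compact self-adjoint operator `A⋆ A`, taking an orthonormal basis of every
-- eigenspace, the kernel included. Orthogonality of the images is `⟪A x, A y⟫ = ⟪x, A⋆ A y⟫`.
theorem exists_isSingularBasis {A : H →L[ℂ] H} (hA : IsCompactOperator A) :
    ∃ (ι : Type u) (e : HilbertBasis ι ℂ H), IsSingularBasis A e := by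
  let T : H →L[ℂ] H := adjoint A ∘L A
  have hT : IsCompactOperator T := hA.clm_comp (adjoint A)
  have hS : (T : H →ₗ[ℂ] H).IsSymmetric := by
    intro x y
    simp [T, adjoint_inner_left, adjoint_inner_right]
  have hE := hS.orthogonalFamily_eigenspaces
  have hc : ∀ μ, CompleteSpace (Module.End.eigenspace (T : H →ₗ[ℂ] H) μ) := by
    intro μ
    have : IsClosed (Module.End.eigenspace (T : H →ₗ[ℂ] H) μ : Set H) := by
      have : (Module.End.eigenspace (T : H →ₗ[ℂ] H) μ : Set H) = {x | T x = μ • x} := by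
        ext x; simp
      rw [this]
      exact isClosed_eq T.continuous (continuous_const_smul μ)
    exact this.completeSpace_coe
  choose w b hb using fun μ => exists_hilbertBasis ℂ (Module.End.eigenspace (T : H →ₗ[ℂ] H) μ)
  have ho : Orthonormal ℂ fun a : Σ μ, w μ => ((b a.1 a.2 : _) : H) :=
    hE.orthonormal_sigma_orthonormal fun μ => (b μ).orthonormal
  have hbot : (Submodule.span ℂ (Set.range fun a : Σ μ, w μ => ((b a.1 a.2 : _) : H)))ᗮ = ⊥ := by
    rw [eq_bot_iff, ← orthogonalComplement_iSup_eigenspaces_eq_bot hT hS]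
    intro x hx
    rw [Submodule.mem_orthogonal] at hx
    have hle : ⨆ μ, Module.End.eigenspace (T : H →ₗ[ℂ] H) μ ≤ (ℂ ∙ x)ᗮ := by
      refine iSup_le fun μ y hy => ?_
      rw [Submodule.mem_orthogonal_singleton_iff_inner_left]
      have hs := ((b μ).hasSum_repr ⟨y, hy⟩).mapL (Submodule.subtypeL _)
      have hs2 := hs.mapL (innerSL ℂ x)
      have hz : ∀ i,
          innerSL ℂ x ((Submodule.subtypeL _) ((b μ).repr ⟨y, hy⟩ i • (b μ i))) = 0 := by
        intro i
        have := hx _ (Submodule.subset_span ⟨⟨μ, i⟩, rfl⟩)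
        rw [map_smul, map_smul]
        have h2 : ⟪x, ((b μ i : _) : H)⟫_ℂ = 0 := inner_eq_zero_symm.mp this
        simp [h2]
      simp_rw [hz] at hs2
      exact inner_eq_zero_symm.mp (hs2.unique hasSum_zero)
    rw [Submodule.mem_orthogonal]
    exact fun y hy => (Submodule.mem_orthogonal_singleton_iff_inner_left).mp (hle hy)
  refine ⟨Σ μ, w μ, HilbertBasis.mkOfOrthogonalEqBot ho hbot, fun k l hkl => ?_⟩
  rw [HilbertBasis.coe_mkOfOrthogonalEqBot]
  have h1 : ∀ x y, ⟪A x, A y⟫_ℂ = ⟪x, T y⟫_ℂ := by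
    intro x y; simp [T, adjoint_inner_right]
  have h2 : T ((b l.1 l.2 : _) : H) = l.1 • ((b l.1 l.2 : _) : H) :=
    Module.End.mem_eigenspace_iff.mp (b l.1 l.2).2
  rw [h1]
  change ⟪((b k.1 k.2 : _) : H), T ((b l.1 l.2 : _) : H)⟫_ℂ = 0
  rw [h2, inner_smul_right]
  have := ho.2 hkl
  change ⟪((b k.1 k.2 : _) : H), ((b l.1 l.2 : _) : H)⟫_ℂ = 0 at this
  rw [this, mul_zero]

open ContinuousLinearMap in
-- With `P = |A|` and `s = ‖A (e k)‖`, `P ^ 2` multiplies `e k` by `s ^ 2`, so `y = P (e k) - s • e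
-- k` satisfies `P y = -s • y`. Positivity of `P` forces `y = 0` if `s > 0`; if `s = 0`, then `‖P (e
-- k)‖ ^ 2 = ⟪e k, P (P (e k))⟫ = 0`.
theorem IsSingularBasis.abs_apply {A : H →L[ℂ] H} {ι : Type*} {e : HilbertBasis ι ℂ H}
    (hA : IsSingularBasis A e) (k : ι) :
    (CFC.abs A : H →L[ℂ] H) (e k) = (‖A (e k)‖ : ℂ) • e k := by
  classical
  set P : H →L[ℂ] H := CFC.abs A with hP
  have hpos : P.IsPositive := (nonneg_iff_isPositive P).mp (CFC.abs_nonneg A)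
  have hsq : ∀ x, P (P x) = adjoint A (A x) := by
    intro x
    have : P * P = star A * A := CFC.abs_mul_abs A
    exact congrArg (fun B : H →L[ℂ] H => B x) this
  have hev : adjoint A (A (e k)) = ((‖A (e k)‖ : ℂ) ^ 2) • e k := by
    refine e.repr.injective ?_
    ext l
    rw [e.repr_apply_apply, e.repr_apply_apply, adjoint_inner_right, inner_smul_right,
      orthonormal_iff_ite.mp e.orthonormal l k]
    by_cases h : l = k
    · subst h
      rw [if_pos rfl, mul_one, inner_self_eq_norm_sq_to_K]
      simp
    · rw [if_neg h, hA l k h, mul_zero]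
  set s := ‖A (e k)‖ with hs
  have hnn : 0 ≤ s := norm_nonneg _
  set y := P (e k) - (s : ℂ) • e k with hy
  have h1 : P y = -((s : ℂ) • y) := by
    rw [hy, map_sub, map_smul, hsq, hev, smul_sub, smul_smul, sq]
    abel
  have h2 := hpos.re_inner_nonneg_right y
  have h3 : y = 0 := by
    rcases hnn.eq_or_lt with h0 | h0
    · have hz : P y = 0 := by rw [h1, ← h0]; simp
      have hy' : y = P (e k) := by rw [hy, ← h0]; simp
      have h4 : ⟪P (e k), P (e k)⟫_ℂ = ⟪e k, P (P (e k))⟫_ℂ :=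
        hpos.isSelfAdjoint.isSymmetric (e k) (P (e k))
      rw [← hy', hz, inner_zero_right] at h4
      exact inner_self_eq_zero.mp h4
    · by_contra hne
      rw [h1, inner_neg_right, inner_smul_right, inner_self_eq_norm_sq_to_K] at h2
      have : 0 < ‖y‖ := norm_pos_iff.mpr hne
      have h4 : RCLike.re (-((s : ℂ) * (‖y‖ : ℂ) ^ 2)) = -(s * ‖y‖ ^ 2) := by
        rw [← Complex.ofReal_pow, ← Complex.ofReal_mul, ← Complex.ofReal_neg]
        exact Complex.ofReal_re _
      have h5 : 0 ≤ -(s * ‖y‖ ^ 2) := h4 ▸ h2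
      have : 0 < s * ‖y‖ ^ 2 := by positivity
      linarith
  exact sub_eq_zero.mp h3

/-- The basis vectors with `‖A (e k)‖ = s` span the eigenspace of `|A|`. Compactness with `s > 0`
makes it finite-dimensional, so that `finrank` is the true multiplicity and not the default value
`0`. -/
theorem IsSingularBasis.finrank_eigenspace {A : H →L[ℂ] H} (hc : IsCompactOperator A)
    {ι : Type*} {e : HilbertBasis ι ℂ H} (hA : IsSingularBasis A e) {s : ℝ} (hs : 0 < s) :
    (singularMultiplicity A s : ℝ≥0∞) = ENat.card {k // ‖A (e k)‖ = s} := by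
  classical
  set P : H →L[ℂ] H := CFC.abs A with hP
  set E := Module.End.eigenspace (P : H →ₗ[ℂ] H) (s : ℂ) with hE
  have hpos : P.IsPositive :=
    (ContinuousLinearMap.nonneg_iff_isPositive P).mp (CFC.abs_nonneg A)
  have hfin : FiniteDimensional ℂ E := by
    let T : H →L[ℂ] H := ContinuousLinearMap.adjoint A ∘L A
    have hT : IsCompactOperator T := hc.clm_comp (ContinuousLinearMap.adjoint A)
    have h2 := ContinuousLinearMap.finite_dimensional_eigenspace hT ((s : ℂ) ^ 2)
      (by simpa using hs.ne')
    have hle : E ≤ Module.End.eigenspace (T : H →ₗ[ℂ] H) ((s : ℂ) ^ 2) := by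
      intro x hx
      rw [Module.End.mem_eigenspace_iff] at hx ⊢
      have hx' : P x = (s : ℂ) • x := hx
      have hsq : P * P = star A * A := CFC.abs_mul_abs A
      have h3 : P (P x) = T x := congrArg (fun B : H →L[ℂ] H => B x) hsq
      change T x = _
      rw [← h3, hx', map_smul, hx', smul_smul, sq]
    exact Submodule.finiteDimensional_of_le hle
  have hmem : ∀ k : {k // ‖A (e k)‖ = s}, e k ∈ E := by
    intro k
    rw [Module.End.mem_eigenspace_iff]
    change P (e k) = _
    rw [hA.abs_apply, k.2]
  let v : {k // ‖A (e k)‖ = s} → E := fun k => ⟨e k, hmem k⟩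
  have hv : Orthonormal ℂ v := by
    have h := e.orthonormal.comp (Subtype.val : {k // ‖A (e k)‖ = s} → ι) Subtype.val_injective
    exact ⟨fun k => h.1 k, fun k l hkl => h.2 hkl⟩
  have hbot : (Submodule.span ℂ (Set.range v))ᗮ = ⊥ := by
    rw [eq_bot_iff]
    intro x hx
    rw [Submodule.mem_orthogonal] at hx
    rw [Submodule.mem_bot]
    have : (x : H) = 0 := by
      refine e.repr.injective ?_
      ext k
      rw [e.repr_apply_apply, map_zero]
      change ⟪e k, (x : H)⟫_ℂ = 0
      by_cases hk : ‖A (e k)‖ = s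
      · exact hx (v ⟨k, hk⟩) (Submodule.subset_span ⟨_, rfl⟩)
      · have hx2 : P x = (s : ℂ) • (x : H) := Module.End.mem_eigenspace_iff.mp x.2
        have h4 : ⟪P (e k), (x : H)⟫_ℂ = ⟪e k, P x⟫_ℂ := hpos.isSelfAdjoint.isSymmetric _ _
        rw [hA.abs_apply, hx2, inner_smul_left, inner_smul_right, Complex.conj_ofReal] at h4
        have h5 : ((‖A (e k)‖ : ℂ) - s) * ⟪e k, (x : H)⟫_ℂ = 0 := by rw [sub_mul, h4, sub_self]
        refine (mul_eq_zero.mp h5).resolve_left ?_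
        rw [← ne_eq, sub_ne_zero]
        exact_mod_cast hk
    exact Subtype.ext this
  have : Finite {k // ‖A (e k)‖ = s} := hv.linearIndependent.finite
  have := Fintype.ofFinite {k // ‖A (e k)‖ = s}
  have h6 := Module.finrank_eq_card_basis
    (HilbertBasis.mkOfOrthogonalEqBot hv hbot).toOrthonormalBasis.toBasis
  rw [singularMultiplicity, ← hP, ← hE, h6, ENat.card_eq_coe_fintype_card]
  rfl

theorem IsSingularBasis.schattenNorm_eq {A : H →L[ℂ] H} (hc : IsCompactOperator A)
    {ι : Type*} {e : HilbertBasis ι ℂ H} (hA : IsSingularBasis A e) {p : ℝ} (hp : 0 < p) :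
    schattenNorm p A = (∑' k, ENNReal.ofReal (‖A (e k)‖ ^ p)) ^ (1 / p) := by
  rw [schattenNorm, if_pos hc, ← ENNReal.tsum_fiberwise _ fun k => ‖A (e k)‖]
  congr 1
  have h1 : ∀ s : ℝ, ∑' b : ((fun k => ‖A (e k)‖) ⁻¹' {s} : Set ι),
      ENNReal.ofReal (‖A (e b)‖ ^ p)
      = ENat.card {k // ‖A (e k)‖ = s} * ENNReal.ofReal (s ^ p) := by
    intro s
    have : ∀ b : ((fun k => ‖A (e k)‖) ⁻¹' {s} : Set ι), ‖A (e b)‖ = s := fun b => b.2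
    simp_rw [this]
    rw [ENNReal.tsum_const]
    rfl
  simp_rw [h1]
  rw [← tsum_subtype_eq_of_support_subset (s := Set.Ioi (0 : ℝ))]
  · refine tsum_congr fun s => ?_
    rw [hA.finrank_eigenspace hc s.2, ENNReal.ofReal_rpow_of_pos s.2]
  -- Only positive `s` contribute: negative fibres are empty, and the fibre over `0`, possibly
  -- infinite, is multiplied by `0 ^ p = 0`.
  · intro s hs
    by_contra h
    rw [Set.mem_Ioi, not_lt] at h
    refine hs ?_
    change _ * _ = _
    rcases h.eq_or_lt with h0 | h0
    · rw [h0, Real.zero_rpow hp.ne']; simp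
    · have : IsEmpty {k // ‖A (e k)‖ = s} := ⟨fun k => absurd k.2 (by
        have := norm_nonneg (A (e k)); intro h; linarith)⟩
      rw [(ENat.card_eq_zero_iff_empty _).mpr this]
      simp

/-- On a singular basis both sides say that the finite partial sums of `‖A (e k)‖ ^ p` are at most
`M ^ p`. This is the bridge between the singular-number definition and all later estimates. -/
theorem schattenNorm_le_ofReal_iff {A : H →L[ℂ] H} {p : ℝ} (hp : 1 ≤ p) {M : ℝ} (hM : 0 ≤ M) :
    schattenNorm p A ≤ ENNReal.ofReal M ↔ IsCompactOperator A ∧ SBound p A M := by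
  have hp0 : 0 < p := by linarith
  by_cases hc : IsCompactOperator A
  · obtain ⟨ι, e, he⟩ := exists_isSingularBasis hc
    rw [he.schattenNorm_eq hc hp0, he.sBound_iff hp hM, one_div,
      ENNReal.rpow_inv_le_iff hp0, ENNReal.ofReal_rpow_of_nonneg hM hp0.le,
      ENNReal.tsum_eq_iSup_sum, iSup_le_iff, and_iff_right hc]
    refine forall_congr' fun s => ?_
    rw [← ENNReal.ofReal_sum_of_nonneg fun k _ => by positivity,
      ENNReal.ofReal_le_ofReal_iff (by positivity)]
  · simp [schattenNorm, hc]

theorem isSchatten_iff {A : H →L[ℂ] H} {p : ℝ} (hp : 1 ≤ p) :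
    IsSchatten p A ↔ IsCompactOperator A ∧ ∃ M, SBound p A M := by
  constructor
  · intro h
    have := (schattenNorm_le_ofReal_iff (A := A) hp ENNReal.toReal_nonneg).mp
      (ENNReal.ofReal_toReal h.ne).ge
    exact ⟨this.1, _, this.2⟩
  · rintro ⟨hc, M, hM⟩
    exact ((schattenNorm_le_ofReal_iff hp hM.1).mpr ⟨hc, hM⟩).trans_lt ENNReal.ofReal_lt_top

end Complete

end SchattenBounds

/-! ### Norm properties and finite rank approximation -/

section SchattenCalculus

variable {H : Type u} [NormedAddCommGroup H] [InnerProductSpace ℂ H]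

theorem SBound.mono {p : ℝ} (hp : 1 ≤ p) {A : H →L[ℂ] H} {M N : ℝ} (h : SBound p A M)
    (hMN : M ≤ N) : SBound p A N :=
  ⟨h.1.trans hMN, fun n e f he hf => (h.2 n e f he hf).trans
    (Real.rpow_le_rpow h.1 hMN (by linarith))⟩

theorem SBound.zero {p : ℝ} (hp : 1 ≤ p) : SBound p (0 : H →L[ℂ] H) 0 := by
  refine ⟨le_rfl, fun n e f _ _ => ?_⟩
  simp [Real.zero_rpow (by linarith : p ≠ 0)]

theorem SBound.smul {p : ℝ} {A : H →L[ℂ] H} {M : ℝ} (h : SBound p A M) (c : ℂ) :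
    SBound p (c • A) (‖c‖ * M) := by
  refine ⟨mul_nonneg (norm_nonneg c) h.1, fun n e f he hf => ?_⟩
  simp only [smul_apply, inner_smul_right, norm_mul]
  rw [Real.mul_rpow (norm_nonneg c) h.1]
  simp_rw [Real.mul_rpow (norm_nonneg c) (norm_nonneg _)]
  rw [← Finset.mul_sum]
  exact mul_le_mul_of_nonneg_left (h.2 n e f he hf) (by positivity)

theorem SBound.neg {p : ℝ} {A : H →L[ℂ] H} {M : ℝ} (h : SBound p A M) : SBound p (-A) M := by
  simpa using h.smul (-1)

/-- Minkowski's inequality for each fixed pair of orthonormal families. -/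
theorem SBound.add {p : ℝ} (hp : 1 ≤ p) {A B : H →L[ℂ] H} {M N : ℝ} (hA : SBound p A M)
    (hB : SBound p B N) : SBound p (A + B) (M + N) := by
  have hp0 : 0 < p := by linarith
  refine ⟨add_nonneg hA.1 hB.1, fun n e f he hf => ?_⟩
  have h := Real.Lp_add_le Finset.univ (fun j => ‖⟪f j, A (e j)⟫_ℂ‖)
    (fun j => ‖⟪f j, B (e j)⟫_ℂ‖) hp
  have hA1 : (∑ j, |‖⟪f j, A (e j)⟫_ℂ‖| ^ p) ^ (1 / p) ≤ M := by
    rw [one_div, Real.rpow_inv_le_iff_of_pos (by positivity) hA.1 hp0]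
    simpa using hA.2 n e f he hf
  have hB1 : (∑ j, |‖⟪f j, B (e j)⟫_ℂ‖| ^ p) ^ (1 / p) ≤ N := by
    rw [one_div, Real.rpow_inv_le_iff_of_pos (by positivity) hB.1 hp0]
    simpa using hB.2 n e f he hf
  have h2 := h.trans (add_le_add hA1 hB1)
  rw [one_div, Real.rpow_inv_le_iff_of_pos (by positivity) (add_nonneg hA.1 hB.1) hp0] at h2
  refine le_trans (Finset.sum_le_sum fun j _ => Real.rpow_le_rpow (norm_nonneg _) ?_ hp0.le) h2
  rw [add_apply, inner_add_right]
  exact (norm_add_le _ _).trans (le_abs_self _)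

theorem SBound.sub {p : ℝ} (hp : 1 ≤ p) {A B : H →L[ℂ] H} {M N : ℝ} (hA : SBound p A M)
    (hB : SBound p B N) : SBound p (A - B) (M + N) := by
  rw [sub_eq_add_neg]; exact hA.add hp hB.neg

/-- Test on the one-element families given by the normalized vectors `x` and `A x`. -/
theorem SBound.opNorm_le {p : ℝ} (hp : 1 ≤ p) {A : H →L[ℂ] H} {M : ℝ} (h : SBound p A M) :
    ‖A‖ ≤ M := by
  refine ContinuousLinearMap.opNorm_le_bound _ h.1 fun x => ?_
  by_cases hx : A x = 0
  · rw [hx, norm_zero]; exact mul_nonneg h.1 (norm_nonneg x)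
  have hx0 : x ≠ 0 := fun h0 => hx (by rw [h0, map_zero])
  have hxn := norm_ne_zero_iff.mpr hx0
  have hAn := norm_ne_zero_iff.mpr hx
  have hort : ∀ y : H, y ≠ 0 → Orthonormal ℂ fun _ : Fin 1 => ((‖y‖ : ℂ)⁻¹) • y := by
    intro y hy
    refine ⟨fun _ => ?_, fun i j hij => absurd (Subsingleton.elim i j) hij⟩
    rw [norm_smul, norm_inv, Complex.norm_real, norm_norm,
      inv_mul_cancel₀ (norm_ne_zero_iff.mpr hy)]
  have h1 := h.2 1 _ _ (hort x hx0) (hort (A x) hx)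
  simp only [Finset.univ_unique, Finset.sum_singleton] at h1
  rw [Real.rpow_le_rpow_iff (norm_nonneg _) h.1 (by linarith), map_smul, inner_smul_left,
    inner_smul_right, inner_self_eq_norm_sq_to_K] at h1
  simp only [map_inv₀, Complex.conj_ofReal, norm_mul, norm_inv, Complex.norm_real, norm_norm,
    norm_pow, Complex.coe_algebraMap] at h1
  have h2 : ‖A x‖⁻¹ * (‖x‖⁻¹ * ‖A x‖ ^ 2) = ‖A x‖ / ‖x‖ := by field_simp
  rw [h2, div_le_iff₀ (by positivity)] at h1
  exact h1

/-- Each inequality in `SBound` involves finitely many coefficients, so pointwise convergence of the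
operators is enough. -/
theorem SBound.of_tendsto {p : ℝ} (hp : 1 ≤ p) {α : Type*} {l : Filter α} [l.NeBot]
    {F : α → H →L[ℂ] H} {A : H →L[ℂ] H} {M : ℝ} (hM : 0 ≤ M)
    (hF : ∀ x, Tendsto (fun i => F i x) l (𝓝 (A x))) (h : ∀ᶠ i in l, SBound p (F i) M) :
    SBound p A M := by
  refine ⟨hM, fun n e f he hf => ?_⟩
  refine le_of_tendsto (tendsto_finsetSum _ fun j _ =>
    ((tendsto_const_nhds.inner (hF (e j))).norm.rpow_const (Or.inr (by linarith : (0 : ℝ) ≤ p))))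
    (h.mono fun i hi => hi.2 n e f he hf)

/-- Every coefficient `a` is at most `‖A‖ ≤ M`, whence `a ^ q ≤ a ^ p * M ^ (q - p)`. -/
theorem SBound.mono_exponent {p q : ℝ} (hp : 1 ≤ p) (hpq : p ≤ q) {A : H →L[ℂ] H} {M : ℝ}
    (h : SBound p A M) : SBound q A M := by
  refine ⟨h.1, fun n e f he hf => ?_⟩
  have hn := h.opNorm_le hp
  have hsplit : ∀ a : ℝ, 0 ≤ a → a ^ q = a ^ p * a ^ (q - p) := by
    intro a ha
    rw [← Real.rpow_add_of_nonneg ha (by linarith) (by linarith)]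
    congr 1; ring
  have hle : ∀ j, ‖⟪f j, A (e j)⟫_ℂ‖ ≤ M := fun j => by
    calc _ ≤ ‖f j‖ * ‖A (e j)‖ := norm_inner_le_norm _ _
      _ ≤ ‖f j‖ * (‖A‖ * ‖e j‖) := by gcongr; exact A.le_opNorm _
      _ ≤ M := by rw [he.1, hf.1]; simpa using hn
  calc _ ≤ ∑ j, ‖⟪f j, A (e j)⟫_ℂ‖ ^ p * M ^ (q - p) := by
        refine Finset.sum_le_sum fun j _ => ?_
        rw [hsplit _ (norm_nonneg _)]
        exact mul_le_mul_of_nonneg_left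
          (Real.rpow_le_rpow (norm_nonneg _) (hle j) (by linarith)) (by positivity)
    _ ≤ M ^ p * M ^ (q - p) := by
        rw [← Finset.sum_mul]
        exact mul_le_mul_of_nonneg_right (h.2 n e f he hf) (Real.rpow_nonneg h.1 _)
    _ = M ^ q := (hsplit M h.1).symm

/-- The operator agreeing with `A` on the basis vectors in `s` and vanishing on the others. -/
noncomputable def truncation (A : H →L[ℂ] H) {ι : Type*} (e : HilbertBasis ι ℂ H)
    (s : Finset ι) : H →L[ℂ] H :=
  ∑ k ∈ s, (innerSL ℂ (e k)).smulRight (A (e k))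

theorem truncation_apply (A : H →L[ℂ] H) {ι : Type*} (e : HilbertBasis ι ℂ H)
    (s : Finset ι) (x : H) : truncation A e s x = ∑ k ∈ s, ⟪e k, x⟫_ℂ • A (e k) := by
  simp [truncation]

open Classical in
theorem truncation_basis (A : H →L[ℂ] H) {ι : Type*} (e : HilbertBasis ι ℂ H)
    (s : Finset ι) (k : ι) : truncation A e s (e k) = if k ∈ s then A (e k) else 0 := by
  rw [truncation_apply]
  simp [orthonormal_iff_ite.mp e.orthonormal]

theorem isFiniteRank_truncation (A : H →L[ℂ] H) {ι : Type*} (e : HilbertBasis ι ℂ H)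
    (s : Finset ι) : IsFiniteRank (truncation A e s) := by
  classical
  have hle : LinearMap.range (truncation A e s : H →ₗ[ℂ] H)
      ≤ Submodule.span ℂ (s.image fun k => A (e k) : Finset H) := by
    rintro _ ⟨x, rfl⟩
    change truncation A e s x ∈ _
    rw [truncation_apply]
    exact Submodule.sum_mem _ fun k hk => Submodule.smul_mem _ _
      (Submodule.subset_span (by simpa using ⟨k, hk, rfl⟩))
  exact Submodule.finiteDimensional_of_le hle

theorem IsSingularBasis.truncation {A : H →L[ℂ] H} {ι : Type*} {e : HilbertBasis ι ℂ H}
    (hA : IsSingularBasis A e) (s : Finset ι) : IsSingularBasis (truncation A e s) e := by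
  intro k l hkl
  rw [truncation_basis, truncation_basis]
  split_ifs <;> simp [hA k l hkl]

theorem IsSingularBasis.sBound_truncation {A : H →L[ℂ] H} {ι : Type*} {e : HilbertBasis ι ℂ H}
    (hA : IsSingularBasis A e) {p : ℝ} (hp : 1 ≤ p) {M : ℝ} (h : SBound p A M) (s : Finset ι) :
    SBound p (DynZeta.truncation A e s) M := by
  refine (hA.truncation s).sBound hp h.1 fun t => ?_
  refine le_trans (Finset.sum_le_sum fun k _ => ?_) ((hA.sBound_iff hp h.1).mp h t)
  rw [truncation_basis]
  split_ifs
  · exact le_rfl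
  · rw [norm_zero, Real.zero_rpow (by linarith)]; positivity

/-- The basis is singular for the difference too, and the sum to be estimated is a tail of the
convergent series `∑ ‖A (e k)‖ ^ p`. -/
theorem IsSingularBasis.eventually_sBound {A : H →L[ℂ] H} {ι : Type*} {e : HilbertBasis ι ℂ H}
    (hA : IsSingularBasis A e) {p : ℝ} (hp : 1 ≤ p) {M : ℝ} (h : SBound p A M) {ε : ℝ}
    (hε : 0 < ε) : ∀ᶠ s in atTop, SBound p (DynZeta.truncation A e s - A) ε := by
  classical
  have hs : Summable fun k => ‖A (e k)‖ ^ p :=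
    summable_of_sum_le (fun k => by positivity) ((hA.sBound_iff hp h.1).mp h)
  obtain ⟨s₀, hs₀⟩ := summable_iff_vanishing_norm.mp hs (ε ^ p) (by positivity)
  filter_upwards [eventually_ge_atTop s₀] with s hs
  have hb : ∀ k, (DynZeta.truncation A e s - A) (e k) = if k ∈ s then 0 else -A (e k) := by
    intro k
    rw [sub_apply, truncation_basis]
    split_ifs <;> simp
  refine IsSingularBasis.sBound (e := e) (fun k l hkl => ?_) hp hε.le fun t => ?_
  · rw [hb, hb]
    split_ifs <;> simp [hA k l hkl]
  · have h1 := hs₀ (t \ s) (Finset.disjoint_of_subset_right hs Finset.sdiff_disjoint)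
    rw [Real.norm_of_nonneg (Finset.sum_nonneg fun k _ => by positivity)] at h1
    refine le_trans (le_of_eq ?_) h1.le
    rw [Finset.sdiff_eq_filter, Finset.sum_filter]
    refine Finset.sum_congr rfl fun k _ => ?_
    rw [hb]
    split_ifs
    · rw [norm_zero, Real.zero_rpow (by linarith)]
    · rw [norm_neg]

theorem IsSingularBasis.tendsto_truncation {A : H →L[ℂ] H} {ι : Type*} {e : HilbertBasis ι ℂ H}
    (hA : IsSingularBasis A e) {p : ℝ} (hp : 1 ≤ p) {M : ℝ} (h : SBound p A M) :
    Tendsto (DynZeta.truncation A e) atTop (𝓝 A) := by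
  rw [Metric.tendsto_nhds]
  intro ε hε
  filter_upwards [hA.eventually_sBound hp h (half_pos hε)] with s hs
  rw [dist_eq_norm]
  linarith [hs.opNorm_le hp]

theorem IsFiniteRank.isCompactOperator {A : H →L[ℂ] H} (hA : IsFiniteRank A) :
    IsCompactOperator A := by
  have : FiniteDimensional ℂ (LinearMap.range (A : H →ₗ[ℂ] H)) := hA
  have h := (isCompactOperator_id_iff_finiteDimensional (𝕜 := ℂ)
    (E := LinearMap.range (A : H →ₗ[ℂ] H))).mpr this
  exact (h.comp_clm (A.codRestrict _ fun x => ⟨x, rfl⟩)).clm_comp (Submodule.subtypeL _)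

/-- The truncations converge in operator norm. This supplies compactness of tensor products and
exterior powers, whose singular bases are explicit. -/
theorem IsSingularBasis.isCompactOperator [CompleteSpace H] {A : H →L[ℂ] H} {ι : Type*}
    {e : HilbertBasis ι ℂ H} (hA : IsSingularBasis A e) {p : ℝ} (hp : 1 ≤ p) {M : ℝ}
    (h : SBound p A M) : IsCompactOperator A :=
  isCompactOperator_of_tendsto (hA.tendsto_truncation hp h)
    (Eventually.of_forall fun s => (isFiniteRank_truncation A e s).isCompactOperator)

end SchattenCalculus

/-! ### Hölder's inequality and powers of Schatten operators -/

section SchattenHolder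

variable {H : Type u} [NormedAddCommGroup H] [InnerProductSpace ℂ H] [CompleteSpace H]

/-- Choose an orthonormal basis `b` of the span of `x` with orthogonal images. Then `‖A (x j)‖ ^ 2`
averages the `‖A (b k)‖ ^ 2` with the weights `|⟪b k, x j⟫| ^ 2`, doubly substochastic by Bessel.
Jensen is used with exponent `q / 2`, hence the condition `2 ≤ q`. -/
theorem SBound.sum_norm_apply_le {q : ℝ} (hq : 2 ≤ q) {A : H →L[ℂ] H} {M : ℝ}
    (h : SBound q A M) {n : ℕ} {x : Fin n → H} (hx : Orthonormal ℂ x) :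
    ∑ j, ‖A (x j)‖ ^ q ≤ M ^ q := by
  let V := Submodule.span ℂ (Set.range x)
  have hV : FiniteDimensional ℂ V := FiniteDimensional.span_of_finite ℂ (Set.finite_range x)
  obtain ⟨b, μ, -, hb⟩ := exists_orthogonal_image V A
  have hb' : Orthonormal ℂ fun k => (b k : H) := ⟨fun k => b.orthonormal.1 k,
    fun k l hkl => b.orthonormal.2 hkl⟩
  have ho : ∀ k l, k ≠ l → ⟪A (b k), A (b l)⟫_ℂ = 0 := fun k l hkl => by
    rw [hb, if_neg hkl]
  have hexp : ∀ j, x j = ∑ k, ⟪(b k : H), x j⟫_ℂ • (b k : H) := by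
    intro j
    have h1 := b.sum_repr' ⟨x j, Submodule.subset_span ⟨j, rfl⟩⟩
    have h2 := congrArg (Submodule.subtype V) h1
    rw [map_sum] at h2
    exact h2.symm
  have hn : ∀ j, ‖A (x j)‖ ^ 2 = ∑ k, ‖⟪(b k : H), x j⟫_ℂ‖ ^ 2 * ‖A (b k)‖ ^ 2 := by
    intro j
    have h0 : A (x j) = ∑ k, ⟪(b k : H), x j⟫_ℂ • A (b k) := by
      conv_lhs => rw [hexp j]
      simp
    have h1 : ((‖A (x j)‖ ^ 2 : ℝ) : ℂ)
        = ((∑ k, ‖⟪(b k : H), x j⟫_ℂ‖ ^ 2 * ‖A (b k)‖ ^ 2 : ℝ) : ℂ) := by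
      have h2 := inner_self_eq_norm_sq_to_K (𝕜 := ℂ) (A (x j))
      rw [Complex.ofReal_pow]
      refine h2.symm.trans ?_
      rw [h0, sum_inner, Complex.ofReal_sum]
      refine Finset.sum_congr rfl fun k _ => ?_
      rw [inner_sum, Finset.sum_eq_single k]
      · rw [inner_smul_left, inner_smul_right, inner_self_eq_norm_sq_to_K, ← mul_assoc,
          Complex.conj_mul']
        simp
      · intro l _ hl
        rw [inner_smul_left, inner_smul_right, ho k l hl.symm]
        simp
      · simp
    exact_mod_cast h1
  have hpow : ∀ y : H, ‖y‖ ^ q = (‖y‖ ^ 2) ^ (q / 2) := by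
    intro y
    rw [← Real.rpow_natCast, ← Real.rpow_mul (norm_nonneg _)]
    congr 1
    push_cast
    ring
  simp_rw [hpow, hn]
  refine (sum_rpow_weighted_le Finset.univ Finset.univ
    (fun j k => ‖⟪(b k : H), x j⟫_ℂ‖ ^ 2) (fun k => ‖A (b k)‖ ^ 2) (fun j k => by positivity)
    (fun j _ => ?_) (fun k _ => ?_) (fun k => by positivity) (by linarith)).trans ?_
  · have := hb'.sum_inner_products_le (x j) (s := Finset.univ)
    rwa [hx.1 j, one_pow] at this
  · have := hx.sum_inner_products_le (b k : H) (s := Finset.univ)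
    simp_rw [norm_inner_symm (b k : H)]
    rwa [hb'.1 k, one_pow] at this
  · simp_rw [← hpow]
    exact h.sum_norm_le (by linarith) hb' ho Finset.univ

theorem SBound.adjoint {p : ℝ} {A : H →L[ℂ] H} {M : ℝ} (h : SBound p A M) :
    SBound p (ContinuousLinearMap.adjoint A) M := by
  refine ⟨h.1, fun n e f he hf => ?_⟩
  convert h.2 n f e hf he using 3 with j
  rw [ContinuousLinearMap.adjoint_inner_right, norm_inner_symm]

/-- Hölder's inequality for two factors with exponents at least `2`. -/
theorem SBound.mul {p q r : ℝ} (hp : 2 ≤ p) (hq : 2 ≤ q) (hr : 0 < r)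
    (hpqr : r⁻¹ = p⁻¹ + q⁻¹) {A B : H →L[ℂ] H} {M N : ℝ} (hA : SBound p A M)
    (hB : SBound q B N) : SBound r (A * B) (M * N) := by
  have hp0 : 0 < p := by linarith
  have hq0 : 0 < q := by linarith
  refine ⟨mul_nonneg hA.1 hB.1, fun n e f he hf => ?_⟩
  have hc : (p / r).HolderConjugate (q / r) := by
    rw [Real.holderConjugate_iff]
    have h1 : r / p + r / q = 1 := by
      rw [div_eq_mul_inv, div_eq_mul_inv, ← mul_add, ← hpqr, mul_inv_cancel₀ hr.ne']
    have h2 : 0 < r / q := by positivity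
    have h3 : r / p < 1 := by linarith
    rw [inv_div, inv_div]
    refine ⟨?_, h1⟩
    rw [div_lt_one hp0] at h3
    rwa [lt_div_iff₀ hr, one_mul]
  have hH := Real.inner_le_Lp_mul_Lq_of_nonneg Finset.univ hc
    (f := fun j => ‖ContinuousLinearMap.adjoint A (f j)‖ ^ r) (g := fun j => ‖B (e j)‖ ^ r)
    (fun j _ => by positivity) (fun j _ => by positivity)
  have hs : ∀ (a : ℝ) (s : ℝ), 0 ≤ a → (a ^ r) ^ (s / r) = a ^ s := by
    intro a s ha
    rw [← Real.rpow_mul ha]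
    congr 1
    field_simp
  simp_rw [hs _ _ (norm_nonneg _)] at hH
  have hl : ∀ {s S : ℝ}, 0 < s → 0 ≤ S → (S ^ s) ^ (1 / (s / r)) = S ^ r := by
    intro s S hs hS
    rw [← Real.rpow_mul hS]
    congr 1
    field_simp
  -- Moving `A` across the inner product, Cauchy–Schwarz bounds the coefficient by `‖A⋆ (f j)‖ * ‖B
  -- (e j)‖`; scalar Hölder then leaves these two sums of norms.
  have hA1 := hA.adjoint.sum_norm_apply_le hp hf
  have hB1 := hB.sum_norm_apply_le hq he
  calc ∑ j, ‖⟪f j, (A * B) (e j)⟫_ℂ‖ ^ r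
      ≤ ∑ j, ‖ContinuousLinearMap.adjoint A (f j)‖ ^ r * ‖B (e j)‖ ^ r := by
        refine Finset.sum_le_sum fun j _ => ?_
        rw [← Real.mul_rpow (norm_nonneg _) (norm_nonneg _)]
        refine Real.rpow_le_rpow (norm_nonneg _) ?_ hr.le
        change ‖⟪f j, A (B (e j))⟫_ℂ‖ ≤ _
        rw [← ContinuousLinearMap.adjoint_inner_left]
        exact norm_inner_le_norm _ _
    _ ≤ _ := hH
    _ ≤ (M ^ p) ^ (1 / (p / r)) * (N ^ q) ^ (1 / (q / r)) := by
        refine mul_le_mul (Real.rpow_le_rpow (by positivity) hA1 (by positivity))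
          (Real.rpow_le_rpow (by positivity) hB1 (by positivity)) (by positivity) ?_
        exact Real.rpow_nonneg (Real.rpow_nonneg hA.1 _) _
    _ = (M * N) ^ r := by rw [hl hp0 hA.1, hl hq0 hB.1, Real.mul_rpow hA.1 hB.1]

/-- Iterates the two-factor inequality. The condition `2 * length ≤ S` keeps the exponent `S /
length` of every partial product at least `2`, as that inequality requires. -/
theorem sBound_list_prod_of_two_le {S : ℝ} (L : List ((H →L[ℂ] H) × ℝ)) (hne : L ≠ [])
    (hS : 2 * L.length ≤ S) (hL : ∀ x ∈ L, SBound S x.1 x.2) :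
    SBound (S / L.length) (L.map Prod.fst).prod (L.map Prod.snd).prod := by
  induction L with
  | nil => exact absurd rfl hne
  | cons x L ih =>
    rcases eq_or_ne L [] with rfl | hL0
    · simpa using hL x (by simp)
    · have hlen : 0 < L.length := List.length_pos_iff.mpr hL0
      have hlen' : (1 : ℝ) ≤ L.length := by exact_mod_cast hlen
      rw [List.length_cons] at hS ⊢
      push_cast at hS ⊢
      have h2 := ih hL0 (by linarith) fun y hy => hL y (List.mem_cons_of_mem _ hy)
      rw [List.map_cons, List.map_cons, List.prod_cons, List.prod_cons]
      have hS0 : 0 < S := by linarith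
      refine (hL x (by simp)).mul (by linarith) ?_ (by positivity) ?_ h2
      · rw [le_div_iff₀ (by linarith)]; linarith
      · rw [inv_div, inv_div]
        field_simp
        ring

/-- Split each singular number of a truncation of `X` into two square roots, which doubles the
exponent. An approximation in operator norm suffices because `SBound` passes to limits. -/
theorem exists_factorization {p : ℝ} (hp : 1 ≤ p) {X : H →L[ℂ] H} (hX : IsCompactOperator X)
    {M : ℝ} (h : SBound p X M) {ε : ℝ} (hε : 0 < ε) :
    ∃ Y Z : H →L[ℂ] H, SBound (2 * p) Y (√M) ∧ SBound (2 * p) Z (√M) ∧ ‖Y * Z - X‖ ≤ ε := by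
  classical
  obtain ⟨ι, e, he⟩ := exists_isSingularBasis hX
  obtain ⟨s, hs⟩ := (he.eventually_sBound hp h hε).exists
  let Y : H →L[ℂ] H := ∑ k ∈ s, (innerSL ℂ (e k)).smulRight ((((√‖X (e k)‖)⁻¹ : ℝ) : ℂ) • X (e k))
  let Z : H →L[ℂ] H := ∑ k ∈ s, (innerSL ℂ (e k)).smulRight (((√‖X (e k)‖ : ℝ) : ℂ) • e k)
  have hY : ∀ k, Y (e k) = if k ∈ s then (((√‖X (e k)‖)⁻¹ : ℝ) : ℂ) • X (e k) else 0 := by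
    intro k
    simp [Y, orthonormal_iff_ite.mp e.orthonormal]
  have hZ : ∀ k, Z (e k) = if k ∈ s then ((√‖X (e k)‖ : ℝ) : ℂ) • e k else 0 := by
    intro k
    simp [Z, orthonormal_iff_ite.mp e.orthonormal]
  have hsqrt : ∀ a : ℝ, 0 ≤ a → (√a) ^ (2 * p) = a ^ p := by
    intro a ha
    rw [Real.sqrt_eq_rpow, ← Real.rpow_mul ha]
    congr 1
    ring
  have hsum : ∀ (W : H →L[ℂ] H), (∀ k, ‖W (e k)‖ ≤ √‖X (e k)‖) → ∀ t : Finset ι,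
      ∑ k ∈ t, ‖W (e k)‖ ^ (2 * p) ≤ (√M) ^ (2 * p) := by
    intro W hW t
    rw [hsqrt M h.1]
    refine le_trans (Finset.sum_le_sum fun k _ => ?_) ((he.sBound_iff hp h.1).mp h t)
    rw [← hsqrt _ (norm_nonneg _)]
    exact Real.rpow_le_rpow (norm_nonneg _) (hW k) (by linarith)
  have hinv : ∀ a : ℝ, 0 ≤ a → (√a)⁻¹ * a = √a := by
    intro a ha
    rcases ha.eq_or_lt with h0 | h0
    · rw [← h0]; simp
    · have : √a ≠ 0 := (Real.sqrt_pos.mpr h0).ne'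
      field_simp
      exact (Real.sq_sqrt ha).symm
  refine ⟨Y, Z, IsSingularBasis.sBound (e := e) (fun k l hkl => ?_) (by linarith)
    (Real.sqrt_nonneg _) (hsum Y fun k => ?_), IsSingularBasis.sBound (e := e)
    (fun k l hkl => ?_) (by linarith) (Real.sqrt_nonneg _) (hsum Z fun k => ?_), ?_⟩
  · rw [hY, hY]
    split_ifs <;> simp [he k l hkl]
  · rw [hY]
    split_ifs
    · rw [norm_smul, Complex.norm_real, Real.norm_of_nonneg (by positivity),
        hinv _ (norm_nonneg _)]
    · simp
  · rw [hZ, hZ]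
    have := e.orthonormal.2 hkl
    split_ifs <;> simp [this]
  · rw [hZ]
    split_ifs
    · rw [norm_smul, Complex.norm_real, Real.norm_of_nonneg (by positivity), e.orthonormal.1,
        mul_one]
    · simp
  · have hYZ : Y * Z = truncation X e s := by
      ext x
      change Y (Z x) = _
      have hZx : Z x = ∑ k ∈ s, ⟪e k, x⟫_ℂ • ((√‖X (e k)‖ : ℝ) : ℂ) • e k := by simp [Z]
      rw [hZx, map_sum, truncation_apply]
      refine Finset.sum_congr rfl fun k hk => ?_
      rw [map_smul, map_smul, hY, if_pos hk, smul_smul]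
      by_cases h0 : X (e k) = 0
      · simp [h0]
      · have : √‖X (e k)‖ ≠ 0 := (Real.sqrt_pos.mpr (norm_pos_iff.mpr h0)).ne'
        rw [smul_smul, mul_assoc, ← Complex.ofReal_mul, mul_inv_cancel₀ this]
        simp
    rw [hYZ]
    exact hs.opNorm_le hp

/-- Hölder's inequality: a product of `n` operators in the Schatten class of exponent `n` is of
trace class. -/
theorem sBound_list_prod (L : List ((H →L[ℂ] H) × ℝ)) (hne : L ≠ [])
    (hL : ∀ x ∈ L, IsCompactOperator x.1 ∧ SBound L.length x.1 x.2) :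
    SBound 1 (L.map Prod.fst).prod (L.map Prod.snd).prod := by
  have hlen : 0 < L.length := List.length_pos_iff.mpr hne
  set n := L.length with hn
  have hn1 : (1 : ℝ) ≤ n := by exact_mod_cast hlen
  have hex : ∀ (x : (H →L[ℂ] H) × ℝ) (i : ℕ), ∃ YZ : (H →L[ℂ] H) × (H →L[ℂ] H), x ∈ L →
      SBound (2 * n) YZ.1 (√x.2) ∧ SBound (2 * n) YZ.2 (√x.2) ∧
        ‖YZ.1 * YZ.2 - x.1‖ ≤ 1 / ((i : ℝ) + 1) := by
    intro x i
    by_cases hx : x ∈ L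
    · obtain ⟨Y, Z, h⟩ := exists_factorization hn1 (hL x hx).1 (hL x hx).2
        (ε := 1 / ((i : ℝ) + 1)) (by positivity)
      exact ⟨⟨Y, Z⟩, fun _ => h⟩
    · exact ⟨0, fun h => absurd h hx⟩
  choose F hF using hex
  have hlim : Tendsto (fun i => (L.map fun x => (F x i).1 * (F x i).2).prod) atTop
      (𝓝 (L.map Prod.fst).prod) := by
    refine tendsto_list_prod L fun x hx => ?_
    rw [tendsto_iff_norm_sub_tendsto_zero]
    exact squeeze_zero (fun i => norm_nonneg _) (fun i => (hF x i hx).2.2)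
      tendsto_one_div_add_atTop_nhds_zero_nat
  have hnn : 0 ≤ (L.map Prod.snd).prod := List.prod_nonneg fun a ha => by
    obtain ⟨x, hx, rfl⟩ := List.mem_map.mp ha
    exact (hL x hx).2.1
  refine SBound.of_tendsto le_rfl hnn
    (fun x => ((ContinuousLinearMap.apply ℂ H x).continuous.tendsto _).comp hlim)
    (Eventually.of_forall fun i => ?_)
  -- Multiplying `n` factors of exponent `n` directly would pass through exponents below `2`. The `2
  -- * n` square roots have exponent `2 * n`; each half of the list has a product of exponent
  -- exactly `2`, and two such products multiply to exponent `1`.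
  let L2 : List ((H →L[ℂ] H) × ℝ) := L.flatMap fun x => [((F x i).1, √x.2), ((F x i).2, √x.2)]
  have h1 : (L2.map Prod.fst).prod = (L.map fun x => (F x i).1 * (F x i).2).prod := by
    simp only [L2]
    clear * -
    induction L with
    | nil => simp
    | cons x L ih => simp [ih, mul_assoc]
  have h2 : (L2.map Prod.snd).prod = (L.map Prod.snd).prod := by
    simp only [L2]
    have h0 : ∀ x ∈ L, 0 ≤ x.2 := fun x hx => (hL x hx).2.1
    clear * - h0
    induction L with
    | nil => simp
    | cons x L ih =>
      have := Real.mul_self_sqrt (h0 x (by simp))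
      simp [ih fun y hy => h0 y (List.mem_cons_of_mem _ hy), ← mul_assoc, this]
  have h3 : L2.length = 2 * n := by
    simp [L2, List.length_flatMap, hn, mul_comm]
  have h4 : ∀ y ∈ L2, SBound (2 * n) y.1 y.2 := by
    intro y hy
    obtain ⟨x, hx, hy⟩ := List.mem_flatMap.mp hy
    simp only [List.mem_cons, List.not_mem_nil, or_false] at hy
    rcases hy with rfl | rfl
    · exact (hF x i hx).1
    · exact (hF x i hx).2.1
  rw [← h1, ← h2, ← List.take_append_drop n L2, List.map_append, List.map_append,
    List.prod_append, List.prod_append]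
  have half : ∀ L3 : List ((H →L[ℂ] H) × ℝ), L3.length = n → (∀ y ∈ L3, y ∈ L2) →
      SBound 2 (L3.map Prod.fst).prod (L3.map Prod.snd).prod := by
    intro L3 hl hsub
    have := sBound_list_prod_of_two_le (S := 2 * n) L3 (by
      rw [← List.length_pos_iff, hl]; exact hlen) (by rw [hl]) fun y hy => h4 y (hsub y hy)
    rwa [hl, mul_div_assoc, div_self (by positivity), mul_one] at this
  exact (half _ (by simp [h3]; omega) fun y => List.mem_of_mem_take).mul le_rfl le_rfl one_pos
    (by norm_num) (half _ (by simp [h3]; omega) fun y => List.mem_of_mem_drop)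

/-- The exponent is first raised from `n` to `k`, so that `k` factors of exponent `k` are
multiplied. -/
theorem SBound.pow {n k : ℕ} (hn : 1 ≤ n) (hk : n ≤ k) {A : H →L[ℂ] H}
    (hA : IsCompactOperator A) {M : ℝ} (h : SBound n A M) : SBound 1 (A ^ k) (M ^ k) := by
  have hn1 : (1 : ℝ) ≤ n := by exact_mod_cast hn
  have := sBound_list_prod (List.replicate k (A, M)) (by
    rw [← List.length_pos_iff]; simp; omega) fun x hx => by
      rw [List.eq_of_mem_replicate hx]
      exact ⟨hA, h.mono_exponent hn1 (by simpa using hk)⟩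
  simpa using this

theorem SBound.pow_sub_pow {n k : ℕ} (hn : 1 ≤ n) (hk : n ≤ k) {A B : H →L[ℂ] H}
    (hAc : IsCompactOperator A) (hBc : IsCompactOperator B) {M δ : ℝ} (hA : SBound n A M)
    (hB : SBound n B M) (hAB : SBound n (A - B) δ) :
    SBound 1 (A ^ k - B ^ k) (k * (M ^ (k - 1) * δ)) := by
  have hn1 : (1 : ℝ) ≤ n := by exact_mod_cast hn
  -- Telescoping. The factor `A ^ i` keeps the number of factors equal to `k`, so each new term,
  -- with a single `A - B`, is trace class by Hölder with exponent `k`.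
  have key : ∀ j i, i + j = k → SBound 1 (A ^ i * (A ^ j - B ^ j)) (j * (M ^ (k - 1) * δ)) := by
    intro j
    induction j with
    | zero => intro i _; simpa using SBound.zero le_rfl
    | succ j ih =>
      intro i hi
      have e1 : A ^ i * (A ^ (j + 1) - B ^ (j + 1))
          = A ^ (i + 1) * (A ^ j - B ^ j) + A ^ i * ((A - B) * B ^ j) := by
        rw [pow_succ' A j, pow_succ' B j, pow_succ A i]
        noncomm_ring
      have h2 := sBound_list_prod
        (List.replicate i (A, M) ++ (A - B, δ) :: List.replicate j (B, M)) (by simp)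
        fun x hx => by
          have hl : ((List.replicate i (A, M) ++ (A - B, δ) :: List.replicate j (B, M)).length : ℝ)
              = k := by
            norm_cast; simp; omega
          have hnk : (n : ℝ) ≤ k := by exact_mod_cast hk
          rw [hl]
          rcases List.mem_append.mp hx with hx | hx
          · rw [List.eq_of_mem_replicate hx]
            exact ⟨hAc, hA.mono_exponent hn1 hnk⟩
          · rcases List.mem_cons.mp hx with hx | hx
            · rw [hx]
              exact ⟨hAc.sub hBc, hAB.mono_exponent hn1 hnk⟩
            · rw [List.eq_of_mem_replicate hx]
              exact ⟨hBc, hB.mono_exponent hn1 hnk⟩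
      rw [e1]
      have h3 := (ih (i + 1) (by omega)).add le_rfl (by simpa using h2)
      convert h3 using 1
      have : k - 1 = i + j := by omega
      rw [this, pow_add]
      push_cast
      ring
  simpa using key k 0 (by omega)

end SchattenHolder

/-! ### The trace and its independence of the basis -/

section Trace

variable {H : Type u} [NormedAddCommGroup H] [InnerProductSpace ℂ H]

theorem sum_norm_inner_mul_inner_le {ι : Type*} {b : ι → H} (hb : Orthonormal ℂ b) (x y : H)
    (s : Finset ι) : ∑ i ∈ s, ‖⟪x, b i⟫_ℂ * ⟪b i, y⟫_ℂ‖ ≤ ‖x‖ * ‖y‖ := by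
  simp_rw [norm_mul, norm_inner_symm x]
  refine (Real.sum_mul_le_sqrt_mul_sqrt _ _ _).trans ?_
  refine mul_le_mul ?_ ?_ (Real.sqrt_nonneg _) (norm_nonneg _)
  · exact Real.sqrt_le_iff.mpr ⟨norm_nonneg _, hb.sum_inner_products_le x⟩
  · exact Real.sqrt_le_iff.mpr ⟨norm_nonneg _, hb.sum_inner_products_le y⟩

theorem SBound.sum_norm_diag_le {X : H →L[ℂ] H} {M : ℝ} (h : SBound 1 X M) {ι : Type*}
    (b : HilbertBasis ι ℂ H) (s : Finset ι) : ∑ i ∈ s, ‖⟪b i, X (b i)⟫_ℂ‖ ≤ M := by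
  simpa using h.sum_finset_le s b.orthonormal b.orthonormal

theorem SBound.summable_norm_diag {X : H →L[ℂ] H} {M : ℝ} (h : SBound 1 X M) {ι : Type*}
    (b : HilbertBasis ι ℂ H) : Summable fun i => ‖⟪b i, X (b i)⟫_ℂ‖ :=
  summable_of_sum_le (fun _ => norm_nonneg _) (h.sum_norm_diag_le b)

/-- The double series `⟪e k, b i⟫ * ⟪b i, X (e k)⟫` converges absolutely: by Cauchy–Schwarz its
`k`-th row is at most `‖X (e k)‖`, which is summable. Summing first over `i` gives the diagonal in
`e`, summing first over `k` the diagonal in `b`. -/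
theorem IsSingularBasis.hasSum_diag {X : H →L[ℂ] H} {κ ι : Type*} {e : HilbertBasis κ ℂ H}
    (he : IsSingularBasis X e) {M : ℝ} (h : SBound 1 X M) (b : HilbertBasis ι ℂ H) :
    HasSum (fun i => ⟪b i, X (b i)⟫_ℂ) (∑' k, ⟪e k, X (e k)⟫_ℂ) := by
  let T : κ × ι → ℂ := fun q => ⟪e q.1, b q.2⟫_ℂ * ⟪b q.2, X (e q.1)⟫_ℂ
  have hle : ∀ k (s : Finset ι), ∑ i ∈ s, ‖T (k, i)‖ ≤ ‖X (e k)‖ := by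
    intro k s
    have := sum_norm_inner_mul_inner_le b.orthonormal (e k) (X (e k)) s
    rwa [e.orthonormal.1, one_mul] at this
  have hk : ∀ k, Summable fun i => ‖T (k, i)‖ := fun k =>
    summable_of_sum_le (fun _ => norm_nonneg _) (hle k)
  have hX : Summable fun k => ‖X (e k)‖ :=
    summable_of_sum_le (fun _ => norm_nonneg _) (c := M)
      (by simpa using (he.sBound_iff le_rfl h.1).mp h)
  have hT : Summable T := by
    refine Summable.of_norm ?_
    rw [summable_prod_of_nonneg fun _ => norm_nonneg _]
    exact ⟨hk, hX.of_nonneg_of_le (fun k => tsum_nonneg fun _ => norm_nonneg _)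
      fun k => (hk k).tsum_le_of_sum_le (hle k)⟩
  have h1 : HasSum (fun k => ⟪e k, X (e k)⟫_ℂ) (∑' q, T q) :=
    hT.hasSum.prod_fiberwise fun k => b.hasSum_inner_mul_inner (e k) (X (e k))
  have h2 : HasSum (fun i => ⟪b i, X (b i)⟫_ℂ) (∑' q, T q) := by
    refine ((Equiv.prodComm ι κ).hasSum_iff.mpr hT.hasSum).prod_fiberwise fun i => ?_
    have := (hasSum_inner_smul_apply X e (b i)).mapL (innerSL ℂ (b i))
    simpa [T, inner_smul_right] using this
  rw [h1.tsum_eq]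
  exact h2

variable [CompleteSpace H]

/-- The trace of a trace class operator may be computed in any orthonormal basis. -/
theorem hasSum_trace {X : H →L[ℂ] H} (hX : IsCompactOperator X) {M : ℝ} (h : SBound 1 X M)
    {ι : Type*} (b : HilbertBasis ι ℂ H) : HasSum (fun i => ⟪b i, X (b i)⟫_ℂ) (trace X) := by
  obtain ⟨κ, e, he⟩ := exists_isSingularBasis hX
  obtain ⟨b₀, hb₀⟩ := (exists_hilbertBasis ℂ H).choose_spec
  have h0 := (he.hasSum_diag h b₀).tsum_eq
  have h1 : trace X = ∑' k, ⟪e k, X (e k)⟫_ℂ := by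
    rw [← h0, trace]
    refine tsum_congr fun i => ?_
    rw [hb₀]
  rw [h1]
  exact he.hasSum_diag h b

theorem norm_trace_le {X : H →L[ℂ] H} (hX : IsCompactOperator X) {M : ℝ} (h : SBound 1 X M) :
    ‖trace X‖ ≤ M := by
  obtain ⟨ι, e, -⟩ := exists_isSingularBasis hX
  exact le_of_tendsto (hasSum_trace hX h e).norm
    (Eventually.of_forall fun s => (norm_sum_le _ _).trans (h.sum_norm_diag_le e s))

theorem trace_sub {X Y : H →L[ℂ] H} (hX : IsCompactOperator X) (hY : IsCompactOperator Y)
    {M N : ℝ} (h : SBound 1 X M) (h' : SBound 1 Y N) : trace (X - Y) = trace X - trace Y := by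
  obtain ⟨ι, e, -⟩ := exists_isSingularBasis hX
  refine (hasSum_trace (hX.sub hY) (h.sub le_rfl h') e).unique ?_
  have := (hasSum_trace hX h e).sub (hasSum_trace hY h' e)
  simpa only [sub_apply, inner_sub_right] using this

theorem trace_smul (c : ℂ) (X : H →L[ℂ] H) : trace (c • X) = c * trace X := by
  rw [trace, trace, ← tsum_mul_left]
  simp

/-- Parseval in the basis that defines `trace` expands each of the finitely many terms on the right;
the hypothesis reassembles their sum into the diagonal. -/
theorem trace_eq_sum {X : H →L[ℂ] H} {κ : Type*} [Fintype κ] (e : κ → H)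
    (he : ∀ x, X x = ∑ j, ⟪e j, X x⟫_ℂ • e j) : trace X = ∑ j, ⟪e j, X (e j)⟫_ℂ := by
  obtain ⟨b, hb⟩ := (exists_hilbertBasis ℂ H).choose_spec
  rw [trace]
  have h : ∀ j, HasSum (fun i => ⟪ContinuousLinearMap.adjoint X (e j), b i⟫_ℂ * ⟪b i, e j⟫_ℂ)
      ⟪e j, X (e j)⟫_ℂ := by
    intro j
    rw [← ContinuousLinearMap.adjoint_inner_left]
    exact b.hasSum_inner_mul_inner _ _
  rw [← (hasSum_sum fun j (_ : j ∈ Finset.univ) => h j).tsum_eq]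
  refine tsum_congr fun i => ?_
  rw [hb]
  conv_lhs => rw [he i]
  rw [inner_sum]
  refine Finset.sum_congr rfl fun j _ => ?_
  rw [inner_smul_right, ContinuousLinearMap.adjoint_inner_left]

end Trace

/-! ### Triangularization in finite rank and Weierstrass factors -/

section FiniteRank

/-- Schur's theorem by induction: the orthogonal complement of an eigenvector of the adjoint is
invariant under `T`, and the normalized eigenvector is appended as the last basis vector. -/
theorem exists_orthonormalBasis_triangular (d : ℕ) :
    ∀ (V : Type u) [NormedAddCommGroup V] [InnerProductSpace ℂ V] [FiniteDimensional ℂ V],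
      Module.finrank ℂ V = d → ∀ T : V →ₗ[ℂ] V,
        ∃ b : OrthonormalBasis (Fin d) ℂ V, ∀ i j, i < j → ⟪b j, T (b i)⟫_ℂ = 0 := by
  induction d with
  | zero =>
    intro V _ _ _ hd T
    exact ⟨(stdOrthonormalBasis ℂ V).reindex (finCongr hd), fun i => i.elim0⟩
  | succ d ih =>
    intro V _ _ _ hd T
    have : Nontrivial V := Module.nontrivial_of_finrank_pos (R := ℂ) (by omega)
    obtain ⟨c, hc⟩ := Module.End.exists_eigenvalue (LinearMap.adjoint T)
    obtain ⟨v, hv⟩ := hc.exists_hasEigenvector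
    have hv1 : LinearMap.adjoint T v = c • v := hv.apply_eq_smul
    have hfact : Fact (Module.finrank ℂ V = d + 1) := ⟨hd⟩
    have hW := Submodule.finrank_orthogonal_span_singleton (𝕜 := ℂ) (n := d) hv.2
    have hinv : ∀ x ∈ (ℂ ∙ v)ᗮ, T x ∈ (ℂ ∙ v)ᗮ := by
      intro x hx
      rw [Submodule.mem_orthogonal_singleton_iff_inner_right] at hx ⊢
      rw [← LinearMap.adjoint_inner_left, hv1, inner_smul_left, hx, mul_zero]
    obtain ⟨b, hb⟩ := ih _ hW (T.restrict hinv)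
    let u : V := ((‖v‖ : ℂ)⁻¹) • v
    have hu : ‖u‖ = 1 := by
      rw [norm_smul, norm_inv, Complex.norm_real, norm_norm,
        inv_mul_cancel₀ (norm_ne_zero_iff.mpr hv.2)]
    have hub : ∀ x ∈ (ℂ ∙ v)ᗮ, ⟪u, x⟫_ℂ = 0 := by
      intro x hx
      rw [Submodule.mem_orthogonal_singleton_iff_inner_right] at hx
      rw [inner_smul_left, hx, mul_zero]
    let w : Fin (d + 1) → V := Fin.snoc (fun i => (b i : V)) u
    have hw1 : ∀ i : Fin d, w i.castSucc = b i := fun i => by simp [w]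
    have hw2 : w (Fin.last d) = u := by simp [w]
    have hw : Orthonormal ℂ w := by
      refine ⟨fun i => ?_, fun i j hij => ?_⟩
      · refine Fin.lastCases ?_ (fun i => ?_) i
        · rw [hw2, hu]
        · rw [hw1]; exact b.orthonormal.1 i
      · revert hij
        refine Fin.lastCases ?_ (fun i => ?_) i <;> refine Fin.lastCases ?_ (fun j => ?_) j
        · exact fun h => absurd rfl h
        · intro _
          rw [hw1, hw2]
          exact hub _ (b j).2
        · intro _
          rw [hw1, hw2]
          exact inner_eq_zero_symm.mp (hub _ (b i).2)
        · intro h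
          rw [hw1, hw1]
          exact b.orthonormal.2 fun h' => h (by rw [h'])
    let B : OrthonormalBasis (Fin (d + 1)) ℂ V :=
      OrthonormalBasis.mk hw (by
        rw [hw.linearIndependent.span_eq_top_of_card_eq_finrank (by simp [hd])])
    have hB : ∀ i, B i = w i := fun i => by simp [B]
    refine ⟨B, fun i j => ?_⟩
    rw [hB, hB]
    refine Fin.lastCases ?_ (fun i => ?_) i
    · intro h
      exact absurd h (not_lt.mpr (Fin.le_last j))
    · refine Fin.lastCases ?_ (fun j => ?_) j
      · intro _
        rw [hw1, hw2]
        exact hub _ (hinv _ (b i).2)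
      · intro h
        rw [hw1, hw1]
        exact hb i j (by simpa using h)

theorem det_id_sub_comp_comm {V W : Type*} [AddCommGroup V] [Module ℂ V] [AddCommGroup W]
    [Module ℂ W] [FiniteDimensional ℂ V] [FiniteDimensional ℂ W] (f : W →ₗ[ℂ] V)
    (g : V →ₗ[ℂ] W) :
    LinearMap.det (LinearMap.id - f ∘ₗ g) = LinearMap.det (LinearMap.id - g ∘ₗ f) := by
  let b := Module.finBasis ℂ V
  let c := Module.finBasis ℂ W
  rw [← LinearMap.det_toMatrix b, ← LinearMap.det_toMatrix c, map_sub, map_sub,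
    LinearMap.toMatrix_comp b c b, LinearMap.toMatrix_comp c b c, LinearMap.toMatrix_id,
    LinearMap.toMatrix_id, Matrix.det_one_sub_mul_comm]

variable {H : Type u} [NormedAddCommGroup H] [InnerProductSpace ℂ H]

/-- Sylvester's identity, used twice, passes from the range of `F` to the possibly larger range of
`f` and from there to `W`. Any factorization through a finite-dimensional space thus computes the
determinant. -/
theorem finiteRankDet_of_comp {W : Type*} [AddCommGroup W] [Module ℂ W] [FiniteDimensional ℂ W]
    (F : H →L[ℂ] H) (f : W →ₗ[ℂ] H) (g : H →ₗ[ℂ] W) (h : ∀ x, F x = f (g x)) :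
    finiteRankDet F = LinearMap.det (LinearMap.id - g ∘ₗ f) := by
  let V := LinearMap.range f
  let R := LinearMap.range (F : H →ₗ[ℂ] H)
  have hRV : R ≤ V := by
    rintro _ ⟨x, rfl⟩
    exact ⟨g x, (h x).symm⟩
  have : FiniteDimensional ℂ R := Submodule.finiteDimensional_of_le hRV
  have h1 := det_id_sub_comp_comm (Submodule.inclusion hRV)
    ((F : H →ₗ[ℂ] H).rangeRestrict ∘ₗ V.subtype)
  have h2 := det_id_sub_comp_comm f.rangeRestrict (g ∘ₗ V.subtype)
  have h3 : Submodule.inclusion hRV ∘ₗ ((F : H →ₗ[ℂ] H).rangeRestrict ∘ₗ V.subtype)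
      = f.rangeRestrict ∘ₗ (g ∘ₗ V.subtype) := by
    ext x
    exact h x
  rw [h3, h2] at h1
  exact h1.symm

theorem finiteRankDet_eq_det (F : H →L[ℂ] H) {V : Submodule ℂ H} [FiniteDimensional ℂ V]
    (hV : ∀ x, F x ∈ V) :
    finiteRankDet F
      = LinearMap.det (LinearMap.id - (F : H →ₗ[ℂ] H).restrict (p := V) fun x _ => hV x) :=
  finiteRankDet_of_comp F V.subtype ((F : H →ₗ[ℂ] H).codRestrict V hV) fun _ => rfl

/-- A Schur basis of the range shows the eigenvalues as diagonal coefficients in one orthonormal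
family. `SBound`, with this family on both sides, therefore bounds their `ℓ^p` norm at once, which
is Weyl's inequality. -/
theorem exists_triangular_of_isFiniteRank [CompleteSpace H] {F : H →L[ℂ] H}
    (hF : IsFiniteRank F) :
    ∃ (d : ℕ) (e : Fin d → H), Orthonormal ℂ e ∧
      finiteRankDet F = ∏ j, (1 - ⟪e j, F (e j)⟫_ℂ) ∧
      ∀ k, 1 ≤ k → trace (F ^ k) = ∑ j, ⟪e j, F (e j)⟫_ℂ ^ k := by
  let V := LinearMap.range (F : H →ₗ[ℂ] H)
  have hV : FiniteDimensional ℂ V := hF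
  have hm : ∀ x, F x ∈ V := fun x => ⟨x, rfl⟩
  let T : V →ₗ[ℂ] V := (F : H →ₗ[ℂ] H).restrict (p := V) fun x _ => hm x
  obtain ⟨b, hb⟩ := exists_orthonormalBasis_triangular _ V rfl T
  have he : Orthonormal ℂ fun j => (b j : H) :=
    ⟨fun k => b.orthonormal.1 k, fun k l hkl => b.orthonormal.2 hkl⟩
  let M := LinearMap.toMatrix b.toBasis b.toBasis T
  have hM : ∀ i j, M i j = ⟪b i, T (b j)⟫_ℂ := by
    intro i j
    simp [M, LinearMap.toMatrix_apply, OrthonormalBasis.repr_apply_apply]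
  have hMp : ∀ k i j, (M ^ k) i j = ⟪b i, (T ^ k) (b j)⟫_ℂ := by
    intro k i j
    have hk : LinearMap.toMatrix b.toBasis b.toBasis (T ^ k) = M ^ k :=
      (LinearMap.toMatrix_pow b.toBasis T k).symm
    rw [← hk]
    simp [LinearMap.toMatrix_apply, OrthonormalBasis.repr_apply_apply]
  have hup : M.IsUpperTriangular := by
    intro i j hij
    rw [hM]
    exact hb j i hij
  have hTk : ∀ k (x : V), ((T ^ k) x : H) = (F ^ k) x := by
    intro k
    induction k with
    | zero => intro x; rfl
    | succ k ih =>
      intro x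
      rw [pow_succ, pow_succ]
      exact ih (T x)
  refine ⟨_, fun j => (b j : H), he, ?_, fun k hk => ?_⟩
  · rw [finiteRankDet_eq_det F hm, ← LinearMap.det_toMatrix b.toBasis, map_sub,
      LinearMap.toMatrix_id]
    change (1 - M).det = _
    have hup' : (1 - M).IsUpperTriangular := Matrix.blockTriangular_one.sub hup
    rw [Matrix.det_of_isUpperTriangular hup']
    refine Finset.prod_congr rfl fun j _ => ?_
    rw [Matrix.sub_apply, Matrix.one_apply_eq, hM]
    rfl
  · have hdiag : ∀ k j, (M ^ k) j j = M j j ^ k := by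
      intro k
      induction k with
      | zero => intro j; simp
      | succ k ih =>
        intro j
        rw [pow_succ, Matrix.mul_apply, Finset.sum_eq_single j, ih, pow_succ]
        · intro i _ hij
          rcases lt_or_gt_of_ne hij with h | h
          · rw [(hup.pow k : (M ^ k).BlockTriangular id) h, zero_mul]
          · rw [hup h, mul_zero]
        · simp
    have hk' : ∀ x, (F ^ k) x ∈ V := by
      intro x
      obtain ⟨l, rfl⟩ : ∃ l, k = l + 1 := ⟨k - 1, by omega⟩
      rw [pow_succ']
      exact hm _
    rw [trace_eq_sum (fun j => (b j : H)) fun x => ?_]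
    · refine Finset.sum_congr rfl fun j _ => ?_
      have h1 := hdiag k j
      rw [hMp, hM] at h1
      rw [← hTk]
      exact h1
    · have h1 := congrArg (Submodule.subtype V) (b.sum_repr' ⟨(F ^ k) x, hk' x⟩)
      rw [map_sum] at h1
      exact h1.symm

/-- The Weierstrass elementary factor `(1 - w) exp (∑_{k=1}^{n-1} w ^ k / k)`. -/
noncomputable def elemFactor (n : ℕ) (w : ℂ) : ℂ :=
  (1 - w) * Complex.exp (∑ k ∈ Finset.Ico 1 n, 1 / (k : ℂ) * w ^ k)

theorem hasSum_elemFactor {n : ℕ} (hn : 1 ≤ n) {w : ℂ} (hw : ‖w‖ < 1) :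
    Summable (fun k : ℕ => w ^ (k + n) / ((k + n : ℕ) : ℂ)) ∧
      elemFactor n w = Complex.exp (-∑' k : ℕ, w ^ (k + n) / ((k + n : ℕ) : ℂ)) := by
  have h := Complex.hasSum_taylorSeries_neg_log hw
  have hs : Summable (fun k : ℕ => w ^ (k + n) / ((k + n : ℕ) : ℂ)) :=
    (summable_nat_add_iff n).mpr h.summable
  refine ⟨hs, ?_⟩
  have h1 := h.summable.sum_add_tsum_nat_add n
  rw [h.tsum_eq] at h1
  have hne : 1 - w ≠ 0 := by
    intro h0
    rw [sub_eq_zero] at h0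
    rw [← h0] at hw
    simp at hw
  -- The term at `k = 0` is a division by zero, hence `0`, both here and in the logarithm series.
  have h2 : ∑ k ∈ Finset.Ico 1 n, 1 / (k : ℂ) * w ^ k = ∑ k ∈ Finset.range n, w ^ k / (k : ℂ) := by
    rw [Finset.sum_range_eq_add_Ico _ (by omega)]
    simp [div_eq_inv_mul]
  rw [elemFactor, h2]
  conv_lhs => rw [← Complex.exp_log hne]
  rw [← Complex.exp_add]
  congr 1
  linear_combination h1

/-- Comparison with a geometric series. The coefficients are left general to cover both powers of a
number and traces of powers. -/
theorem norm_tsum_tail_le {n : ℕ} (hn : 1 ≤ n) {c : ℕ → ℂ} {ρ : ℝ} (hρ0 : 0 ≤ ρ)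
    (hρ : ρ ≤ 1 / 2) (hc : ∀ k, ‖c k‖ ≤ ρ ^ (k + n)) :
    ‖∑' k : ℕ, c k / ((k + n : ℕ) : ℂ)‖ ≤ 2 * ρ ^ n := by
  have hg : HasSum (fun k : ℕ => ρ ^ k * ρ ^ n) ((1 - ρ)⁻¹ * ρ ^ n) :=
    (hasSum_geometric_of_lt_one hρ0 (by linarith)).mul_right _
  refine (tsum_of_norm_bounded hg fun k => ?_).trans ?_
  · rw [norm_div, Complex.norm_natCast, ← pow_add]
    have : (1 : ℝ) ≤ ((k + n : ℕ) : ℝ) := by exact_mod_cast (by omega : 1 ≤ k + n)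
    exact (div_le_self (norm_nonneg _) this).trans (hc k)
  · refine mul_le_mul_of_nonneg_right ?_ (by positivity)
    rw [inv_le_comm₀ (by linarith) (by norm_num)]
    linarith

/-- For `‖w‖ ≤ 1 / 2` the logarithm is a tail of size `2 * ‖w‖ ^ n`. Otherwise every lower power is
at most `2 ^ n * ‖w‖ ^ n`; there are `n - 1` of them in the exponent, and `‖1 - w‖ ≤ exp ‖w‖` adds
one more. -/
theorem norm_elemFactor_le {n : ℕ} (hn : 1 ≤ n) (w : ℂ) :
    ‖elemFactor n w‖ ≤ Real.exp ((n * 2 ^ n + 2) * ‖w‖ ^ n) := by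
  rcases le_or_gt ‖w‖ (1 / 2) with h | h
  · rw [(hasSum_elemFactor hn (by linarith)).2]
    refine (Complex.norm_exp_le_exp_norm _).trans (Real.exp_le_exp.mpr ?_)
    rw [norm_neg]
    refine (norm_tsum_tail_le hn (norm_nonneg w) h fun k => (norm_pow _ _).le).trans ?_
    have : (0 : ℝ) ≤ n * 2 ^ n := by positivity
    gcongr
    linarith
  · have hpow : ∀ k ≤ n, ‖w‖ ^ k ≤ 2 ^ n * ‖w‖ ^ n := by
      intro k hk
      have h1 : (1 : ℝ) ≤ (2 * ‖w‖) ^ (n - k) := one_le_pow₀ (by linarith)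
      calc ‖w‖ ^ k ≤ ‖w‖ ^ k * (2 * ‖w‖) ^ (n - k) := le_mul_of_one_le_right (by positivity) h1
        _ = 2 ^ (n - k) * (‖w‖ ^ k * ‖w‖ ^ (n - k)) := by rw [mul_pow]; ring
        _ = 2 ^ (n - k) * ‖w‖ ^ n := by rw [← pow_add, Nat.add_sub_cancel' hk]
        _ ≤ 2 ^ n * ‖w‖ ^ n := by
          gcongr
          · norm_num
          · omega
    have h1 : ‖1 - w‖ ≤ Real.exp ‖w‖ := by
      calc ‖1 - w‖ ≤ ‖(1 : ℂ)‖ + ‖w‖ := norm_sub_le _ _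
        _ ≤ Real.exp ‖w‖ := by rw [norm_one, add_comm]; exact Real.add_one_le_exp _
    have h2 : ‖∑ k ∈ Finset.Ico 1 n, 1 / (k : ℂ) * w ^ k‖ ≤ (n - 1 : ℕ) * (2 ^ n * ‖w‖ ^ n) := by
      refine (norm_sum_le _ _).trans ?_
      rw [← Nat.card_Ico, ← nsmul_eq_mul]
      refine Finset.sum_le_card_nsmul _ _ _ fun k hk => ?_
      rw [Finset.mem_Ico] at hk
      rw [norm_mul, norm_pow, norm_div, norm_one, Complex.norm_natCast]
      refine (mul_le_of_le_one_left (by positivity) ?_).trans (hpow k hk.2.le)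
      rw [div_le_one (by exact_mod_cast hk.1)]
      exact_mod_cast hk.1
    rw [elemFactor, norm_mul]
    calc _ ≤ Real.exp ‖w‖ * Real.exp ((n - 1 : ℕ) * (2 ^ n * ‖w‖ ^ n)) := by
          gcongr
          exact (Complex.norm_exp_le_exp_norm _).trans (Real.exp_le_exp.mpr h2)
      _ ≤ _ := by
          rw [← Real.exp_add]
          refine Real.exp_le_exp.mpr ?_
          have h3 := hpow 1 hn
          rw [pow_one] at h3
          have h4 : ((n - 1 : ℕ) : ℝ) = n - 1 := by rw [Nat.cast_sub hn]; simp
          rw [h4]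
          have h5 : 0 ≤ ‖w‖ ^ n := by positivity
          nlinarith

end FiniteRank

/-! ### Existence, analyticity and trace expansion of the regularized determinant -/

section RegDet

variable {H : Type u} [NormedAddCommGroup H] [InnerProductSpace ℂ H]

theorem IsFiniteRank.smul {A : H →L[ℂ] H} (hA : IsFiniteRank A) (c : ℂ) :
    IsFiniteRank (c • A) := by
  have : FiniteDimensional ℂ (LinearMap.range (A : H →ₗ[ℂ] H)) := hA
  refine Submodule.finiteDimensional_of_le (S₂ := LinearMap.range (A : H →ₗ[ℂ] H)) ?_
  rintro _ ⟨x, rfl⟩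
  exact ⟨c • x, map_smul _ _ _⟩

theorem IsFiniteRank.add {A B : H →L[ℂ] H} (hA : IsFiniteRank A) (hB : IsFiniteRank B) :
    IsFiniteRank (A + B) := by
  have : FiniteDimensional ℂ (LinearMap.range (A : H →ₗ[ℂ] H)) := hA
  have : FiniteDimensional ℂ (LinearMap.range (B : H →ₗ[ℂ] H)) := hB
  refine Submodule.finiteDimensional_of_le
    (S₂ := LinearMap.range (A : H →ₗ[ℂ] H) ⊔ LinearMap.range (B : H →ₗ[ℂ] H)) ?_
  rintro _ ⟨x, rfl⟩
  exact Submodule.add_mem_sup ⟨x, rfl⟩ ⟨x, rfl⟩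

theorem IsFiniteRank.sub {A B : H →L[ℂ] H} (hA : IsFiniteRank A) (hB : IsFiniteRank B) :
    IsFiniteRank (A - B) := by
  have := hA.add (hB.smul (-1))
  rwa [neg_one_smul, ← sub_eq_add_neg] at this

theorem isCompactOperator_pow {A : H →L[ℂ] H} (hA : IsCompactOperator A) {k : ℕ} (hk : 1 ≤ k) :
    IsCompactOperator (A ^ k : H →L[ℂ] H) := by
  obtain ⟨l, rfl⟩ : ∃ l, k = l + 1 := ⟨k - 1, by omega⟩
  rw [pow_succ]
  exact hA.clm_comp (A ^ l)

variable [CompleteSpace H]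

theorem finiteRankRegDet_eq_prod {n : ℕ} {F : H →L[ℂ] H} {d : ℕ} {e : Fin d → H}
    (h1 : finiteRankDet F = ∏ j, (1 - ⟪e j, F (e j)⟫_ℂ))
    (h2 : ∀ k, 1 ≤ k → trace (F ^ k) = ∑ j, ⟪e j, F (e j)⟫_ℂ ^ k) :
    finiteRankRegDet n F = ∏ j, elemFactor n ⟪e j, F (e j)⟫_ℂ := by
  simp only [elemFactor]
  rw [Finset.prod_mul_distrib, ← Complex.exp_sum, finiteRankRegDet, h1, Finset.sum_comm]
  congr 2
  refine Finset.sum_congr rfl fun k hk => ?_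
  rw [h2 k (Finset.mem_Ico.mp hk).1, Finset.mul_sum]

theorem norm_finiteRankRegDet_le {n : ℕ} (hn : 1 ≤ n) {F : H →L[ℂ] H} (hF : IsFiniteRank F)
    {M : ℝ} (h : SBound n F M) :
    ‖finiteRankRegDet n F‖ ≤ Real.exp ((n * 2 ^ n + 2) * M ^ n) := by
  obtain ⟨d, e, he, h1, h2⟩ := exists_triangular_of_isFiniteRank hF
  rw [finiteRankRegDet_eq_prod h1 h2, norm_prod]
  have hs := h.sum_le he he
  simp_rw [Real.rpow_natCast] at hs
  calc _ ≤ ∏ j, Real.exp ((n * 2 ^ n + 2) * ‖⟪e j, F (e j)⟫_ℂ‖ ^ n) :=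
        Finset.prod_le_prod (fun _ _ => norm_nonneg _) fun j _ => norm_elemFactor_le hn _
    _ ≤ _ := by
        rw [← Real.exp_sum, ← Finset.mul_sum]
        gcongr

/-- The exponent in `det_n (1 - A) = exp (-∑_{k ≥ n} tr (A ^ k) / k)`. -/
noncomputable def tailSum (n : ℕ) (A : H →L[ℂ] H) : ℂ :=
  ∑' k : ℕ, trace (A ^ (k + n)) / ((k + n : ℕ) : ℂ)

/-- As `M < 1` bounds the operator norm, all eigenvalues lie in the open unit disc, and the finitely
many logarithm series can be added. -/
theorem finiteRankRegDet_eq_exp {n : ℕ} (hn : 1 ≤ n) {F : H →L[ℂ] H} (hF : IsFiniteRank F)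
    {M : ℝ} (h : SBound n F M) (hM : M < 1) :
    finiteRankRegDet n F = Complex.exp (-tailSum n F) := by
  obtain ⟨d, e, he, h1, h2⟩ := exists_triangular_of_isFiniteRank hF
  have hn1 : (1 : ℝ) ≤ n := by exact_mod_cast hn
  have hlt : ∀ j, ‖⟪e j, F (e j)⟫_ℂ‖ < 1 := by
    intro j
    refine lt_of_le_of_lt ?_ (lt_of_le_of_lt (h.opNorm_le hn1) hM)
    calc _ ≤ ‖e j‖ * ‖F (e j)‖ := norm_inner_le_norm _ _
      _ ≤ ‖e j‖ * (‖F‖ * ‖e j‖) := by gcongr; exact F.le_opNorm _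
      _ = ‖F‖ := by rw [he.1]; ring
  rw [finiteRankRegDet_eq_prod h1 h2,
    Finset.prod_congr rfl fun j _ => (hasSum_elemFactor hn (hlt j)).2, ← Complex.exp_sum,
    Finset.sum_neg_distrib, tailSum,
    ← Summable.tsum_finsetSum fun j _ => (hasSum_elemFactor hn (hlt j)).1]
  congr 2
  refine tsum_congr fun k => ?_
  rw [h2 (k + n) (by omega), Finset.sum_div]

/-- All `A + z • B` map into the fixed finite-dimensional space `range A + range B`. There the
determinant is that of a matrix affine in `z`, and the traces are finite sums of coefficients. -/
theorem differentiable_finiteRankRegDet (n : ℕ) {A B : H →L[ℂ] H} (hA : IsFiniteRank A)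
    (hB : IsFiniteRank B) : Differentiable ℂ fun z : ℂ => finiteRankRegDet n (A + z • B) := by
  have : FiniteDimensional ℂ (LinearMap.range (A : H →ₗ[ℂ] H)) := hA
  have : FiniteDimensional ℂ (LinearMap.range (B : H →ₗ[ℂ] H)) := hB
  let V := LinearMap.range (A : H →ₗ[ℂ] H) ⊔ LinearMap.range (B : H →ₗ[ℂ] H)
  have hAV : ∀ x, A x ∈ V := fun x => Submodule.mem_sup_left ⟨x, rfl⟩
  have hBV : ∀ x, B x ∈ V := fun x => Submodule.mem_sup_right ⟨x, rfl⟩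
  have hV : ∀ (z : ℂ) x, (A + z • B) x ∈ V := fun z x =>
    V.add_mem (hAV x) (V.smul_mem z (hBV x))
  let b := stdOrthonormalBasis ℂ V
  unfold finiteRankRegDet
  refine Differentiable.fun_mul ?_ (Differentiable.cexp (Differentiable.fun_sum fun k hk =>
    Differentiable.const_mul ?_ _))
  · let a : V →ₗ[ℂ] V := (A : H →ₗ[ℂ] H).restrict (p := V) fun x _ => hAV x
    let c : V →ₗ[ℂ] V := (B : H →ₗ[ℂ] H).restrict (p := V) fun x _ => hBV x
    have h : ∀ z : ℂ, finiteRankDet (A + z • B)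
        = (1 - (LinearMap.toMatrix b.toBasis b.toBasis a
            + z • LinearMap.toMatrix b.toBasis b.toBasis c)).det := by
      intro z
      rw [finiteRankDet_eq_det _ (hV z), ← LinearMap.det_toMatrix b.toBasis, map_sub,
        LinearMap.toMatrix_id, ← map_smul, ← map_add]
      rfl
    simp_rw [h, Matrix.det_apply]
    refine Differentiable.fun_sum fun σ _ => Differentiable.const_smul ?_ _
    refine Differentiable.fun_finsetProd fun i _ => ?_
    simp only [Matrix.sub_apply, Matrix.add_apply, Matrix.smul_apply, smul_eq_mul]
    fun_prop
  · have h : ∀ z : ℂ, trace ((A + z • B) ^ k)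
        = ∑ j, ⟪(b j : H), ((A + z • B) ^ k) (b j : H)⟫_ℂ := by
      intro z
      refine trace_eq_sum _ fun x => ?_
      obtain ⟨l, rfl⟩ : ∃ l, k = l + 1 := ⟨k - 1, by have := Finset.mem_Ico.mp hk; omega⟩
      have hx : ((A + z • B) ^ (l + 1)) x ∈ V := by rw [pow_succ']; exact hV z _
      have h1 := congrArg (Submodule.subtype V) (b.sum_repr' ⟨_, hx⟩)
      rw [map_sum] at h1
      exact h1.symm
    simp_rw [h]
    have hp : Differentiable ℂ fun z : ℂ => (A + z • B) ^ k := by fun_prop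
    refine Differentiable.fun_sum fun j _ => ?_
    exact ((innerSL ℂ (b j : H)).comp
      (ContinuousLinearMap.apply ℂ H (b j : H))).differentiable.comp hp

/-- A local Lipschitz constant of the regularized determinant. -/
noncomputable def detLip (n : ℕ) (M : ℝ) : ℝ := 2 * Real.exp ((n * 2 ^ n + 2) * (M + 1) ^ n)

theorem detLip_nonneg (n : ℕ) (M : ℝ) : 0 ≤ detLip n M := by
  rw [detLip]; positivity

/-- Schwarz lemma for `z ↦ det_n (1 - (A + z (B - A)))`: on the disc of radius `1 / δ` the operators
have bound `M + 1`, so the function is bounded by `Q` there, and its values at `0` and `1` differ by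
at most `2 * Q * δ`. -/
theorem norm_finiteRankRegDet_sub_le {n : ℕ} (hn : 1 ≤ n) {A B : H →L[ℂ] H}
    (hA : IsFiniteRank A) (hB : IsFiniteRank B) {M δ : ℝ} (h : SBound n A M)
    (hAB : SBound n (B - A) δ) (hδ0 : 0 < δ) (hδ : δ < 1) :
    ‖finiteRankRegDet n B - finiteRankRegDet n A‖ ≤ detLip n M * δ := by
  have hn1 : (1 : ℝ) ≤ n := by exact_mod_cast hn
  have hBA := hB.sub hA
  let g : ℂ → ℂ := fun z => finiteRankRegDet n (A + z • (B - A))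
  have hg : Differentiable ℂ g := differentiable_finiteRankRegDet n hA hBA
  set Q := Real.exp ((n * 2 ^ n + 2) * (M + 1) ^ n) with hQ
  have hbd : ∀ z ∈ Metric.ball (0 : ℂ) (1 / δ), ‖g z‖ ≤ Q := by
    intro z hz
    rw [mem_ball_zero_iff, lt_div_iff₀ hδ0] at hz
    refine norm_finiteRankRegDet_le hn (hA.add (hBA.smul z)) ?_
    exact (h.add hn1 (hAB.smul z)).mono hn1 (by linarith)
  have hmaps : Set.MapsTo g (Metric.ball 0 (1 / δ)) (Metric.closedBall (g 0) (2 * Q)) := by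
    intro z hz
    rw [Metric.mem_closedBall, dist_eq_norm]
    refine (norm_sub_le _ _).trans ?_
    have := hbd z hz
    have := hbd 0 (Metric.mem_ball_self (by positivity))
    linarith
  have h1 : (1 : ℂ) ∈ Metric.ball (0 : ℂ) (1 / δ) := by
    rw [mem_ball_zero_iff, norm_one, lt_div_iff₀ hδ0]; linarith
  have h2 := Complex.dist_le_div_mul_dist_of_mapsTo_ball hg.differentiableOn hmaps h1
  have e1 : g 1 = finiteRankRegDet n B := by simp [g]
  have e0 : g 0 = finiteRankRegDet n A := by simp [g]
  rw [e1, e0, dist_eq_norm] at h2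
  refine h2.trans (le_of_eq ?_)
  rw [detLip, ← hQ, dist_zero_right, norm_one, mul_one]
  field_simp

/-- The filter of operators of finite rank converging to `A` in the Schatten norm. -/
noncomputable def finiteRankNhds (n : ℕ) (A : H →L[ℂ] H) : Filter (H →L[ℂ] H) :=
  comap (fun F : H →L[ℂ] H => schattenNorm n (F - A)) (𝓝 0) ⊓ 𝓟 {F | IsFiniteRank F}

theorem eventually_finiteRankNhds {n : ℕ} (hn : 1 ≤ n) (A : H →L[ℂ] H) {δ : ℝ} (hδ : 0 < δ) :
    ∀ᶠ F in finiteRankNhds n A, IsFiniteRank F ∧ SBound n (F - A) δ := by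
  have hn1 : (1 : ℝ) ≤ n := by exact_mod_cast hn
  have h1 : ∀ᶠ F in finiteRankNhds n A, schattenNorm n (F - A) ≤ ENNReal.ofReal δ :=
    Eventually.filter_mono inf_le_left
      ((eventually_le_nhds (by simpa using hδ)).comap _)
  have h2 : ∀ᶠ F in finiteRankNhds n A, IsFiniteRank F :=
    Eventually.filter_mono inf_le_right (eventually_principal.mpr fun _ h => h)
  filter_upwards [h1, h2] with F hF hF'
  exact ⟨hF', ((schattenNorm_le_ofReal_iff hn1 hδ.le).mp hF).2⟩

theorem IsSingularBasis.tendsto_finiteRankNhds {n : ℕ} (hn : 1 ≤ n) {A : H →L[ℂ] H}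
    (hA : IsCompactOperator A) {M : ℝ} (h : SBound n A M) {ι : Type*} {e : HilbertBasis ι ℂ H}
    (he : IsSingularBasis A e) :
    Tendsto (DynZeta.truncation A e) atTop (finiteRankNhds n A) := by
  have hn1 : (1 : ℝ) ≤ n := by exact_mod_cast hn
  refine tendsto_inf.mpr ⟨tendsto_comap_iff.mpr ?_,
    tendsto_principal.mpr (Eventually.of_forall (isFiniteRank_truncation A e))⟩
  rw [ENNReal.tendsto_nhds_zero]
  intro ε hε
  obtain ⟨δ, hδ0, hδ⟩ : ∃ δ : ℝ, 0 < δ ∧ ENNReal.ofReal δ ≤ ε := by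
    rcases eq_or_ne ε ∞ with rfl | hne
    · exact ⟨1, one_pos, le_top⟩
    · exact ⟨ε.toReal, ENNReal.toReal_pos hε.ne' hne, (ENNReal.ofReal_toReal hne).le⟩
  filter_upwards [he.eventually_sBound hn1 h hδ0] with s hs
  refine le_trans ((schattenNorm_le_ofReal_iff hn1 hδ0.le).mpr ⟨?_, hs⟩) hδ
  exact (isFiniteRank_truncation A e s).isCompactOperator.sub hA

/-- The truncations along a singular basis converge along this filter, so a limit along it is
unique. -/
theorem neBot_finiteRankNhds {n : ℕ} (hn : 1 ≤ n) {A : H →L[ℂ] H} (hA : IsCompactOperator A)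
    {M : ℝ} (h : SBound n A M) : (finiteRankNhds n A).NeBot := by
  obtain ⟨ι, e, he⟩ := exists_isSingularBasis hA
  exact (he.tendsto_finiteRankNhds hn hA h).neBot

/-- The regularized determinant is the limit along the operators of finite rank. -/
theorem tendsto_regDet {n : ℕ} (hn : 1 ≤ n) {A : H →L[ℂ] H} (hA : IsCompactOperator A) {M : ℝ}
    (h : SBound n A M) :
    Tendsto (finiteRankRegDet n) (finiteRankNhds n A) (𝓝 (regDet n A)) := by
  have hn1 : (1 : ℝ) ≤ n := by exact_mod_cast hn
  have := neBot_finiteRankNhds hn hA h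
  -- The values form a Cauchy filter: two operators within `δ` of `A` are within `2 * δ` of each
  -- other and bounded by `M + 1`, so the Lipschitz estimate applies.
  refine tendsto_nhds_limUnder (CompleteSpace.complete (cauchy_map_iff.mpr ⟨this, ?_⟩))
  rw [Metric.uniformity_basis_dist.tendsto_right_iff]
  intro ε hε
  obtain ⟨δ, hδ0, hδ⟩ : ∃ δ : ℝ, 0 < δ ∧ δ < 1 / 2 ∧ detLip n (M + 1) * (2 * δ) < ε := by
    have hL := detLip_nonneg n (M + 1)
    refine ⟨min (1 / 4) (ε / (4 * (detLip n (M + 1) + 1))), by positivity,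
      (min_le_left _ _).trans_lt (by norm_num), ?_⟩
    calc _ ≤ detLip n (M + 1) * (2 * (ε / (4 * (detLip n (M + 1) + 1)))) := by
          gcongr; exact min_le_right _ _
      _ = ε / 2 * (detLip n (M + 1) / (detLip n (M + 1) + 1)) := by field_simp; ring
      _ ≤ ε / 2 * 1 := by
          gcongr
          rw [div_le_one (by positivity)]
          linarith
      _ < ε := by linarith
  have h1 := eventually_finiteRankNhds hn A hδ0
  filter_upwards [h1.prod_mk h1] with ⟨F, G⟩ ⟨⟨hF, hF'⟩, hG, hG'⟩
  have h2 : SBound n (F - G) (2 * δ) := by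
    have := hF'.sub hn1 hG'
    rw [sub_sub_sub_cancel_right] at this
    exact this.mono hn1 (by linarith)
  have h3 : SBound n G (M + 1) := by
    have := hG'.add hn1 h
    rw [sub_add_cancel] at this
    exact this.mono hn1 (by linarith)
  rw [dist_eq_norm]
  exact (norm_finiteRankRegDet_sub_le hn hG hF h3 h2 (by linarith) (by linarith)).trans_lt hδ.2

theorem norm_regDet_sub_le {n : ℕ} (hn : 1 ≤ n) {A F : H →L[ℂ] H} (hA : IsCompactOperator A)
    (hF : IsFiniteRank F) {M δ : ℝ} (h : SBound n F M) (hAF : SBound n (A - F) δ) (hδ0 : 0 < δ)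
    (hδ : δ < 1 / 2) : ‖regDet n A - finiteRankRegDet n F‖ ≤ detLip n M * (2 * δ) := by
  have hn1 : (1 : ℝ) ≤ n := by exact_mod_cast hn
  have hA' : SBound n A (δ + M) := by
    have := hAF.add hn1 h
    rwa [sub_add_cancel] at this
  have := neBot_finiteRankNhds hn hA hA'
  refine le_of_tendsto ((tendsto_regDet hn hA hA').sub_const _).norm ?_
  filter_upwards [eventually_finiteRankNhds hn A hδ0] with G ⟨hG, hG'⟩
  refine norm_finiteRankRegDet_sub_le hn hF hG h ?_ (by linarith) (by linarith)
  have := hG'.add hn1 hAF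
  rw [sub_add_sub_cancel] at this
  exact this.mono hn1 (by linarith)

/-- The regularized determinant of `1 - z A` is an entire function of `z`. -/
theorem differentiable_regDet {n : ℕ} (hn : 1 ≤ n) {A : H →L[ℂ] H} (hA : IsCompactOperator A)
    {M : ℝ} (h : SBound n A M) : Differentiable ℂ fun z : ℂ => regDet n (z • A) := by
  have hn1 : (1 : ℝ) ≤ n := by exact_mod_cast hn
  obtain ⟨ι, e, he⟩ := exists_isSingularBasis hA
  rw [← differentiableOn_univ]
  refine TendstoLocallyUniformlyOn.differentiableOn (φ := (atTop : Filter (Finset ι)))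
    (F := fun s z => finiteRankRegDet n (z • truncation A e s)) ?_
    (Eventually.of_forall fun s => ?_) isOpen_univ
  · rw [tendstoLocallyUniformlyOn_iff_forall_isCompact isOpen_univ]
    intro K _ hK
    obtain ⟨R, hR⟩ := hK.isBounded.exists_pos_norm_le
    rw [Metric.tendstoUniformlyOn_iff]
    intro ε hε
    -- For `‖z‖ ≤ R` this one Lipschitz constant serves all `z • truncation A e s`; truncating
    -- within `δ / R` makes the scaled error at most `δ`, uniformly in `z`.
    set L := detLip n (R * M) with hL
    have hL0 : 0 ≤ L := detLip_nonneg n _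
    obtain ⟨δ, hδ0, hδ1, hδ2⟩ : ∃ δ : ℝ, 0 < δ ∧ δ < 1 / 2 ∧ L * (2 * δ) < ε := by
      refine ⟨min (1 / 4) (ε / (4 * (L + 1))), by positivity,
        (min_le_left _ _).trans_lt (by norm_num), ?_⟩
      calc _ ≤ L * (2 * (ε / (4 * (L + 1)))) := by
            gcongr; exact min_le_right _ _
        _ = ε / 2 * (L / (L + 1)) := by field_simp; ring
        _ ≤ ε / 2 * 1 := by
            gcongr
            rw [div_le_one (by positivity)]
            linarith
        _ < ε := by linarith
    filter_upwards [he.eventually_sBound hn1 h (div_pos hδ0 hR.1)] with s hs z hz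
    rw [dist_eq_norm]
    refine (norm_regDet_sub_le hn (hA.smul z) ((isFiniteRank_truncation A e s).smul z)
      (((he.sBound_truncation hn1 h s).smul z).mono hn1
        (mul_le_mul_of_nonneg_right (hR.2 z hz) h.1)) ?_ hδ0 hδ1).trans_lt hδ2
    have h1 := (hs.neg.smul z).mono hn1 (N := δ) (by
      calc ‖z‖ * (δ / R) ≤ R * (δ / R) :=
            mul_le_mul_of_nonneg_right (hR.2 z hz) (div_pos hδ0 hR.1).le
        _ = δ := mul_div_cancel₀ _ hR.1.ne')
    rwa [neg_sub, smul_sub] at h1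
  · have := differentiable_finiteRankRegDet n (A := 0) (B := truncation A e s) (by
      simpa using (isFiniteRank_truncation A e s).smul 0) (isFiniteRank_truncation A e s)
    simpa using this.differentiableOn

theorem norm_trace_pow_le {n k : ℕ} (hn : 1 ≤ n) (hk : n ≤ k) {A : H →L[ℂ] H}
    (hA : IsCompactOperator A) {M : ℝ} (h : SBound n A M) : ‖trace (A ^ k)‖ ≤ M ^ k :=
  norm_trace_le (isCompactOperator_pow hA (hn.trans hk)) (h.pow hn hk hA)

/-- For small `A`, the regularized determinant is the exponential of a series of traces. -/
theorem regDet_eq_exp {n : ℕ} (hn : 1 ≤ n) {A : H →L[ℂ] H} (hA : IsCompactOperator A) {M : ℝ}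
    (h : SBound n A M) (hM : M < 1) : regDet n A = Complex.exp (-tailSum n A) := by
  have hn1 : (1 : ℝ) ≤ n := by exact_mod_cast hn
  obtain ⟨ι, e, he⟩ := exists_isSingularBasis hA
  have h1 := (tendsto_regDet hn hA h).comp (he.tendsto_finiteRankNhds hn hA h)
  have hc : ∀ s, IsCompactOperator (truncation A e s) := fun s =>
    (isFiniteRank_truncation A e s).isCompactOperator
  have hb := he.sBound_truncation hn1 h
  have h2 : Tendsto (fun s => tailSum n (truncation A e s)) atTop (𝓝 (tailSum n A)) := by
    -- Truncation does not increase the Schatten bound, so `M ^ (k + n)` dominates uniformly in `s`;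
    -- the terms converge by the telescoping estimate for powers.
    refine tendsto_tsum_of_dominated_convergence (bound := fun k => M ^ (k + n)) ?_ (fun k => ?_)
      (Eventually.of_forall fun s k => ?_)
    · exact (summable_nat_add_iff n).mpr (summable_geometric_of_lt_one h.1 hM)
    · refine Tendsto.div_const ?_ _
      rw [tendsto_iff_norm_sub_tendsto_zero, Metric.tendsto_nhds]
      intro ε hε
      set c : ℝ := ((k + n : ℕ) : ℝ) * M ^ (k + n - 1) with hcd
      have hc0 : 0 ≤ c := mul_nonneg (Nat.cast_nonneg _) (pow_nonneg h.1 _)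
      have hδ : 0 < ε / (c + 1) := by positivity
      filter_upwards [he.eventually_sBound hn1 h hδ] with s hs
      have hk : n ≤ k + n := by omega
      have h3 := SBound.pow_sub_pow hn hk (hc s) hA (hb s) h hs
      rw [dist_zero_right, norm_norm, ← trace_sub (isCompactOperator_pow (hc s) (hn.trans hk))
        (isCompactOperator_pow hA (hn.trans hk)) ((hb s).pow hn hk (hc s)) (h.pow hn hk hA)]
      refine (norm_trace_le ((isCompactOperator_pow (hc s) (hn.trans hk)).sub
        (isCompactOperator_pow hA (hn.trans hk))) h3).trans_lt ?_
      rw [← mul_assoc, ← hcd, mul_div_assoc', div_lt_iff₀ (by positivity)]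
      nlinarith
    · rw [norm_div, Complex.norm_natCast]
      have h4 : (1 : ℝ) ≤ ((k + n : ℕ) : ℝ) := by exact_mod_cast (by omega : 1 ≤ k + n)
      exact (div_le_self (norm_nonneg _) h4).trans
        (norm_trace_pow_le hn (by omega) (hc s) (hb s))
  refine tendsto_nhds_unique h1 ((Complex.continuous_exp.tendsto _).comp h2.neg |>.congr ?_)
  intro s
  exact (finiteRankRegDet_eq_exp hn (isFiniteRank_truncation A e s) (hb s) hM).symm

end RegDet

/-! ### Singular bases, norms and traces of Hilbert tensor products -/

section TensorBases

theorem clm_eq_zero_of_hilbertBasis {H : Type*} [NormedAddCommGroup H] [InnerProductSpace ℂ H]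
    {ι : Type*} (e : HilbertBasis ι ℂ H) (f : H →L[ℂ] ℂ) (h : ∀ k, f (e k) = 0) (x : H) :
    f x = 0 := by
  have := (e.hasSum_repr x).mapL f
  simp_rw [map_smul, h, smul_zero] at this
  exact this.unique hasSum_zero

theorem eq_zero_of_inner_coe {E : Type*} [NormedAddCommGroup E] [InnerProductSpace ℂ E]
    {w : UniformSpace.Completion E}
    (h : ∀ x : E, ⟪w, (x : UniformSpace.Completion E)⟫_ℂ = 0) : w = 0 := by
  rw [← inner_self_eq_zero (𝕜 := ℂ)]
  have : ∀ z : UniformSpace.Completion E, ⟪w, z⟫_ℂ = 0 := fun z =>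
    UniformSpace.Completion.induction_on z (isClosed_eq (by fun_prop) continuous_const) h
  exact this w

theorem orthonormal_coe {E : Type*} [NormedAddCommGroup E] [InnerProductSpace ℂ E] {ι : Type*}
    {v : ι → E} (hv : Orthonormal ℂ v) :
    Orthonormal ℂ fun i => (v i : UniformSpace.Completion E) :=
  ⟨fun i => by rw [UniformSpace.Completion.norm_coe, hv.1],
    fun i j hij => by
      change ⟪(v i : UniformSpace.Completion E), (v j : UniformSpace.Completion E)⟫_ℂ = 0
      rw [UniformSpace.Completion.inner_coe, hv.2 hij]⟩

/-- The orthonormal basis of the completion given by an orthonormal family. -/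
noncomputable def completionBasis {E : Type*} [NormedAddCommGroup E] [InnerProductSpace ℂ E]
    {ι : Type*} {v : ι → E} (hv : Orthonormal ℂ v)
    (hd : ∀ w : UniformSpace.Completion E,
      (∀ i, ⟪w, (v i : UniformSpace.Completion E)⟫_ℂ = 0) → w = 0) :
    HilbertBasis ι ℂ (UniformSpace.Completion E) :=
  HilbertBasis.mkOfOrthogonalEqBot (orthonormal_coe hv) (by
    rw [eq_bot_iff]
    intro w hw
    refine hd w fun i => ?_
    exact (Submodule.mem_orthogonal' _ _).mp hw _ (Submodule.subset_span ⟨i, rfl⟩))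

theorem completionBasis_apply {E : Type*} [NormedAddCommGroup E] [InnerProductSpace ℂ E]
    {ι : Type*} {v : ι → E} (hv : Orthonormal ℂ v)
    (hd : ∀ w : UniformSpace.Completion E,
      (∀ i, ⟪w, (v i : UniformSpace.Completion E)⟫_ℂ = 0) → w = 0) (i : ι) :
    completionBasis hv hd i = (v i : UniformSpace.Completion E) := by
  rw [completionBasis, HilbertBasis.coe_mkOfOrthogonalEqBot]

variable {H : Type u} [NormedAddCommGroup H] [InnerProductSpace ℂ H]
variable {K : Type v} [NormedAddCommGroup K] [InnerProductSpace ℂ K]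

theorem orthonormal_tmul {ι κ : Type*} {e : ι → H} {f : κ → K} (he : Orthonormal ℂ e)
    (hf : Orthonormal ℂ f) : Orthonormal ℂ fun q : ι × κ => e q.1 ⊗ₜ[ℂ] f q.2 := by
  classical
  rw [orthonormal_iff_ite]
  rintro ⟨i, k⟩ ⟨j, l⟩
  rw [TensorProduct.inner_tmul, orthonormal_iff_ite.mp he, orthonormal_iff_ite.mp hf]
  simp only [Prod.mk.injEq]
  by_cases h1 : i = j <;> by_cases h2 : k = l <;> simp [h1, h2]

/-- The orthonormal basis of products in the Hilbert space tensor product. -/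
noncomputable def tensorBasis {ι κ : Type*} (e : HilbertBasis ι ℂ H) (f : HilbertBasis κ ℂ K) :
    HilbertBasis (ι × κ) ℂ (HilbertTensor H K) :=
  completionBasis (orthonormal_tmul e.orthonormal f.orthonormal) fun w hw => by
    refine eq_zero_of_inner_coe fun t => ?_
    let Φ : H ⊗[ℂ] K →L[ℂ] ℂ := (innerSL ℂ w).comp UniformSpace.Completion.toComplL
    change Φ t = 0
    -- A vector orthogonal to all `e i ⊗ f k` is orthogonal to all pure tensors, by separate
    -- continuity in one variable after the other.
    have h1 : ∀ i y, Φ (e i ⊗ₜ y) = 0 := fun i y =>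
      clm_eq_zero_of_hilbertBasis f (Φ.comp (TensorProduct.mkL ℂ H K (e i)))
        (fun k => hw (i, k)) y
    have h2 : ∀ x y, Φ (x ⊗ₜ y) = 0 := fun x y =>
      clm_eq_zero_of_hilbertBasis e (Φ.comp ((TensorProduct.mkL ℂ H K).flip y))
        (fun i => h1 i y) x
    induction t with
    | zero => exact map_zero _
    | tmul x y => exact h2 x y
    | add a b ha hb => rw [map_add, ha, hb, add_zero]

theorem tensorBasis_apply {ι κ : Type*} (e : HilbertBasis ι ℂ H) (f : HilbertBasis κ ℂ K)
    (q : ι × κ) : tensorBasis e f q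
      = ((e q.1 ⊗ₜ[ℂ] f q.2 : H ⊗[ℂ] K) : UniformSpace.Completion (H ⊗[ℂ] K)) :=
  completionBasis_apply _ _ q

theorem opTensor_tmul (A : H →L[ℂ] H) (B : K →L[ℂ] K) (x : H) (y : K) :
    opTensor A B ((x ⊗ₜ[ℂ] y : H ⊗[ℂ] K) : UniformSpace.Completion (H ⊗[ℂ] K))
      = ((A x ⊗ₜ[ℂ] B y : H ⊗[ℂ] K) : UniformSpace.Completion (H ⊗[ℂ] K)) := by
  rw [opTensor, ContinuousLinearMap.completion_apply_coe, TensorProduct.mapL_tmul]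

theorem completion_mul {E : Type*} [NormedAddCommGroup E] [InnerProductSpace ℂ E]
    (A B : E →L[ℂ] E) : (A * B).completion = A.completion * B.completion := by
  ext z
  induction z using UniformSpace.Completion.induction_on with
  | hp => exact isClosed_eq (ContinuousLinearMap.continuous _) (ContinuousLinearMap.continuous _)
  | ih x =>
    rw [mul_apply_eq_comp, ContinuousLinearMap.completion_apply_coe,
      ContinuousLinearMap.completion_apply_coe, ContinuousLinearMap.completion_apply_coe]
    rfl

theorem completion_pow {E : Type*} [NormedAddCommGroup E] [InnerProductSpace ℂ E]
    (A : E →L[ℂ] E) (k : ℕ) : (A ^ (k + 1)).completion = A.completion ^ (k + 1) := by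
  induction k with
  | zero => simp
  | succ k ih => rw [pow_succ, completion_mul, ih, ← pow_succ]

theorem opTensor_pow (A : H →L[ℂ] H) (B : K →L[ℂ] K) {k : ℕ} (hk : 1 ≤ k) :
    opTensor A B ^ k = opTensor (A ^ k) (B ^ k) := by
  obtain ⟨l, rfl⟩ : ∃ l, k = l + 1 := ⟨k - 1, by omega⟩
  rw [opTensor, opTensor, ← completion_pow]
  congr 1
  ext t
  have h : ∀ m : ℕ, ∀ x y, (TensorProduct.mapL A B ^ m) (x ⊗ₜ[ℂ] y) = (A ^ m) x ⊗ₜ (B ^ m) y := by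
    intro m
    induction m with
    | zero => intro x y; rfl
    | succ m ih =>
      intro x y
      rw [pow_succ, pow_succ, pow_succ, mul_apply_eq_comp, TensorProduct.mapL_tmul, ih]
      rfl
  induction t with
  | zero => simp
  | tmul x y => rw [h, TensorProduct.mapL_tmul]
  | add a b ha hb => rw [map_add, map_add, ha, hb]

theorem IsSingularBasis.opTensor {A : H →L[ℂ] H} {B : K →L[ℂ] K} {ι κ : Type*}
    {e : HilbertBasis ι ℂ H} {f : HilbertBasis κ ℂ K} (he : IsSingularBasis A e)
    (hf : IsSingularBasis B f) : IsSingularBasis (DynZeta.opTensor A B) (tensorBasis e f) := by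
  rintro ⟨i, k⟩ ⟨j, l⟩ hne
  rw [tensorBasis_apply, tensorBasis_apply, opTensor_tmul, opTensor_tmul,
    UniformSpace.Completion.inner_coe, TensorProduct.inner_tmul]
  by_cases h : i = j
  · rw [hf k l fun h' => hne (by simp [h, h']), mul_zero]
  · rw [he i j h, zero_mul]

theorem hasSum_mul_of_summable_norm {ι κ : Type*} {f : ι → ℂ} {g : κ → ℂ} {a b : ℂ}
    (hf : HasSum f a) (hg : HasSum g b) (hf' : Summable fun i => ‖f i‖)
    (hg' : Summable fun k => ‖g k‖) : HasSum (fun q : ι × κ => f q.1 * g q.2) (a * b) :=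
  hf.mul hg (summable_mul_of_summable_norm hf' hg')

theorem inner_tensorBasis_opTensor (A : H →L[ℂ] H) (B : K →L[ℂ] K) {ι κ : Type*}
    (e : HilbertBasis ι ℂ H) (f : HilbertBasis κ ℂ K) (q : ι × κ) :
    ⟪tensorBasis e f q, opTensor A B (tensorBasis e f q)⟫_ℂ
      = ⟪e q.1, A (e q.1)⟫_ℂ * ⟪f q.2, B (f q.2)⟫_ℂ := by
  rw [tensorBasis_apply, opTensor_tmul, UniformSpace.Completion.inner_coe,
    TensorProduct.inner_tmul]

variable [CompleteSpace H] [CompleteSpace K]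

/-- The singular numbers of `A ⊗ B` are the products of those of `A` and `B`. A finite set of index
pairs is enclosed in a rectangle, where the sum factors. -/
theorem opTensor_bound {p : ℝ} (hp : 1 ≤ p) {A : H →L[ℂ] H} {B : K →L[ℂ] K}
    (hA : IsCompactOperator A) (hB : IsCompactOperator B) {M N : ℝ} (h : SBound p A M)
    (h' : SBound p B N) :
    IsCompactOperator (opTensor A B) ∧ SBound p (opTensor A B) (M * N) := by
  classical
  obtain ⟨ι, e, he⟩ := exists_isSingularBasis hA
  obtain ⟨κ, f, hf⟩ := exists_isSingularBasis hB
  have hb : SBound p (opTensor A B) (M * N) := by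
    refine (he.opTensor hf).sBound hp (mul_nonneg h.1 h'.1) fun s => ?_
    have hn : ∀ q : ι × κ, ‖opTensor A B (tensorBasis e f q)‖ ^ p
        = ‖A (e q.1)‖ ^ p * ‖B (f q.2)‖ ^ p := by
      intro q
      rw [tensorBasis_apply, opTensor_tmul, UniformSpace.Completion.norm_coe,
        TensorProduct.norm_tmul, Real.mul_rpow (norm_nonneg _) (norm_nonneg _)]
    calc _ ≤ ∑ q ∈ s.image Prod.fst ×ˢ s.image Prod.snd, ‖A (e q.1)‖ ^ p * ‖B (f q.2)‖ ^ p := by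
          simp_rw [hn]
          exact Finset.sum_le_sum_of_subset_of_nonneg Finset.subset_product
            fun _ _ _ => by positivity
      _ = (∑ i ∈ s.image Prod.fst, ‖A (e i)‖ ^ p) * ∑ k ∈ s.image Prod.snd, ‖B (f k)‖ ^ p := by
          rw [Finset.sum_mul_sum, Finset.sum_product]
      _ ≤ M ^ p * N ^ p := by
          refine mul_le_mul ((he.sBound_iff hp h.1).mp h _) ((hf.sBound_iff hp h'.1).mp h' _)
            (by positivity) (Real.rpow_nonneg h.1 _)
      _ = (M * N) ^ p := (Real.mul_rpow h.1 h'.1).symm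
  exact ⟨(he.opTensor hf).isCompactOperator hp hb, hb⟩

theorem trace_opTensor {A : H →L[ℂ] H} {B : K →L[ℂ] K} (hA : IsCompactOperator A)
    (hB : IsCompactOperator B) {M N : ℝ} (h : SBound 1 A M) (h' : SBound 1 B N) :
    trace (opTensor A B) = trace A * trace B := by
  obtain ⟨ι, e, -⟩ := exists_isSingularBasis hA
  obtain ⟨κ, f, -⟩ := exists_isSingularBasis hB
  have hAB := opTensor_bound le_rfl hA hB h h'
  have hT := hasSum_trace hAB.1 hAB.2 (tensorBasis e f)
  have h1 := hasSum_trace hA h e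
  have h2 := hasSum_trace hB h' f
  have h3 := h.summable_norm_diag e
  have h4 := h'.summable_norm_diag f
  have h5 := hasSum_mul_of_summable_norm h1 h2 h3 h4
  rw [funext fun q => inner_tensorBasis_opTensor A B e f q] at hT
  exact hT.unique h5

end TensorBases

/-! ### Singular bases, norms and minors of exterior powers -/

section ExteriorBases

variable {H : Type u} [NormedAddCommGroup H] [InnerProductSpace ℂ H] {n : ℕ}

/-- The crude Leibniz estimate of the Gram determinant; only continuity of the wedge product is
wanted. -/
theorem norm_ιMulti_le (x : Fin n → H) :
    ‖exteriorPower.ιMulti ℂ n x‖ ≤ √(n.factorial) * ∏ i, ‖x i‖ := by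
  refine le_of_sq_le_sq ?_ (by positivity)
  rw [mul_pow, Real.sq_sqrt (by positivity), ← inner_self_eq_norm_sq (𝕜 := ℂ), inner_ιMulti,
    Matrix.det_apply]
  refine (RCLike.re_le_norm _).trans ((norm_sum_le _ _).trans ?_)
  have hc : (n.factorial : ℝ) = (Finset.univ : Finset (Equiv.Perm (Fin n))).card := by
    rw [Finset.card_univ, Fintype.card_perm, Fintype.card_fin]
  rw [hc, ← nsmul_eq_mul]
  refine Finset.sum_le_card_nsmul _ _ _ fun σ _ => ?_
  have hs : ‖((Equiv.Perm.sign σ : ℤˣ) : ℤ) • (∏ i, (Matrix.of fun i j => ⟪x i, x j⟫_ℂ) (σ i) i)‖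
      = ‖∏ i, (Matrix.of fun i j => ⟪x i, x j⟫_ℂ) (σ i) i‖ := by
    rcases Int.units_eq_one_or (Equiv.Perm.sign σ) with h | h <;> simp [h]
  refine hs.le.trans ?_
  rw [norm_prod]
  calc _ ≤ ∏ i, ‖x (σ i)‖ * ‖x i‖ :=
        Finset.prod_le_prod (fun _ _ => norm_nonneg _) fun i _ => norm_inner_le_norm _ _
    _ = (∏ i, ‖x i‖) ^ 2 := by
        rw [Finset.prod_mul_distrib, Equiv.prod_comp σ fun i => ‖x i‖, sq]

theorem continuous_ιMulti :
    Continuous (fun x : Fin n → H => exteriorPower.ιMulti ℂ n x) :=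
  ((exteriorPower.ιMulti ℂ n (M := H)).toMultilinearMap.mkContinuous _ norm_ιMulti_le).cont

variable {ι : Type*} [LinearOrder ι]

theorem orthonormal_ιMulti_family {e : ι → H} (he : Orthonormal ℂ e) :
    Orthonormal ℂ (exteriorPower.ιMulti_family ℂ n e) := by
  classical
  rw [orthonormal_iff_ite]
  intro s t
  have h := extInner_family e (fun _ => 1) (n := n) (fun k l => by
    rw [orthonormal_iff_ite.mp he]; simp) s t
  simp only [Finset.prod_const_one, Complex.ofReal_one] at h
  exact h

/-- The orthonormal basis of wedge products in the Hilbert space exterior power. -/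
noncomputable def exteriorBasis (n : ℕ) (e : HilbertBasis ι ℂ H) :
    HilbertBasis (Set.powersetCard ι n) ℂ (HilbertExterior H n) :=
  completionBasis (orthonormal_ιMulti_family e.orthonormal) fun w hw => by
    refine eq_zero_of_inner_coe fun t => ?_
    let Φ : ⋀[ℂ]^n H →L[ℂ] ℂ := (innerSL ℂ w).comp UniformSpace.Completion.toComplL
    change Φ t = 0
    let W := Submodule.span ℂ (Set.range e)
    have hW : Dense (W : Set H) := by
      rw [Submodule.dense_iff_topologicalClosure_eq_top]
      exact e.dense_span
    -- Wedges of vectors from the algebraic span of `e` are combinations of basis wedges; density of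
    -- this span and joint continuity extend the vanishing to all wedges.
    have h1 : ∀ x : Fin n → W, Φ (exteriorPower.ιMulti ℂ n fun i => (x i : H)) = 0 := by
      intro x
      have h2 : exteriorPower.map n W.subtype (exteriorPower.ιMulti ℂ n x)
          ∈ Submodule.span ℂ (Set.range (exteriorPower.ιMulti_family ℂ n e)) := by
        rw [← exteriorPower.ιMulti_family_span]
        exact ⟨_, rfl⟩
      rw [exteriorPower.map_apply_ιMulti] at h2
      have h3 : Submodule.span ℂ (Set.range (exteriorPower.ιMulti_family ℂ n e))
          ≤ LinearMap.ker (Φ : ⋀[ℂ]^n H →ₗ[ℂ] ℂ) := by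
        rw [Submodule.span_le]
        rintro _ ⟨s, rfl⟩
        exact hw s
      exact h3 h2
    have h4 : (fun x : Fin n → H => Φ (exteriorPower.ιMulti ℂ n x)) = fun _ => 0 := by
      refine Continuous.ext_on (dense_pi Set.univ fun i _ => hW)
        (Φ.continuous.comp continuous_ιMulti) continuous_const fun x hx => ?_
      exact h1 fun i => ⟨x i, hx i trivial⟩
    induction t using ext_induction with
    | hι x => exact congrFun h4 x
    | h0 => exact map_zero _
    | hadd a b ha hb => rw [map_add, ha, hb, add_zero]
    | hsmul c a ha => rw [map_smul, ha, smul_zero]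

theorem exteriorBasis_apply (n : ℕ) (e : HilbertBasis ι ℂ H) (s : Set.powersetCard ι n) :
    exteriorBasis n e s = ((exteriorPower.ιMulti_family ℂ n e s : ⋀[ℂ]^n H) :
      UniformSpace.Completion (⋀[ℂ]^n H)) :=
  completionBasis_apply _ _ s

variable [CompleteSpace H]

theorem opExterior_pow (ν : ℕ) (A : H →L[ℂ] H) {k : ℕ} (hk : 1 ≤ k) :
    opExterior ν A ^ k = opExterior ν (A ^ k) := by
  obtain ⟨l, rfl⟩ : ∃ l, k = l + 1 := ⟨k - 1, by omega⟩
  rw [opExterior, opExterior, ← completion_pow]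
  congr 1
  have h : ∀ m : ℕ, ∀ t, (extMapL ν A ^ (m + 1)) t = extMapL ν (A ^ (m + 1)) t := by
    intro m
    induction m with
    | zero => intro t; simp
    | succ m ih =>
      intro t
      rw [pow_succ, mul_apply_eq_comp, ih]
      change exteriorPower.map ν _ (exteriorPower.map ν _ t) = exteriorPower.map ν _ t
      rw [← LinearMap.comp_apply, ← exteriorPower.map_comp]
      rfl
  exact ContinuousLinearMap.ext (h l)

theorem opExterior_exteriorBasis (ν : ℕ) (A : H →L[ℂ] H) (e : HilbertBasis ι ℂ H)
    (s : Set.powersetCard ι ν) :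
    opExterior ν A (exteriorBasis ν e s)
      = ((exteriorPower.ιMulti_family ℂ ν (A ∘ e) s : ⋀[ℂ]^ν H) :
        UniformSpace.Completion (⋀[ℂ]^ν H)) := by
  rw [exteriorBasis_apply, opExterior, ContinuousLinearMap.completion_apply_coe]
  congr 1
  exact exteriorPower.map_apply_ιMulti_family _ _ _

theorem prod_ofFinEmbEquiv_symm {M : Type*} [CommMonoid M] (g : ι → M)
    (s : Set.powersetCard ι n) :
    ∏ i, g (Set.powersetCard.ofFinEmbEquiv.symm s i) = ∏ k ∈ (s : Finset ι), g k := by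
  rw [← Finset.prod_coe_sort (s : Finset ι), ← (s.val.orderIsoOfFin s.prop).toEquiv.prod_comp]
  rfl

theorem inner_opExterior_exteriorBasis {A : H →L[ℂ] H} {e : HilbertBasis ι ℂ H}
    (he : IsSingularBasis A e) (ν : ℕ) (s t : Set.powersetCard ι ν) :
    ⟪opExterior ν A (exteriorBasis ν e s), opExterior ν A (exteriorBasis ν e t)⟫_ℂ
      = if s = t then ((∏ k ∈ (s : Finset ι), ‖A (e k)‖ ^ 2 : ℝ) : ℂ) else 0 := by
  rw [opExterior_exteriorBasis, opExterior_exteriorBasis, UniformSpace.Completion.inner_coe]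
  have h := extInner_family (A ∘ e) (fun k => ‖A (e k)‖ ^ 2) (n := ν) (fun k l => by
    split_ifs with h
    · subst h
      simp [inner_self_eq_norm_sq_to_K]
    · exact he k l h) s t
  rw [prod_ofFinEmbEquiv_symm (fun k => ‖A (e k)‖ ^ 2)] at h
  convert h

theorem IsSingularBasis.opExterior {A : H →L[ℂ] H} {e : HilbertBasis ι ℂ H}
    (he : IsSingularBasis A e) (ν : ℕ) :
    IsSingularBasis (DynZeta.opExterior ν A) (exteriorBasis ν e) := fun s t hst => by
  rw [inner_opExterior_exteriorBasis he, if_neg hst]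

theorem norm_opExterior_exteriorBasis {A : H →L[ℂ] H} {e : HilbertBasis ι ℂ H}
    (he : IsSingularBasis A e) (ν : ℕ) (s : Set.powersetCard ι ν) :
    ‖opExterior ν A (exteriorBasis ν e s)‖ = ∏ k ∈ (s : Finset ι), ‖A (e k)‖ := by
  have h := inner_opExterior_exteriorBasis he ν s s
  rw [if_pos rfl, inner_self_eq_norm_sq_to_K, Finset.prod_pow] at h
  have h2 : ‖opExterior ν A (exteriorBasis ν e s)‖ ^ 2
      = (∏ k ∈ (s : Finset ι), ‖A (e k)‖) ^ 2 :=
    Complex.ofReal_injective (by rw [Complex.ofReal_pow]; exact h)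
  exact (pow_left_inj₀ (norm_nonneg _) (Finset.prod_nonneg fun _ _ => norm_nonneg _)
    two_ne_zero).mp h2

/-- Here `b ν` is the `ν`-th elementary symmetric function of the numbers `s_k ^ p`, with `s_k` the
singular numbers. Sorting finite index sets by cardinality gives `∑ b ν = ∏ (1 + s_k ^ p) < ∞`; this
summability is the source of all convergence in `ν`. -/
theorem exists_opExterior_bounds {p : ℝ} (hp : 1 ≤ p) {A : H →L[ℂ] H}
    (hA : IsCompactOperator A) {M : ℝ} (h : SBound p A M) :
    ∃ b : ℕ → ℝ, (∀ ν, 0 ≤ b ν) ∧ Summable b ∧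
      ∀ ν, IsCompactOperator (opExterior ν A) ∧ SBound p (opExterior ν A) (b ν ^ p⁻¹) := by
  classical
  have hp0 : 0 < p := by linarith
  obtain ⟨κ, e, he⟩ := exists_isSingularBasis hA
  let _ : LinearOrder κ := linearOrderOfSTO WellOrderingRel
  let g : Finset κ → ℝ := fun s => ∏ k ∈ s, ‖A (e k)‖ ^ p
  have hg0 : ∀ s, 0 ≤ g s := fun s => Finset.prod_nonneg fun k _ => by positivity
  have hg : Summable g := summable_finsetProd_of_summable_nonneg (fun k => by positivity)
    (summable_of_sum_le (fun k => by positivity) ((he.sBound_iff hp h.1).mp h))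
  let σ : (Σ ν, Set.powersetCard κ ν) ≃ Finset κ := Equiv.sigmaFiberEquiv Finset.card
  have hσ : Summable fun q : Σ ν, Set.powersetCard κ ν => g q.2 := σ.summable_iff.mpr hg
  refine ⟨fun ν => ∑' s : Set.powersetCard κ ν, g s, fun ν => tsum_nonneg fun s => hg0 s,
    hσ.sigma, fun ν => ?_⟩
  have hb0 : 0 ≤ ∑' s : Set.powersetCard κ ν, g s := tsum_nonneg fun s => hg0 s
  have hb : SBound p (opExterior ν A) ((∑' s : Set.powersetCard κ ν, g s) ^ p⁻¹) := by
    refine (he.opExterior ν).sBound hp (by positivity) fun t => ?_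
    rw [Real.rpow_inv_rpow hb0 hp0.ne']
    refine le_trans (Finset.sum_le_sum fun s _ => ?_)
      ((hσ.sigma_factor ν).sum_le_tsum t fun s _ => hg0 s)
    rw [norm_opExterior_exteriorBasis he, ← Real.finsetProd_rpow _ _ fun _ _ => norm_nonneg _]
  exact ⟨(he.opExterior ν).isCompactOperator hp hb, hb⟩

/-- The principal minor of the matrix of `A` belonging to `s`. -/
noncomputable def principalMinor (A : H →L[ℂ] H) {κ : Type*} (e : HilbertBasis κ ℂ H)
    (s : Finset κ) : ℂ := by
  classical
  exact (Matrix.of fun i j : s => ⟪e i, A (e j)⟫_ℂ).det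

theorem inner_exteriorBasis_opExterior (ν : ℕ) (A : H →L[ℂ] H) (e : HilbertBasis ι ℂ H)
    (s : Set.powersetCard ι ν) :
    ⟪exteriorBasis ν e s, opExterior ν A (exteriorBasis ν e s)⟫_ℂ = principalMinor A e s := by
  classical
  rw [opExterior_exteriorBasis, exteriorBasis_apply, UniformSpace.Completion.inner_coe,
    exteriorPower.ιMulti_family, exteriorPower.ιMulti_family, inner_ιMulti]
  have h := Matrix.det_submatrix_equiv_self (s.val.orderIsoOfFin s.prop).toEquiv
    (Matrix.of fun i j : (s : Finset ι) => ⟪e i, A (e j)⟫_ℂ)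
  refine Eq.trans ?_ (h.trans ?_)
  · rfl
  · rw [principalMinor]
    congr!

end ExteriorBases

/-! ### The Fredholm determinant as a series of principal minors -/

/-- The expansion of `det (1 - M)` into principal minors. -/
theorem det_one_sub_eq_sum_minors {n R : Type*} [Fintype n] [DecidableEq n] [CommRing R]
    (M : Matrix n n R) :
    (1 - M).det = ∑ s : Finset n, (-1) ^ s.card *
      (M.submatrix (Subtype.val : s → n) (Subtype.val : s → n)).det := by
  rw [show 1 - M = -M + 1 by abel]
  change Matrix.detRowAlternating (fun i => (-M) i + (1 : Matrix n n R) i) = _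
  refine (Matrix.detRowAlternating.map_add_univ (-M : n → n → R) (1 : Matrix n n R)).trans ?_
  refine Finset.sum_congr rfl fun s _ => ?_
  refine (Matrix.det_piecewise_one_eq_submatrix_det (-M) s).trans ?_
  rw [show (-M).submatrix (Subtype.val : s → n) (Subtype.val : s → n)
    = -(M.submatrix Subtype.val Subtype.val) from rfl, Matrix.det_neg, Fintype.card_coe]

section Fredholm

variable {H : Type u} [NormedAddCommGroup H] [InnerProductSpace ℂ H]

/-- The truncation factors through `ℂ^s`, where the reverse composite has the matrix `⟪e i, A (e
j)⟫`. -/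
theorem finiteRankDet_truncation (A : H →L[ℂ] H) {ι : Type*} (e : HilbertBasis ι ℂ H)
    (s : Finset ι) :
    finiteRankDet (truncation A e s) = ∑ T ∈ s.powerset, (-1) ^ T.card * principalMinor A e T := by
  classical
  let f : (s → ℂ) →ₗ[ℂ] H := Fintype.linearCombination ℂ fun i : s => A (e i)
  let g : H →ₗ[ℂ] (s → ℂ) := LinearMap.pi fun i : s => innerₛₗ ℂ (e i)
  rw [finiteRankDet_of_comp (truncation A e s) f g fun x => ?_]
  · have hm : LinearMap.toMatrix' (LinearMap.id - g ∘ₗ f)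
        = 1 - Matrix.of fun i j : s => ⟪e i, A (e j)⟫_ℂ := by
      ext i j
      simp [f, g, LinearMap.toMatrix'_apply, Matrix.one_apply, Pi.single_apply]
    rw [← LinearMap.det_toMatrix', hm, det_one_sub_eq_sum_minors]
    have hp : s.powerset = Finset.univ.map
        (Finset.mapEmbedding (Function.Embedding.subtype (· ∈ s))).toEmbedding := by
      ext T
      simp only [Finset.mem_powerset, Finset.mem_map, Finset.mem_univ, true_and]
      constructor
      · intro hT
        refine ⟨T.subtype (· ∈ s), ?_⟩
        simp only [RelEmbedding.coe_toEmbedding, Finset.mapEmbedding_apply]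
        exact Finset.subtype_map_of_mem hT
      · rintro ⟨T', rfl⟩ x hx
        simp only [RelEmbedding.coe_toEmbedding, Finset.mapEmbedding_apply, Finset.mem_map] at hx
        obtain ⟨y, -, rfl⟩ := hx
        exact y.2
    rw [hp, Finset.sum_map]
    refine Finset.sum_congr rfl fun T _ => ?_
    simp only [RelEmbedding.coe_toEmbedding, Finset.mapEmbedding_apply, Finset.card_map]
    congr 1
    have h := Matrix.det_submatrix_equiv_self
      (Equiv.ofBijective (fun i : T => (⟨i, Finset.mem_map_of_mem _ i.2⟩ :
        T.map (Function.Embedding.subtype (· ∈ s)))) ⟨fun i j hij => ?_, fun j => ?_⟩)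
      (Matrix.of fun i j : T.map (Function.Embedding.subtype (· ∈ s)) => ⟪e i, A (e j)⟫_ℂ)
    rw [principalMinor]
    refine Eq.trans ?_ (h.trans ?_)
    · rfl
    · congr!
    · have h2 := congrArg Subtype.val hij
      exact Subtype.ext (Subtype.ext h2)
    · obtain ⟨y, hy, hyj⟩ := Finset.mem_map.mp j.2
      exact ⟨⟨y, hy⟩, Subtype.ext hyj⟩
  · rw [truncation_apply, ← Finset.sum_coe_sort]
    simp [f, g, Fintype.linearCombination_apply]

variable [CompleteSpace H]

/-- The minors of size `ν` are the diagonal coefficients of `∧^ν X` in the basis of wedges, so their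
absolute values sum to at most `b ν`, which is summable. -/
theorem summable_principalMinor {X : H →L[ℂ] H} (hX : IsCompactOperator X) {M : ℝ}
    (h : SBound 1 X M) {ι : Type*} (e : HilbertBasis ι ℂ H) :
    Summable fun T : Finset ι => ‖principalMinor X e T‖ := by
  classical
  let _ : LinearOrder ι := linearOrderOfSTO WellOrderingRel
  obtain ⟨b, hb0, hb, hbb⟩ := exists_opExterior_bounds le_rfl hX h
  let σ : (Σ ν, Set.powersetCard ι ν) ≃ Finset ι := Equiv.sigmaFiberEquiv Finset.card
  refine σ.summable_iff.mp ((summable_sigma_of_nonneg fun q => norm_nonneg _).mpr ⟨?_, ?_⟩)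
  all_goals
    have hs : ∀ ν, Summable fun T : Set.powersetCard ι ν => ‖principalMinor X e T‖ := fun ν => by
      simpa only [inner_exteriorBasis_opExterior] using
        (hbb ν).2.summable_norm_diag (exteriorBasis ν e)
  · exact hs
  · refine hb.of_nonneg_of_le (fun ν => tsum_nonneg fun _ => norm_nonneg _) fun ν => ?_
    refine (hs ν).tsum_le_of_sum_le fun t => ?_
    have := (hbb ν).2.sum_norm_diag_le (exteriorBasis ν e) t
    simpa only [inner_exteriorBasis_opExterior, inv_one, Real.rpow_one] using this

theorem hasSum_principalMinor {X : H →L[ℂ] H} (hX : IsCompactOperator X) {M : ℝ}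
    (h : SBound 1 X M) {ι : Type*} {e : HilbertBasis ι ℂ H} (he : IsSingularBasis X e) :
    HasSum (fun T : Finset ι => (-1) ^ T.card * principalMinor X e T) (fredholmDet X) := by
  have hs : Summable fun T : Finset ι => (-1) ^ T.card * principalMinor X e T :=
    .of_norm (by simpa using summable_principalMinor hX h e)
  have h' : SBound (1 : ℕ) X M := by simpa using h
  have h1 := (tendsto_regDet le_rfl hX h').comp (he.tendsto_finiteRankNhds le_rfl hX h')
  -- Powersets are cofinal among finite sets of finite sets, so the determinants of the truncations
  -- are partial sums along a cofinal family and tend to the sum of the series.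
  have h2 : Tendsto (Finset.powerset : Finset ι → Finset (Finset ι)) atTop atTop :=
    tendsto_atTop_finset_of_monotone (fun _ _ => Finset.powerset_mono.mpr)
      fun T => ⟨T, Finset.mem_powerset_self T⟩
  have h3 := hs.hasSum.comp h2
  have h4 : finiteRankRegDet 1 ∘ truncation X e
      = (fun S => ∑ T ∈ S, (-1) ^ T.card * principalMinor X e T) ∘ Finset.powerset := by
    funext s
    simp [finiteRankRegDet, finiteRankDet_truncation]
  rw [h4] at h1
  rw [fredholmDet, tendsto_nhds_unique h1 h3]
  exact hs.hasSum

/-- The Fredholm determinant of `1 - X` is the alternating sum of the traces of the exterior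
powers of `X`. -/
theorem hasSum_trace_opExterior {X : H →L[ℂ] H} (hX : IsCompactOperator X) {M : ℝ}
    (h : SBound 1 X M) :
    HasSum (fun ν : ℕ => (-1) ^ ν * trace (opExterior ν X)) (fredholmDet X) := by
  obtain ⟨ι, e, he⟩ := exists_isSingularBasis hX
  classical
  let _ : LinearOrder ι := linearOrderOfSTO WellOrderingRel
  obtain ⟨b, -, -, hbb⟩ := exists_opExterior_bounds le_rfl hX h
  let σ : (Σ ν, Set.powersetCard ι ν) ≃ Finset ι := Equiv.sigmaFiberEquiv Finset.card
  refine (σ.hasSum_iff.mpr (hasSum_principalMinor hX h he)).sigma fun ν => ?_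
  have h1 := (hasSum_trace (hbb ν).1 (hbb ν).2 (exteriorBasis ν e)).mul_left ((-1) ^ ν)
  rw [funext fun s => congrArg _ (inner_exteriorBasis_opExterior ν X e s)] at h1
  refine h1.congr_fun fun s => ?_
  change (-1) ^ (s : Finset ι).card * principalMinor X e s = _
  rw [s.prop]

end Fredholm

/-! ### Infinite products of entire functions -/

section Products

variable {ι : Type*}

/-- On every disc, the terms of the series `∑ |D i - 1|` are eventually bounded by those of a
convergent series. -/
def NormallyConvergent (D : ι → ℂ → ℂ) : Prop :=
  ∀ R : ℝ, ∃ w : ι → ℝ, Summable w ∧ ∀ᶠ i in cofinite, ∀ z : ℂ, ‖z‖ ≤ R → ‖D i z - 1‖ ≤ w i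

namespace NormallyConvergent

variable {D : ι → ℂ → ℂ}

theorem summableLocallyUniformlyOn (h : NormallyConvergent D) :
    SummableLocallyUniformlyOn (fun i z => ‖D i z - 1‖) Set.univ := by
  refine SummableLocallyUniformlyOn.of_locally_bounded_eventually isOpen_univ fun K _ hK => ?_
  obtain ⟨R, hR⟩ := hK.isBounded.exists_norm_le
  obtain ⟨w, hw, h'⟩ := h R
  refine ⟨w, hw, ?_⟩
  filter_upwards [h'] with i hi z hz
  simpa using hi z (hR z hz)

theorem summable_norm (h : NormallyConvergent D) (z : ℂ) : Summable fun i => ‖D i z - 1‖ := by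
  obtain ⟨w, hw, h'⟩ := h ‖z‖
  refine hw.of_norm_bounded_eventually ?_
  filter_upwards [h'] with i hi
  simpa using hi z le_rfl

theorem multipliable (h : NormallyConvergent D) (z : ℂ) : Multipliable fun i => D i z := by
  simpa using multipliable_one_add_of_summable (h.summable_norm z)

theorem tprod_ne_zero (h : NormallyConvergent D) {z : ℂ} (hz : ∀ i, D i z ≠ 0) :
    ∏' i, D i z ≠ 0 := by
  simpa using tprod_one_add_ne_zero_of_summable (f := fun i => D i z - 1) (by simpa using hz)
    (h.summable_norm z)

theorem differentiable_tprod (h : NormallyConvergent D) (hD : ∀ i, Differentiable ℂ (D i)) :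
    Differentiable ℂ fun z => ∏' i, D i z := by
  intro z
  obtain ⟨w, hw, h'⟩ := h (‖z‖ + 1)
  have h1 := hw.hasProdLocallyUniformlyOn_one_add (f := fun i z => D i z - 1)
    (Metric.isOpen_ball (x := (0 : ℂ)) (ε := ‖z‖ + 1))
    (by
      filter_upwards [h'] with i hi y hy
      exact hi y (by simpa using (mem_ball_zero_iff.mp hy).le))
    fun i => ((hD i).continuous.sub continuous_const).continuousOn
  simp only [add_sub_cancel] at h1
  have h2 := (hasProdLocallyUniformlyOn_iff_tendstoLocallyUniformlyOn.mp h1).differentiableOn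
    (Eventually.of_forall fun s => DifferentiableOn.fun_finsetProd
      fun i _ => (hD i).differentiableOn) Metric.isOpen_ball
  exact h2.differentiableAt (Metric.isOpen_ball.mem_nhds (by simp))

/-- Allows the even and the odd factors to be separated without changing the index set. -/
theorem restrict (h : NormallyConvergent D) (p : ι → Prop) [DecidablePred p] :
    NormallyConvergent fun i z => if p i then D i z else 1 := by
  intro R
  obtain ⟨w, hw, h'⟩ := h R
  refine ⟨w, hw, ?_⟩
  filter_upwards [h'] with i hi z hz
  split_ifs
  · exact hi z hz
  · simpa using (norm_nonneg _).trans (hi z hz)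

end NormallyConvergent

theorem differentiable_restrict {D : ι → ℂ → ℂ} (hD : ∀ i, Differentiable ℂ (D i)) (p : ι → Prop)
    [DecidablePred p] (i : ι) : Differentiable ℂ fun z => if p i then D i z else 1 := by
  split_ifs
  · exact hD i
  · exact differentiable_const 1

/-- The product of all factors is entire and nonzero at the origin, so its zeros are isolated; a
zero of any factor is a zero of the product. -/
theorem NormallyConvergent.eventually_ne_zero {D : ι → ℂ → ℂ} (h : NormallyConvergent D)
    (hD : ∀ i, Differentiable ℂ (D i)) (h0 : ∀ i, D i 0 ≠ 0) :
    ∀ᶠ z in codiscrete ℂ, ∀ i, D i z ≠ 0 := by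
  have h1 : AnalyticOnNhd ℂ (fun z => ∏' i, D i z) Set.univ := fun z _ =>
    (h.differentiable_tprod hD).analyticAt z
  filter_upwards [h1.preimage_zero_mem_codiscrete (x := 0) (h.tprod_ne_zero h0)] with z hz i hi
  exact hz (tprod_of_exists_eq_zero ⟨i, hi⟩)

/-- The alternating product of a normally convergent family of entire functions is
meromorphic. -/
theorem NormallyConvergent.exists_meromorphic {D : ι → ℂ → ℂ} (h : NormallyConvergent D)
    (hD : ∀ i, Differentiable ℂ (D i)) (g : ι → ℕ) :
    ∃ F : ℂ → ℂ, Meromorphic F ∧ ∀ z, (∀ i, Even (g i) → D i z ≠ 0) →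
      HasProd (fun i => D i z ^ ((-1 : ℤ) ^ (g i + 1))) (F z) := by
  -- Odd indices carry the exponent `+1` and even ones `-1`, so the function is a quotient of two
  -- entire products.
  refine ⟨fun z => (∏' i, if ¬ Even (g i) then D i z else 1) *
    (∏' i, if Even (g i) then D i z else 1)⁻¹, fun z => ?_, fun z hz => ?_⟩
  · have h1 := ((h.restrict fun i => ¬ Even (g i)).differentiable_tprod
      (differentiable_restrict hD _)).analyticAt z
    have h2 := ((h.restrict fun i => Even (g i)).differentiable_tprod
      (differentiable_restrict hD _)).analyticAt z
    exact h1.meromorphicAt.fun_mul h2.meromorphicAt.fun_inv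
  · have h1 := ((h.restrict fun i => ¬ Even (g i)).multipliable z).hasProd
    have h2 := ((h.restrict fun i => Even (g i)).multipliable z).hasProd.inv₀
      ((h.restrict fun i => Even (g i)).tprod_ne_zero fun i => by
        split_ifs with hi
        · exact hz i hi
        · exact one_ne_zero)
    refine (h1.mul h2).congr_fun fun i => ?_
    by_cases hi : Even (g i)
    · simp [hi, hi.add_one.neg_one_pow]
    · simp [hi, (Nat.not_even_iff_odd.mp hi).add_one.neg_one_pow]

end Products

/-! ### Regularized determinants close to one -/

section Factors

variable {H : Type u} [NormedAddCommGroup H] [InnerProductSpace ℂ H] [CompleteSpace H]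

theorem trace_smul_pow (z : ℂ) (A : H →L[ℂ] H) (k : ℕ) :
    trace ((z • A) ^ k) = z ^ k * trace (A ^ k) := by
  rw [smul_pow, trace_smul]

theorem regDet_zero {n : ℕ} (hn : 1 ≤ n) : regDet n (0 : H →L[ℂ] H) = 1 := by
  have hc : IsCompactOperator (0 : H →L[ℂ] H) := isCompactOperator_zero
  rw [regDet_eq_exp hn hc (SBound.zero (by exact_mod_cast hn)) one_pos, tailSum]
  have h : ∀ k : ℕ, (0 : H →L[ℂ] H) ^ (k + n) = 0 := fun k => zero_pow (by omega)
  simp [h, trace]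

theorem regDet_smul_eq_exp {n : ℕ} (hn : 1 ≤ n) {A : H →L[ℂ] H} (hA : IsCompactOperator A)
    {M : ℝ} (h : SBound n A M) {z : ℂ} (hz : ‖z‖ * M ≤ 1 / 2) :
    regDet n (z • A) = Complex.exp (-tailSum n (z • A)) :=
  regDet_eq_exp hn (hA.smul z) (h.smul z) (by linarith)

/-- The exponent is at most `2 * (‖z‖ * M) ^ n ≤ 1`, and `‖exp u - 1‖ ≤ 2 * ‖u‖` for `‖u‖ ≤ 1`. -/
theorem norm_regDet_smul_sub_one_le {n : ℕ} (hn : 1 ≤ n) {A : H →L[ℂ] H}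
    (hA : IsCompactOperator A) {M : ℝ} (h : SBound n A M) {z : ℂ} (hz : ‖z‖ * M ≤ 1 / 2) :
    ‖regDet n (z • A) - 1‖ ≤ 4 * (‖z‖ * M) ^ n := by
  have h0 : 0 ≤ ‖z‖ * M := mul_nonneg (norm_nonneg _) h.1
  have h1 : ‖-tailSum n (z • A)‖ ≤ 2 * (‖z‖ * M) ^ n := by
    rw [norm_neg]
    exact norm_tsum_tail_le hn h0 hz fun k =>
      norm_trace_pow_le hn (by omega) (hA.smul z) (h.smul z)
  have h2 : (‖z‖ * M) ^ n ≤ 1 / 2 :=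
    (pow_le_of_le_one h0 (by linarith) (by omega)).trans hz
  rw [regDet_smul_eq_exp hn hA h hz]
  exact (Complex.norm_exp_sub_one_le (by linarith)).trans (by linarith)

/-- The preceding estimate needs `|R| * M i ≤ 1 / 2`, which holds for all but finitely many `i`
because `M i ^ n` tends to `0`. -/
theorem normallyConvergent_regDet {ι : Type*} {E : ι → Type u} [∀ i, NormedAddCommGroup (E i)]
    [∀ i, InnerProductSpace ℂ (E i)] [∀ i, CompleteSpace (E i)] {n : ℕ} (hn : 1 ≤ n)
    {A : ∀ i, E i →L[ℂ] E i} (hA : ∀ i, IsCompactOperator (A i)) {M : ι → ℝ}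
    (h : ∀ i, SBound n (A i) (M i)) (hM : Summable fun i => M i ^ n) :
    NormallyConvergent fun i z => regDet n (z • A i) := by
  intro R
  refine ⟨fun i => 4 * (|R| ^ n * M i ^ n), (hM.mul_left _).mul_left _, ?_⟩
  have hε : 0 < 1 / (2 * (|R| + 1)) := by positivity
  filter_upwards [hM.tendsto_cofinite_zero.eventually_lt_const (pow_pos hε n)] with i hi z hz
  have h1 : M i < 1 / (2 * (|R| + 1)) := lt_of_pow_lt_pow_left₀ n hε.le hi
  have hzR : ‖z‖ ≤ |R| := hz.trans (le_abs_self R)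
  have h0 := (h i).1
  rw [lt_div_iff₀ (by positivity)] at h1
  have h2 : ‖z‖ * M i ≤ |R| * M i := by gcongr
  refine (norm_regDet_smul_sub_one_le hn (hA i) (h i) (by nlinarith)).trans ?_
  rw [← mul_pow]
  have := norm_nonneg z
  gcongr

end Factors

/-! ### The zeta function near the origin -/

section Zeta

variable {H : Type u} [NormedAddCommGroup H] [InnerProductSpace ℂ H] [CompleteSpace H]
variable {H₀ : Type v} [NormedAddCommGroup H₀] [InnerProductSpace ℂ H₀] [CompleteSpace H₀]

/-- Beyond the dimension an orthonormal basis has no `ν`-element subsets, so the basis of wedges is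
empty. This cuts the sum over `ℕ` down to `DimIndex H₀`. -/
theorem trace_opExterior_eq_zero {ν : ℕ} (hν : ¬ (ν : Cardinal.{v}) ≤ Module.rank ℂ H₀)
    {X : H₀ →L[ℂ] H₀} (hX : IsCompactOperator X) {M : ℝ} (h : SBound 1 X M) :
    trace (opExterior ν X) = 0 := by
  classical
  obtain ⟨κ, e, -⟩ := exists_isSingularBasis hX
  let _ : LinearOrder κ := linearOrderOfSTO WellOrderingRel
  obtain ⟨b, -, -, hb⟩ := exists_opExterior_bounds le_rfl hX h
  have : IsEmpty (Set.powersetCard κ ν) := by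
    refine ⟨fun s => hν ?_⟩
    have h1 : ((s : Finset κ).card : Cardinal.{v}) ≤ Cardinal.mk κ := by
      rw [← Cardinal.mk_coe_finset]
      exact Cardinal.mk_subtype_le _
    rw [s.prop] at h1
    exact h1.trans e.orthonormal.linearIndependent.cardinal_le_rank
  exact (hasSum_trace (hb ν).1 (hb ν).2 (exteriorBasis ν e)).unique hasSum_empty

/-- The product formula for the coefficients, as a sum over the exterior powers. -/
theorem hasSum_trace_opTensor_opExterior {n m : ℕ} (hn : 1 ≤ n) (hm : n ≤ m) {G : H →L[ℂ] H}
    {Λ : H₀ →L[ℂ] H₀} (hG : IsCompactOperator G) (hΛ : IsCompactOperator Λ) {M N : ℝ}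
    (h : SBound n G M) (h' : SBound n Λ N) :
    HasSum (fun ν : DimIndex H₀ => (-1) ^ (ν : ℕ) * trace (opTensor G (opExterior ν Λ) ^ m))
      (fredholmDet (Λ ^ m) * trace (G ^ m)) := by
  have hm1 : 1 ≤ m := hn.trans hm
  have hGm := isCompactOperator_pow hG hm1
  have hΛm := isCompactOperator_pow hΛ hm1
  have hG1 := h.pow hn hm hG
  have hΛ1 := h'.pow hn hm hΛ
  obtain ⟨b, -, -, hb⟩ := exists_opExterior_bounds le_rfl hΛm hΛ1
  have h1 : HasSum (fun ν : ℕ => (-1) ^ ν * trace (opTensor G (opExterior ν Λ) ^ m))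
      (fredholmDet (Λ ^ m) * trace (G ^ m)) := by
    refine ((hasSum_trace_opExterior hΛm hΛ1).mul_right _).congr_fun fun ν => ?_
    rw [opTensor_pow _ _ hm1, opExterior_pow _ _ hm1, trace_opTensor hGm (hb ν).1 hG1 (hb ν).2]
    ring
  refine (hasSum_subtype_iff_of_support_subset fun ν hν => ?_).mpr h1
  by_contra hc
  refine hν ?_
  change (-1) ^ ν * trace (opTensor G (opExterior ν Λ) ^ m) = 0
  rw [opTensor_pow _ _ hm1, opExterior_pow _ _ hm1, trace_opTensor hGm (hb ν).1 hG1 (hb ν).2,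
    trace_opExterior_eq_zero hc hΛm hΛ1, mul_zero, mul_zero]

/-- Interchange of the two summations in the logarithm of the zeta function. -/
theorem hasSum_tailSum {ι : Type*} {E : ι → Type u} [∀ i, NormedAddCommGroup (E i)]
    [∀ i, InnerProductSpace ℂ (E i)] [∀ i, CompleteSpace (E i)] {n : ℕ} (hn : 1 ≤ n)
    {A : ∀ i, E i →L[ℂ] E i} (hA : ∀ i, IsCompactOperator (A i)) {M : ι → ℝ}
    (h : ∀ i, SBound n (A i) (M i)) (hM : Summable fun i => M i ^ n) (σ : ι → ℕ) {Z : ℕ → ℂ}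
    (hZ : ∀ m, n ≤ m → HasSum (fun i => (-1) ^ σ i * trace (A i ^ m)) (Z m)) {z : ℂ}
    (hz : ∀ i, ‖z‖ * M i ≤ 1 / 2) :
    ∃ S, HasSum (fun i => (-1) ^ σ i * tailSum n (z • A i)) S ∧
      HasSum (fun k : ℕ => z ^ (k + n) / ((k + n : ℕ) : ℂ) * Z (k + n)) S := by
  let f : ι × ℕ → ℂ := fun q =>
    (-1) ^ σ q.1 * (trace ((z • A q.1) ^ (q.2 + n)) / ((q.2 + n : ℕ) : ℂ))
  have hf : Summable f := by
    -- From `‖tr ((z A_i) ^ (k + n))‖ ≤ (‖z‖ * M i) ^ (k + n)`: the first `n` factors give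
    -- summability in `i`, the other `k` are at most `1 / 2` each.
    have hg : Summable fun q : ι × ℕ => (‖z‖ ^ n * M q.1 ^ n) * (1 / 2 : ℝ) ^ q.2 :=
      (hM.mul_left (‖z‖ ^ n)).mul_of_nonneg summable_geometric_two
        (fun i => mul_nonneg (by positivity) (pow_nonneg (h i).1 n)) fun k => by positivity
    refine hg.of_norm_bounded fun q => ?_
    have h0 : 0 ≤ ‖z‖ * M q.1 := mul_nonneg (norm_nonneg _) (h q.1).1
    have h1 := norm_trace_pow_le hn (Nat.le_add_left n q.2) ((hA q.1).smul z)
      ((h q.1).smul z)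
    have h2 : (1 : ℝ) ≤ ((q.2 + n : ℕ) : ℝ) := by exact_mod_cast hn.trans (Nat.le_add_left n q.2)
    have h3 : ‖f q‖ = ‖trace ((z • A q.1) ^ (q.2 + n))‖ / ((q.2 + n : ℕ) : ℝ) := by
      simp only [f, norm_mul, norm_pow, norm_neg, norm_one, one_pow, one_mul, norm_div,
        Complex.norm_natCast]
    rw [h3]
    refine (div_le_self (norm_nonneg _) h2).trans (h1.trans ?_)
    rw [pow_add, mul_comm, ← mul_pow]
    gcongr
    exact hz q.1
  refine ⟨∑' q, f q, hf.hasSum.prod_fiberwise fun i => ?_, ?_⟩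
  · rw [tailSum, ← tsum_mul_left]
    exact (hf.prod_factor i).hasSum
  · refine ((Equiv.prodComm ℕ ι).hasSum_iff.mpr hf.hasSum).prod_fiberwise fun k => ?_
    refine ((hZ (k + n) (Nat.le_add_left n k)).mul_left
      (z ^ (k + n) / ((k + n : ℕ) : ℂ))).congr_fun fun i => ?_
    change (-1) ^ σ i * (trace ((z • A i) ^ (k + n)) / ((k + n : ℕ) : ℂ)) = _
    rw [trace_smul_pow]
    ring

theorem hasSum_pnat_of_tail {n : ℕ} (hn : 1 ≤ n) {Z : ℕ → ℂ} {z S : ℂ}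
    (h : HasSum (fun k : ℕ => z ^ (k + n) / ((k + n : ℕ) : ℂ) * Z (k + n)) S) :
    HasSum (fun m : ℕ+ => z ^ (m : ℕ) / (m : ℂ) * Z m)
      (∑ m ∈ Finset.Ico 1 n, z ^ m / (m : ℂ) * Z m + S) := by
  let g : ℕ → ℂ := fun m => z ^ m / (m : ℂ) * Z m
  have h1 : HasSum g (S + ∑ m ∈ Finset.range n, g m) := (hasSum_nat_add_iff n).mp h
  have h2 : ∑ m ∈ Finset.range n, g m = ∑ m ∈ Finset.Ico 1 n, g m := by
    rw [Finset.range_eq_Ico, Finset.sum_eq_sum_Ico_succ_bot (by omega)]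
    simp [g]
  rw [h2, add_comm] at h1
  refine (PNat.coe_injective.hasSum_iff fun m hm => ?_).mpr h1
  have : m = 0 := by
    by_contra hc
    exact hm ⟨⟨m, Nat.pos_of_ne_zero hc⟩, rfl⟩
  simp [g, this]

theorem hasProd_zpow_of_exp {ι : Type*} {t D : ι → ℂ} {σ : ι → ℕ} {S : ℂ}
    (h : HasSum (fun i => (-1) ^ σ i * t i) S) (hD : ∀ i, D i = Complex.exp (-t i)) :
    HasProd (fun i => D i ^ ((-1 : ℤ) ^ (σ i + 1))) (Complex.exp S) := by
  refine h.cexp.congr_fun fun i => ?_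
  rw [hD, Function.comp_apply]
  rcases Nat.even_or_odd (σ i) with hi | hi
  · rw [hi.neg_one_pow, hi.add_one.neg_one_pow, zpow_neg_one, ← Complex.exp_neg]
    simp
  · rw [hi.neg_one_pow, hi.add_one.neg_one_pow, zpow_one]
    simp

variable {n : ℕ} {G : H →L[ℂ] H} {Λ : H₀ →L[ℂ] H₀}

/-- The norms multiply under the tensor product, so `M ν ^ n` is a constant times the summable `b
ν`. -/
theorem exists_factor_bounds (hn : 1 ≤ n) (hG : IsSchatten n G) (hΛ : IsSchatten n Λ) :
    ∃ M : ℕ → ℝ, (Summable fun ν => M ν ^ n) ∧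
      ∀ ν, IsCompactOperator (opTensor G (opExterior ν Λ)) ∧
        SBound n (opTensor G (opExterior ν Λ)) (M ν) := by
  have hn1 : (1 : ℝ) ≤ n := by exact_mod_cast hn
  obtain ⟨hGc, M, hM⟩ := (isSchatten_iff hn1).mp hG
  obtain ⟨hΛc, N, hN⟩ := (isSchatten_iff hn1).mp hΛ
  obtain ⟨b, hb0, hb, hbb⟩ := exists_opExterior_bounds hn1 hΛc hN
  refine ⟨fun ν => M * b ν ^ (n : ℝ)⁻¹, ?_, fun ν =>
    opTensor_bound hn1 hGc (hbb ν).1 hM (hbb ν).2⟩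
  refine (hb.mul_left (M ^ n)).congr fun ν => ?_
  rw [mul_pow, Real.rpow_inv_natCast_pow (hb0 ν) (by omega)]

theorem normallyConvergent_factorDet (hn : 1 ≤ n) (hG : IsSchatten n G) (hΛ : IsSchatten n Λ) :
    NormallyConvergent fun ν : DimIndex H₀ => factorDet n G Λ ν := by
  obtain ⟨M, hM, h⟩ := exists_factor_bounds hn hG hΛ
  exact normallyConvergent_regDet hn (fun ν : DimIndex H₀ => (h ν).1) (fun ν => (h ν).2)
    (hM.comp_injective Subtype.val_injective)

/-- Near the origin, the zeta function is given by the product formula. -/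
theorem exists_zetaR_eq (hn : 1 ≤ n) (hG : IsSchatten n G) (hΛ : IsSchatten n Λ) {Z : ℕ → ℂ}
    (hZ : ∀ m, n ≤ m → Z m = fredholmDet (Λ ^ m) * trace (G ^ m)) :
    ∃ r > 0, ∀ z : ℂ, ‖z‖ < r →
      (Summable fun m : ℕ+ => z ^ (m : ℕ) / (m : ℂ) * Z m) ∧
      (∀ ν, factorDet n G Λ ν z ≠ 0) ∧
      zetaR Z z = Complex.exp (∑ m ∈ Finset.Ico 1 n, z ^ m / (m : ℂ) * Z m) *
        ∏' ν : DimIndex H₀, factorDet n G Λ ν z ^ ((-1 : ℤ) ^ ((ν : ℕ) + 1)) := by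
  have hn1 : (1 : ℝ) ≤ n := by exact_mod_cast hn
  obtain ⟨M, hM, h⟩ := exists_factor_bounds hn hG hΛ
  obtain ⟨hGc, B, hB⟩ := (isSchatten_iff hn1).mp hG
  obtain ⟨hΛc, B', hB'⟩ := (isSchatten_iff hn1).mp hΛ
  have hs0 : 0 ≤ ∑' ν, M ν ^ n := tsum_nonneg fun ν => pow_nonneg (h ν).2.1 n
  -- A bound uniform in `ν`: either `M ν ≤ 1`, or `M ν ≤ M ν ^ n`, which is a term of the series. It
  -- gives one radius `1 / (2 * C)` on which all factors have their exponential form.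
  have hMs : ∀ ν, M ν ≤ 1 + ∑' ν, M ν ^ n := fun ν => by
    have h1 : M ν ^ n ≤ ∑' ν, M ν ^ n := hM.le_tsum ν fun μ _ => pow_nonneg (h μ).2.1 n
    rcases le_total (M ν) 1 with hν | hν
    · linarith
    · linarith [le_self_pow₀ hν (show n ≠ 0 by omega)]
  set C := 1 + ∑' ν, M ν ^ n
  have hC : 0 < C := by positivity
  refine ⟨1 / (2 * C), by positivity, fun z hz => ?_⟩
  have hzM : ∀ ν, ‖z‖ * M ν ≤ 1 / 2 := fun ν => by
    rw [lt_div_iff₀ (by positivity)] at hz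
    have := mul_le_mul_of_nonneg_left (hMs ν) (norm_nonneg z)
    linarith
  have hexp : ∀ ν, factorDet n G Λ ν z
      = Complex.exp (-tailSum n (z • opTensor G (opExterior ν Λ))) := fun ν =>
    regDet_smul_eq_exp hn (h ν).1 (h ν).2 (hzM ν)
  have hZs : ∀ m, n ≤ m → HasSum (fun ν : DimIndex H₀ =>
      (-1) ^ (ν : ℕ) * trace (opTensor G (opExterior ν Λ) ^ m)) (Z m) := fun m hm => by
    rw [hZ m hm]
    exact hasSum_trace_opTensor_opExterior hn hm hGc hΛc hB hB'
  obtain ⟨S, hS, hS'⟩ := hasSum_tailSum hn (fun ν : DimIndex H₀ => (h ν).1) (fun ν => (h ν).2)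
    (hM.comp_injective Subtype.val_injective) (fun ν => (ν : ℕ)) hZs fun ν => hzM ν
  have hsum := hasSum_pnat_of_tail hn hS'
  refine ⟨hsum.summable, fun ν => by rw [hexp]; exact Complex.exp_ne_zero _, ?_⟩
  rw [zetaR, hsum.tsum_eq, Complex.exp_add]
  exact congrArg _ (hasProd_zpow_of_exp hS fun ν : DimIndex H₀ => hexp ν).tprod_eq.symm

end Zeta

end DynZeta

/-! ### The meromorphic continuation -/

theorem corollary2p2
    {H : Type*} [NormedAddCommGroup H] [InnerProductSpace ℂ H] [CompleteSpace H]
    {H₀ : Type*} [NormedAddCommGroup H₀] [InnerProductSpace ℂ H₀] [CompleteSpace H₀]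
    (n₀ : ℕ) (hn₀ : 1 ≤ n₀)
    (G : H →L[ℂ] H) (hG : DynZeta.IsSchatten n₀ G)
    (Λ : H₀ →L[ℂ] H₀) (hΛ : DynZeta.IsSchatten n₀ Λ)
    (Z : ℕ → ℂ)
    (hZ : ∀ n, n₀ ≤ n → Z n = DynZeta.fredholmDet (Λ ^ n) * DynZeta.trace (G ^ n)) :
    -- the operators `G ⊗ ∧^ν Λ` are in the Schatten class and their determinants are entire
    (∀ ν, DynZeta.IsSchatten n₀ (DynZeta.opTensor G (DynZeta.opExterior ν Λ))) ∧
    (∀ ν, Differentiable ℂ (DynZeta.factorDet n₀ G Λ ν)) ∧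
    -- the product of the determinants converges absolutely and locally uniformly
    SummableLocallyUniformlyOn
      (fun (ν : DynZeta.DimIndex H₀) (z : ℂ) => ‖DynZeta.factorDet n₀ G Λ ν z - 1‖) Set.univ ∧
    -- the zeros of the factors in the denominator form a closed discrete set
    (∀ᶠ z in Filter.codiscrete ℂ,
      ∀ ν : DynZeta.DimIndex H₀, Even (ν : ℕ) → DynZeta.factorDet n₀ G Λ ν z ≠ 0) ∧
    -- the meromorphic continuation, given by the product formula outside these zeros
    ∃ F : ℂ → ℂ, Meromorphic F ∧
      (∃ r > 0, ∀ z : ℂ, ‖z‖ < r →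
        Summable (fun n : ℕ+ => z ^ (n : ℕ) / (n : ℂ) * Z n) ∧ F z = DynZeta.zetaR Z z) ∧
      ∀ z : ℂ,
        (∀ ν : DynZeta.DimIndex H₀, Even (ν : ℕ) → DynZeta.factorDet n₀ G Λ ν z ≠ 0) →
        Multipliable (fun ν : DynZeta.DimIndex H₀ =>
          DynZeta.factorDet n₀ G Λ ν z ^ ((-1 : ℤ) ^ ((ν : ℕ) + 1))) ∧
        F z = Complex.exp (∑ n ∈ Finset.Ico 1 n₀, z ^ n / (n : ℂ) * Z n) *
          ∏' ν : DynZeta.DimIndex H₀,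
            DynZeta.factorDet n₀ G Λ ν z ^ ((-1 : ℤ) ^ ((ν : ℕ) + 1)) := by
  have hn : (1 : ℝ) ≤ n₀ := by exact_mod_cast hn₀
  obtain ⟨M, -, hM⟩ := DynZeta.exists_factor_bounds hn₀ hG hΛ
  have hD : ∀ ν, Differentiable ℂ (DynZeta.factorDet n₀ G Λ ν) := fun ν =>
    DynZeta.differentiable_regDet hn₀ (hM ν).1 (hM ν).2
  have hconv := DynZeta.normallyConvergent_factorDet hn₀ hG hΛ
  refine ⟨fun ν => (DynZeta.isSchatten_iff hn).mpr ⟨(hM ν).1, M ν, (hM ν).2⟩, hD,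
    hconv.summableLocallyUniformlyOn, ?_, ?_⟩
  -- Each factor is `1` at the origin, so even the zeros of all factors together, of either parity,
  -- form a closed discrete set.
  · have h0 : ∀ ν : DynZeta.DimIndex H₀, DynZeta.factorDet n₀ G Λ ν 0 ≠ 0 := fun ν => by
      rw [DynZeta.factorDet, zero_smul, DynZeta.regDet_zero hn₀]
      exact one_ne_zero
    filter_upwards [hconv.eventually_ne_zero (fun ν => hD ν) h0] with z hz ν _
    exact hz ν
  · obtain ⟨P, hP, hPz⟩ := hconv.exists_meromorphic (fun ν => hD ν) fun ν => (ν : ℕ)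
    obtain ⟨r, hr, hrz⟩ := DynZeta.exists_zetaR_eq hn₀ hG hΛ hZ
    refine ⟨fun z => Complex.exp (∑ n ∈ Finset.Ico 1 n₀, z ^ n / (n : ℂ) * Z n) * P z,
      fun z => ?_, ⟨r, hr, fun z hz => ?_⟩, fun z hz => ?_⟩
    · have h1 : Differentiable ℂ fun z : ℂ =>
          Complex.exp (∑ n ∈ Finset.Ico 1 n₀, z ^ n / (n : ℂ) * Z n) := by
        fun_prop
      exact (h1.analyticAt z).meromorphicAt.fun_mul (hP z)
    -- Near the origin no factor vanishes, so the global quotient equals the product there and hence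
    -- the zeta function.
    · obtain ⟨h1, h2, h3⟩ := hrz z hz
      exact ⟨h1, by rw [h3, (hPz z fun ν _ => h2 ν).tprod_eq]⟩
    · exact ⟨(hPz z hz).multipliable, by rw [(hPz z hz).tprod_eq]⟩
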